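/- **Setting.** Let $(\Omega,\mathcal F,(\mathcal F_t)_{t\ge0},\mathrm P)$ be a filtered probability space and $\lambda,\delta,\alpha>0$. Claims arrive at times $0=T_0<T_1<T_2<\cdots\to\infty$ with i.i.d. exponential interarrival times of mean $1/\lambda$; the claim sizes $Y_1,Y_2,\dots\ge 0$ are i.i.d. exponential with mean $1/\alpha$ and independent of the arrival times. Put $N(t)=\#\{i\ge1:T_i\le t\}$ and $S(t)=\sum_{i=1}^{N(t)}Y_i$; $N$ and $S$ are adapted and for $s\le t$ the increment $(N(t)-N(s),S(t)-S(s))$ is independent of $\mathcal F_s$. Let $g:\mathbb R\to\mathbb R$ be Lipschitz continuous with $g\ge0$ on $[0,\infty)$. For initial surplus $x\ge 0$, an *admissible control* is an adapted, nondecreasing, càdlàg process $D$ with $D(0-)=0$ whose controlled surplus $X$, given by $X(0-)=x$ and $$X(t)=x+\int_0^t g(X(s))\,ds-S(t)-D(t),\qquad t\ge0,$$ satisfies $\Delta D(t)\le X(t-)$ for all $0\le t\le\tau$, where $\Delta D(t)=D(t)-D(t-)$ and $\tau=\inf\{t\ge0:X(t)<0\}$ is the ruin time. Its expected present value of dividends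 is $J(x,D)=\mathrm E\int_{[0,\tau)}e^{-\delta t}\,dD(t)$ (a payment at time $0$ is included, a payment at the ruin time itself is not), and $V(x)=\sup_D J(x,D)$ over all admissible controls. **Hypothesis B.** The function $\psi$ is continuous and strictly increasing on $[0,\infty)$, continuously differentiable on $(0,\infty)$, and satisfies $$g(x)\psi'(x)-(\lambda+\delta)\psi(x)+\lambda\int_0^x\psi(x-y)\,\alpha e^{-\alpha y}\,dy=0,\qquad x>0;$$ moreover $\psi'$ attains its minimum over $(0,\infty)$ at a point $b>0$ and is nondecreasing on $(b,\infty)$. Put $$\Phi(x)=\begin{cases}\psi(x)/\psi'(b),&x\le b,\\ x-b+\psi(b)/\psi'(b),&x>b.\end{cases}$$ **Barrier strategy at level $b$.** This is the control $D^*$, with surplus $X^*$, such that at every $t\ge0$ any excess over $b$ of the surplus available just before the payment is paid out at once, $$\Delta D^*(t)=\max\{X^*(t)+\Delta D^*(t)-b,\,0\},$$ and the continuous part pays at rate $g(b)$ exactly while the surplus equals $b$, $$D^*(t)-\sum_{0\le s\le t}\Delta D^*(s)=\int_0^t g(b)\,\mathbf 1_{\{X^*(s)=b\}}\,ds .$$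 **Theorem 4.4.** Assume the above setting and Hypothesis B, and let $x\ge0$. Then an admissible barrier strategy at level $b$ exists. Every admissible barrier strategy $D^*$ at level $b$ is optimal, and its value is $\Phi$: $$J(x,D^*)=\Phi(x)=V(x).$$ Under it, $X^*(t)\le b$ for all $t\ge0$, and once the surplus equals $b$ it stays equal to $b$ until the next claim. -/

import Mathlib

open MeasureTheory ProbabilityTheory Set Filter Topology
open scoped NNReal ENNReal

noncomputable section

namespace DividendModel

/-- Number of claims up to time `t`; the `(i+1)`-st claim arrives at time `T (i+1)`. -/
def claimCount {Ω : Type*} (T : ℕ → Ω → ℝ) (t : ℝ) (ω : Ω) : ℕ :=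
  Set.ncard {i : ℕ | T (i + 1) ω ≤ t}

/-- Aggregate claims up to time `t`; `Y i` is the size of the claim that arrives at `T (i+1)`. -/
def aggregateClaims {Ω : Type*} (T Y : ℕ → Ω → ℝ) (t : ℝ) (ω : Ω) : ℝ :=
  ∑ i ∈ Finset.range (claimCount T t ω), Y i ω

/-- A compound Poisson claim process with intensity `lam` and exponential claims of rate `α`
(mean `1/α`), relative to the filtration `ℱ`: it is adapted and its increments after time `s`
are independent of `ℱ s`. -/
structure IsClaimProcess {Ω : Type*} [mΩ : MeasurableSpace Ω] (P : Measure Ω)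
    (ℱ : Filtration ℝ≥0 mΩ) (lam α : ℝ) (T Y : ℕ → Ω → ℝ) : Prop where
  measurable_T : ∀ i, Measurable (T i)
  measurable_Y : ∀ i, Measurable (Y i)
  T_zero : ∀ ω, T 0 ω = 0
  T_strictMono : ∀ ω, StrictMono fun i => T i ω
  T_tendsto : ∀ ω, Tendsto (fun i => T i ω) atTop atTop
  Y_nonneg : ∀ i ω, 0 ≤ Y i ω
  law_interarrival : ∀ i, P.map (fun ω => T (i + 1) ω - T i ω) = expMeasure lam
  law_Y : ∀ i, P.map (Y i) = expMeasure α
  /-- interarrival times and claim sizes are all mutually independent -/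
  indep : iIndepFun
    (Sum.elim (fun (i : ℕ) (ω : Ω) => T (i + 1) ω - T i ω) Y : ℕ ⊕ ℕ → Ω → ℝ) P
  adapted_count : ∀ t : ℝ≥0, Measurable[ℱ t] (claimCount T (t : ℝ))
  adapted_claims : ∀ t : ℝ≥0, Measurable[ℱ t] (aggregateClaims T Y (t : ℝ))
  indep_increments : ∀ s t : ℝ≥0, s ≤ t →
    Indep (ℱ s) (MeasurableSpace.comap (fun ω =>
      (((claimCount T t ω : ℝ) - (claimCount T s ω : ℝ),
        aggregateClaims T Y t ω - aggregateClaims T Y s ω) : ℝ × ℝ)) inferInstance) P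

/-- The jump `f(t) - f(t-)` of a path indexed by the real line. -/
def jump (f : ℝ → ℝ) (t : ℝ) : ℝ := f t - Function.leftLim f t

/-- Ruin time `inf {t ≥ 0 : X(t) < 0}`, with `inf ∅ = +∞`. -/
def ruinTime (X : ℝ → ℝ) : EReal := sInf {s : EReal | ∃ t : ℝ, 0 ≤ t ∧ X t < 0 ∧ s = (t : EReal)}

/-- `D` is an admissible aggregate dividend process for initial surplus `x`, and `X` is the
corresponding controlled surplus. A path of `D` is a nondecreasing right-continuous function.
Paths are extended to negative times by `D(t) = 0` and `X(t) = x`, which encodes `D(0-) = 0`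
and `X(0-) = x`; a payment `D(0) > 0` at time zero is allowed. -/
structure IsAdmissible {Ω : Type*} [mΩ : MeasurableSpace Ω]
    (ℱ : Filtration ℝ≥0 mΩ) (g : ℝ → ℝ) (T Y : ℕ → Ω → ℝ) (x : ℝ)
    (D : Ω → StieltjesFunction ℝ) (X : Ω → ℝ → ℝ) : Prop where
  D_neg : ∀ ω t, t < 0 → D ω t = 0
  X_neg : ∀ ω t, t < 0 → X ω t = x
  adapted_D : ∀ t : ℝ≥0, Measurable[ℱ t] fun ω => D ω (t : ℝ)
  adapted_X : ∀ t : ℝ≥0, Measurable[ℱ t] fun ω => X ω (t : ℝ)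
  integrable : ∀ ω t, 0 ≤ t → IntervalIntegrable (fun s => g (X ω s)) volume 0 t
  surplus : ∀ ω t, 0 ≤ t →
    X ω t = x + (∫ s in (0 : ℝ)..t, g (X ω s)) - aggregateClaims T Y t ω - D ω t
  /-- up to ruin, no payment exceeds the surplus just before it -/
  jump_le : ∀ ω (t : ℝ), 0 ≤ t → (t : EReal) ≤ ruinTime (X ω) →
    jump (D ω) t ≤ Function.leftLim (X ω) t

/-- Expected present value `E ∫_{[0,τ)} e^{-δt} dD(t)` of the dividends paid before ruin,
including a payment at time zero. -/
def epv {Ω : Type*} [MeasurableSpace Ω] (P : Measure Ω) (δ : ℝ)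
    (D : Ω → StieltjesFunction ℝ) (X : Ω → ℝ → ℝ) : ℝ≥0∞ :=
  ∫⁻ ω, ∫⁻ t in {t : ℝ | 0 ≤ t ∧ (t : EReal) < ruinTime (X ω)},
    ENNReal.ofReal (Real.exp (-δ * t)) ∂(D ω).measure ∂P

/-- The value function: supremum of the expected present value over all admissible controls. -/
def value {Ω : Type*} [mΩ : MeasurableSpace Ω] (P : Measure Ω) (ℱ : Filtration ℝ≥0 mΩ)
    (g : ℝ → ℝ) (δ : ℝ) (T Y : ℕ → Ω → ℝ) (x : ℝ) : ℝ≥0∞ :=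
  ⨆ (D : Ω → StieltjesFunction ℝ) (X : Ω → ℝ → ℝ) (_ : IsAdmissible ℱ g T Y x D X),
    epv P δ D X

/-- `D`, with controlled surplus `X`, is the barrier strategy at level `b`. The jump part pays
the excess over `b` of the surplus available just before the payment (that is, `X(t) + ΔD(t)`);
the continuous part `D(t) - ∑_{0 ≤ s ≤ t} ΔD(s)` grows at rate `g b` while the surplus equals `b`
and is constant otherwise. -/
structure IsBarrier {Ω : Type*} (g : ℝ → ℝ) (b : ℝ)
    (D : Ω → StieltjesFunction ℝ) (X : Ω → ℝ → ℝ) : Prop where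
  singular : ∀ ω t, 0 ≤ t → jump (D ω) t = max (X ω t + jump (D ω) t - b) 0
  continuous : ∀ ω t, 0 ≤ t →
    D ω t - ∑' s : Set.Icc (0 : ℝ) t, jump (D ω) (s : ℝ)
      = ∫ s in (0 : ℝ)..t, Set.indicator {s | X ω s = b} (fun _ => g b) s

/-- Generator of the surplus process with exponential claims, on functions vanishing on the
negative half-line. -/
def generator (g : ℝ → ℝ) (lam α : ℝ) (h : ℝ → ℝ) (x : ℝ) : ℝ :=
  g x * deriv h x - lam * h x
    + lam * ∫ y in (0 : ℝ)..x, h (x - y) * (α * Real.exp (-α * y))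

/-- `ψ` is a continuously differentiable, strictly increasing solution on `[0,∞)` of
`(A - δ) ψ = 0`, whose derivative attains its minimum at `b > 0` and is nondecreasing
on `(b,∞)`. -/
structure IsBarrierSolution (g : ℝ → ℝ) (lam δ α : ℝ) (ψ : ℝ → ℝ) (b : ℝ) : Prop where
  continuousOn : ContinuousOn ψ (Set.Ici 0)
  contDiffOn : ContDiffOn ℝ 1 ψ (Set.Ioi 0)
  equation : ∀ x, 0 < x → generator g lam α ψ x - δ * ψ x = 0
  strictMono : StrictMonoOn ψ (Set.Ici 0)
  b_pos : 0 < b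
  isMin : IsMinOn (deriv ψ) (Set.Ioi 0) b
  deriv_mono : MonotoneOn (deriv ψ) (Set.Ioi b)

/-- The candidate value function. -/
def candidate (ψ : ℝ → ℝ) (b x : ℝ) : ℝ :=
  if x ≤ b then ψ x / deriv ψ b else x - b + ψ b / deriv ψ b

end DividendModel

end

namespace DividendModel

/-! ### Calculus tools -/

/-! Write A for `claimAvg`, the mean of Φ after one exponential claim, and H = (λ+δ)Φ - λA for
`harmonicDrift`. The equation for ψ says gψ' = H (with ψ in place of Φ), and Φ inherits from it a
Hamilton-Jacobi-Bellman inequality: Φ has slope at least 1 on [0,∞), and gΦ' ≤ H, with equality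
below b, while H(b) = g(b). `IsVerification` collects these facts and
`IsBarrierSolution.isVerification` derives them. Slope at least 1 is the minimality of ψ'(b). The
delicate point is g ≤ H above b (`le_harmonicDrift_candidate`): since claims are exponential, A' =
α(Φ - A), so the derivative of exp(αz)H(z) contains no integral, and the comparison of Φ with ψ
becomes pointwise.

Slope at least 1 means that a unit of surplus is worth no less than a unit paid out. So the
discounted Φ(X) plus the discounted dividends paid before ruin behaves like a supermartingale under
every control, and like a martingale under the barrier strategy, which pays only where keeping and
paying are worth the same, and at b at the very rate H(b).

No stochastic calculus is used: time is cut into steps of mesh h. Path by path, the value after a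
step plus the dividends of the step is at most `stepValue` plus a small error (`step_upper`), and
for a barrier path at least `stepValue` minus a small error (`step_lower`). `stepValue` depends only
on the surplus at the start of the step and on the claim increment, which is independent of the
past. Up to O(h²), an increment contains one exponential claim with probability λh and none
otherwise (`abs_integral_claim_sub_le`), and H is the drift for which the mean of `stepValue` is
then exp(δh)Φ to first order (`step_le`, `le_step`). Summed over t/h steps, the quadratic errors are
O(h).

For a general control one error is h times D(t), whose integrability is not known. It vanishes path
by path, so the mesh limit is taken with Fatou's lemma, the claim count providing an integrable
lower bound (`sum_stepGain_ge`, `IsAdmissible.exists_majorant`, `IsAdmissible.epv_le`). For the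
barrier strategy all errors are deterministic, and the leftover exp(-δt)Φ(b) disappears as t grows
(`IsAdmissible.barrier_le_epv`).

The barrier strategy itself is the Skorokhod reflection of the surplus at b. It is the fixed point
of a map that contracts by 1/2 in an exponentially weighted sup norm (`reflectedPath_sub_le`); the
running supremum is then identified with the prescribed payments (`eventually_barrierDividends`,
`barrierDividends_eq`). -/

theorem integral_le_exp_weight {u : ℝ → ℝ} {s r m c : ℝ} (hc : 0 < c) (hsr : s ≤ r) (hm : 0 ≤ m)
    (hi : IntervalIntegrable u volume s r)
    (h : ∀ v ∈ Icc s r, u v ≤ m * Real.exp (c * (v - s))) :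
    ∫ v in s..r, u v ≤ m / c * Real.exp (c * (r - s)) := by
  have hcont : Continuous fun v : ℝ => m * Real.exp (c * (v - s)) := by fun_prop
  have h1 : ∫ v in s..r, u v ≤ ∫ v in s..r, m * Real.exp (c * (v - s)) :=
    intervalIntegral.integral_mono_on hsr hi (hcont.intervalIntegrable _ _) h
  have h2 : ∫ v in s..r, m * Real.exp (c * (v - s))
      = m / c * Real.exp (c * (r - s)) - m / c * Real.exp (c * (s - s)) := by
    refine intervalIntegral.integral_eq_sub_of_hasDerivAt
      (f := fun v => m / c * Real.exp (c * (v - s))) (fun v _ => ?_)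
      (hcont.intervalIntegrable _ _)
    refine (((((hasDerivAt_id' v).sub_const s).const_mul c).exp).const_mul (m / c)).congr_deriv ?_
    field_simp
  have h3 : 0 ≤ m / c * Real.exp (c * (s - s)) := by positivity
  linarith

/-- Surplus paths jump, so continuity of u is not assumed: integrability and an upper bound C
suffice. Inserting a bound with weight exp(c(r-s)) into the inequality gains K/c ≤ 1/2, so the
excess over 2a halves at each iteration. The case a = 0 gives u ≤ 0; it yields the absorption at 0,
the permanence at b and the survival of barrier paths. -/
theorem gronwall_integral {u : ℝ → ℝ} {s t a C K : ℝ} (hK : 0 ≤ K) (ha : 0 ≤ a)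
    (hi : IntervalIntegrable u volume s t) (hb : ∀ r ∈ Icc s t, u r ≤ C)
    (h : ∀ r ∈ Icc s t, u r ≤ a + K * ∫ v in s..r, u v) :
    ∀ r ∈ Icc s t, u r ≤ 2 * a * Real.exp ((2 * K + 1) * (r - s)) := by
  set c := 2 * K + 1 with hc
  have hc0 : 0 < c := by positivity
  have hexp : ∀ r ∈ Icc s t, 1 ≤ Real.exp (c * (r - s)) := fun r hr =>
    Real.one_le_exp (mul_nonneg hc0.le (by linarith [hr.1]))
  have key : ∀ n : ℕ, ∀ r ∈ Icc s t,
      u r ≤ (2 * a + |C| * (1 / 2) ^ n) * Real.exp (c * (r - s)) := by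
    intro n
    induction n with
    | zero =>
      intro r hr
      have h1 := hexp r hr
      have h2 : u r ≤ |C| := (hb r hr).trans (le_abs_self C)
      have h3 : 0 ≤ |C| := abs_nonneg C
      simp only [pow_zero, mul_one]
      nlinarith
    | succ n ih =>
      intro r hr
      have hsub : ∀ v ∈ Icc s r, v ∈ Icc s t := fun v hv => ⟨hv.1, hv.2.trans hr.2⟩
      have h1 := integral_le_exp_weight (u := u) hc0 hr.1
        (m := 2 * a + |C| * (1 / 2) ^ n) (by positivity)
        (hi.mono_set (by rw [uIcc_of_le hr.1, uIcc_of_le (hr.1.trans hr.2)]; exact hsub))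
        (fun v hv => ih v (hsub v hv))
      have h2 := h r hr
      have h3 := hexp r hr
      set E := Real.exp (c * (r - s))
      set m := |C| * (1 / 2) ^ n with hm
      have hm0 : 0 ≤ m := by positivity
      have h4 : K * ((2 * a + m) / c * E) ≤ (a + m / 2) * E := by
        have : K * ((2 * a + m) / c) ≤ a + m / 2 := by
          rw [mul_div_assoc', div_le_iff₀ hc0, hc]
          nlinarith
        calc K * ((2 * a + m) / c * E) = K * ((2 * a + m) / c) * E := by ring
          _ ≤ _ := by gcongr
      have h5 : K * ∫ v in s..r, u v ≤ K * ((2 * a + m) / c * E) := by gcongr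
      have h6 : |C| * (1 / 2) ^ (n + 1) = m / 2 := by rw [hm, pow_succ]; ring
      rw [h6]
      nlinarith
  intro r hr
  have hlim : Tendsto (fun n : ℕ => (2 * a + |C| * (1 / 2 : ℝ) ^ n) * Real.exp (c * (r - s)))
      atTop (𝓝 ((2 * a + |C| * 0) * Real.exp (c * (r - s)))) := by
    refine Tendsto.mul_const _ (Tendsto.const_add _ (Tendsto.const_mul _ ?_))
    exact tendsto_pow_atTop_nhds_zero_of_lt_one (by norm_num) (by norm_num)
  have := ge_of_tendsto' hlim (fun n => key n r hr)
  simpa using this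

/-- Continuous induction: a function that locally grows to the right at most at rate `0` and
does not jump upwards from the left is bounded by its initial value. -/
theorem le_of_local_right_le {F : ℝ → ℝ} {s u : ℝ} (hsu : s ≤ u)
    (hr : ∀ r ∈ Ico s u, ∀ ε > 0, ∀ᶠ v in 𝓝[>] r, F v ≤ F r + ε * (v - r))
    (hl : ∀ r ∈ Ioc s u, ∀ ε > 0, ∀ᶠ v in 𝓝[<] r, F r ≤ F v + ε) : F u ≤ F s := by
  suffices H : ∀ ε > 0, F u ≤ F s + ε * (u - s) by
    refine le_of_forall_pos_le_add fun η hη => ?_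
    have h1 := H (η / (u - s + 1)) (by have : 0 ≤ u - s := by linarith
                                       positivity)
    have h2 : η / (u - s + 1) * (u - s) ≤ η := by
      have : 0 ≤ u - s := by linarith
      rw [div_mul_eq_mul_div, div_le_iff₀ (by linarith)]
      nlinarith
    linarith
  intro ε hε
  set S : Set ℝ := {r | r ∈ Icc s u ∧ ∀ v ∈ Icc s r, F v ≤ F s + ε * (v - s)} with hS
  have hsS : s ∈ S := by
    refine ⟨⟨le_rfl, hsu⟩, fun v hv => ?_⟩
    have : v = s := le_antisymm hv.2 hv.1
    simp [this]
  have hbdd : BddAbove S := ⟨u, fun r hr => hr.1.2⟩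
  set c := sSup S with hc
  have hsc : s ≤ c := le_csSup hbdd hsS
  have hcu : c ≤ u := csSup_le ⟨s, hsS⟩ fun r hr => hr.1.2
  have hlt : ∀ v ∈ Ico s c, F v ≤ F s + ε * (v - s) := by
    intro v hv
    obtain ⟨r, hrS, hvr⟩ := exists_lt_of_lt_csSup ⟨s, hsS⟩ hv.2
    exact hrS.2 v ⟨hv.1, hvr.le⟩
  have hcval : F c ≤ F s + ε * (c - s) := by
    rcases hsc.eq_or_lt with h | h
    · simp [← h]
    · refine le_of_forall_pos_le_add fun η hη => ?_
      have h1 := hl c ⟨h, hcu⟩ η hη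
      have h2 : ∀ᶠ v in 𝓝[<] c, v ∈ Ico s c := by
        filter_upwards [Ioo_mem_nhdsLT h] with v hv using ⟨hv.1.le, hv.2⟩
      obtain ⟨v, hv1, hv2⟩ := (h1.and h2).exists
      have := hlt v hv2
      nlinarith [hv2.2]
  have hcle : ∀ v ∈ Icc s c, F v ≤ F s + ε * (v - s) := by
    intro v hv
    rcases hv.2.eq_or_lt with h | h
    · rw [h]; exact hcval
    · exact hlt v ⟨hv.1, h⟩
  rcases hcu.eq_or_lt with h | h
  · rw [← h]; exact hcval
  · exfalso
    -- If c < u, the right growth condition at c extends the linear bound past the supremum.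
    have h1 := hr c ⟨hsc, h⟩ ε hε
    obtain ⟨d, hd, hd'⟩ := (mem_nhdsGT_iff_exists_Ioo_subset).1 (h1.and (Ioo_mem_nhdsGT h))
    have hcd : c < d := hd
    set w := (c + d) / 2 with hw
    have hwS : w ∈ S := by
      have hw' := (hd' (show w ∈ Ioo c d from ⟨by linarith, by linarith⟩)).2
      refine ⟨⟨by linarith, hw'.2.le⟩, fun v hv => ?_⟩
      rcases le_or_gt v c with hvc | hvc
      · exact hcle v ⟨hv.1, hvc⟩
      · have := (hd' (show v ∈ Ioo c d from ⟨hvc, by linarith [hv.2]⟩)).1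
        nlinarith
    have := le_csSup hbdd hwS
    linarith

/-! ### Paths of the claim process -/

/-- A nondecreasing step path on `[0,∞)` with locally finitely many jumps. -/
structure IsClaimPath (S : ℝ → ℝ) : Prop where
  mono : Monotone S
  zero : S 0 = 0
  right_const : ∀ t, 0 ≤ t → ∃ u, t < u ∧ ∀ r ∈ Ico t u, S r = S t
  left_const : ∀ t, 0 < t → ∃ s, 0 ≤ s ∧ s < t ∧ ∀ r ∈ Ico s t, S r = S s

section ClaimPaths

variable {Ω : Type*} {T Y : ℕ → Ω → ℝ} {ω : Ω}

theorem claimCount_eq {n : ℕ} {t : ℝ} (hT : StrictMono fun i => T i ω) (h1 : T n ω ≤ t)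
    (h2 : t < T (n + 1) ω) : claimCount T t ω = n := by
  have : {i : ℕ | T (i + 1) ω ≤ t} = ↑(Finset.range n) := by
    ext i
    simp only [mem_ofPred_eq, Finset.coe_range, mem_Iio]
    constructor
    · intro h
      have := hT.lt_iff_lt.1 (h.trans_lt h2 : T (i + 1) ω < T (n + 1) ω)
      omega
    · intro h
      exact (hT.monotone (by omega : i + 1 ≤ n)).trans h1
  rw [claimCount, this, Set.ncard_coe_finset, Finset.card_range]

theorem exists_mem_interarrival {t : ℝ} (h0 : T 0 ω = 0) (ht : 0 ≤ t)
    (hlim : Tendsto (fun i => T i ω) atTop atTop) : ∃ n, T n ω ≤ t ∧ t < T (n + 1) ω := by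
  classical
  have hex : ∃ n, t < T n ω := (hlim.eventually (eventually_gt_atTop t)).exists
  have hne : Nat.find hex ≠ 0 := fun h => by
    have := Nat.find_spec hex
    rw [h, h0] at this
    linarith
  obtain ⟨m, hm⟩ := Nat.exists_eq_succ_of_ne_zero hne
  refine ⟨m, not_lt.1 (Nat.find_min hex (m := m) (by omega)), ?_⟩
  have := Nat.find_spec hex
  rwa [hm] at this

theorem setOf_claims_finite (hlim : Tendsto (fun i => T i ω) atTop atTop) (t : ℝ) :
    {i : ℕ | T (i + 1) ω ≤ t}.Finite := by
  obtain ⟨n, hn⟩ := (hlim.eventually (eventually_gt_atTop t)).exists_forall_of_atTop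
  refine (Set.finite_Iio n).subset fun i hi => ?_
  by_contra h
  have h' : n ≤ i := not_lt.1 h
  have h1 := hn (i + 1) (by omega)
  have h2 : T (i + 1) ω ≤ t := hi
  linarith

theorem claimCount_mono (hlim : Tendsto (fun i => T i ω) atTop atTop) :
    Monotone fun t => claimCount T t ω := fun _ t hst =>
  Set.ncard_le_ncard (fun _ hi => le_trans hi hst) (setOf_claims_finite hlim t)

theorem claimCount_right_const {t : ℝ} (h0 : T 0 ω = 0) (hT : StrictMono fun i => T i ω)
    (hlim : Tendsto (fun i => T i ω) atTop atTop) (ht : 0 ≤ t) :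
    ∃ u, t < u ∧ ∀ r ∈ Ico t u, claimCount T r ω = claimCount T t ω := by
  obtain ⟨n, h1, h2⟩ := exists_mem_interarrival h0 ht hlim
  refine ⟨T (n + 1) ω, h2, fun r hr => ?_⟩
  rw [claimCount_eq hT h1 h2, claimCount_eq hT (h1.trans hr.1) hr.2]

theorem claimCount_left_const {t : ℝ} (h0 : T 0 ω = 0) (hT : StrictMono fun i => T i ω)
    (hlim : Tendsto (fun i => T i ω) atTop atTop) (ht : 0 < t) :
    ∃ s, 0 ≤ s ∧ s < t ∧ ∀ r ∈ Ico s t, claimCount T r ω = claimCount T s ω := by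
  obtain ⟨n, h1, h2⟩ := exists_mem_interarrival h0 ht.le hlim
  have hpos : ∀ m, 0 ≤ T m ω := fun m => by
    have := hT.monotone (Nat.zero_le m)
    simp only [h0] at this
    exact this
  have aux : ∀ m, T m ω < t → t ≤ T (m + 1) ω →
      ∃ s, 0 ≤ s ∧ s < t ∧ ∀ r ∈ Ico s t, claimCount T r ω = claimCount T s ω := by
    intro m hm hm'
    refine ⟨T m ω, hpos m, hm, fun r hr => ?_⟩
    rw [claimCount_eq hT hr.1 (hr.2.trans_le hm'), claimCount_eq hT le_rfl (hm.trans_le hm')]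
  rcases h1.eq_or_lt with h | h
  · cases n with
    | zero => rw [h0] at h; exact absurd h ht.ne
    | succ m => exact aux m (by rw [← h]; exact hT (Nat.lt_succ_self m)) h.ge
  · exact aux n h h2.le

theorem claimCount_zero (h0 : T 0 ω = 0) (hT : StrictMono fun i => T i ω) :
    claimCount T 0 ω = 0 :=
  claimCount_eq hT h0.le (by have := hT (Nat.zero_lt_one); simp only [h0] at this; simpa using this)

theorem isClaimPath_aggregateClaims (h0 : T 0 ω = 0) (hT : StrictMono fun i => T i ω)
    (hlim : Tendsto (fun i => T i ω) atTop atTop) (hY : ∀ i, 0 ≤ Y i ω) :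
    IsClaimPath fun t => aggregateClaims T Y t ω where
  mono := fun s t hst => by
    refine Finset.sum_le_sum_of_subset_of_nonneg (fun i hi => ?_) (fun i _ _ => hY i)
    exact Finset.mem_range.2 ((Finset.mem_range.1 hi).trans_le (claimCount_mono hlim hst))
  zero := by simp [aggregateClaims, claimCount_zero h0 hT]
  right_const := fun t ht => by
    obtain ⟨u, hu, h⟩ := claimCount_right_const h0 hT hlim ht
    exact ⟨u, hu, fun r hr => by simp [aggregateClaims, h r hr]⟩
  left_const := fun t ht => by
    obtain ⟨s, hs, hst, h⟩ := claimCount_left_const h0 hT hlim ht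
    exact ⟨s, hs, hst, fun r hr => by simp [aggregateClaims, h r hr]⟩

end ClaimPaths

/-! ### Controlled paths -/

/-- A single path `X` of the surplus controlled by the dividend path `D`. -/
structure IsControlledPath (g : ℝ → ℝ) (x : ℝ) (S : ℝ → ℝ) (D : StieltjesFunction ℝ)
    (X : ℝ → ℝ) : Prop where
  claims : IsClaimPath S
  D_neg : ∀ t, t < 0 → D t = 0
  X_neg : ∀ t, t < 0 → X t = x
  integrable : ∀ t, 0 ≤ t → IntervalIntegrable (fun s => g (X s)) volume 0 t
  surplus : ∀ t, 0 ≤ t → X t = x + (∫ s in (0 : ℝ)..t, g (X s)) - S t - D t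

theorem IsAdmissible.isControlledPath {Ω : Type*} [mΩ : MeasurableSpace Ω] {P : Measure Ω}
    {ℱ : Filtration ℝ≥0 mΩ} {lam α : ℝ} {T Y : ℕ → Ω → ℝ} (hc : IsClaimProcess P ℱ lam α T Y)
    {g : ℝ → ℝ} {x : ℝ} {D : Ω → StieltjesFunction ℝ} {X : Ω → ℝ → ℝ}
    (h : IsAdmissible ℱ g T Y x D X) (ω : Ω) :
    IsControlledPath g x (fun t => aggregateClaims T Y t ω) (D ω) (X ω) where
  claims := isClaimPath_aggregateClaims (hc.T_zero ω) (hc.T_strictMono ω) (hc.T_tendsto ω)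
    (fun i => hc.Y_nonneg i ω)
  D_neg := h.D_neg ω
  X_neg := h.X_neg ω
  integrable := h.integrable ω
  surplus := h.surplus ω

namespace IsControlledPath

variable {g : ℝ → ℝ} {x : ℝ} {S : ℝ → ℝ} {D : StieltjesFunction ℝ} {X : ℝ → ℝ}

theorem integrable' (h : IsControlledPath g x S D X) {s r : ℝ} (hs : 0 ≤ s) (hsr : s ≤ r) :
    IntervalIntegrable (fun v => g (X v)) volume s r :=
  (h.integrable r (hs.trans hsr)).mono_set
    (by rw [uIcc_of_le hsr, uIcc_of_le (hs.trans hsr)]; exact Icc_subset_Icc_left hs)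

theorem increment (h : IsControlledPath g x S D X) {s r : ℝ} (hs : 0 ≤ s) (hsr : s ≤ r) :
    X r = X s + (∫ v in s..r, g (X v)) - (S r - S s) - (D r - D s) := by
  have h1 := h.surplus s hs
  have h2 := h.surplus r (hs.trans hsr)
  have h3 := intervalIntegral.integral_add_adjacent_intervals (h.integrable s hs)
    (h.integrable' hs hsr)
  linarith

theorem D_nonneg (h : IsControlledPath g x S D X) (t : ℝ) : 0 ≤ D t := by
  have h1 := D.mono (show min (t - 1) (-1) ≤ t from (min_le_left _ _).trans (by linarith))
  rw [h.D_neg _ ((min_le_right _ _).trans_lt (by norm_num))] at h1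
  exact h1

theorem continuousOn_drift (h : IsControlledPath g x S D X) :
    ContinuousOn (fun t => ∫ s in (0 : ℝ)..t, g (X s)) (Ici 0) := by
  intro t ht
  have ht0 : (0 : ℝ) ≤ t := ht
  have h1 := intervalIntegral.continuousOn_primitive_interval'
    (h.integrable (t + 1) (by linarith)) (left_mem_uIcc)
  rw [uIcc_of_le (by linarith)] at h1
  refine (h1 t ⟨ht0, by linarith⟩).mono_of_mem_nhdsWithin ?_
  filter_upwards [self_mem_nhdsWithin,
    mem_nhdsWithin_of_mem_nhds (Iio_mem_nhds (by linarith : t < t + 1))] with v hv hv'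
  exact ⟨hv, hv'.le⟩

theorem continuousWithinAt (h : IsControlledPath g x S D X) {t : ℝ} (ht : 0 ≤ t) :
    ContinuousWithinAt X (Ici t) t := by
  have h1 : ContinuousWithinAt (fun t => ∫ s in (0 : ℝ)..t, g (X s)) (Ici t) t :=
    (h.continuousOn_drift t ht).mono (Ici_subset_Ici.2 ht)
  have h2 : ContinuousWithinAt S (Ici t) t := by
    obtain ⟨u, hu, hS⟩ := h.claims.right_const t ht
    refine continuousWithinAt_const.congr_of_eventuallyEq
      (f := fun _ => S t) ?_ rfl
    filter_upwards [Ico_mem_nhdsGE hu] with v hv using hS v hv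
  have h3 := D.right_continuous t
  refine (((continuousWithinAt_const (b := x)).add h1).sub h2 |>.sub h3).congr ?_ ?_
  · intro v hv
    exact h.surplus v (ht.trans hv)
  · exact h.surplus t ht

theorem measurable (h : IsControlledPath g x S D X) : Measurable X := by
  have hG : Continuous fun t => ∫ s in (0 : ℝ)..(max t 0), g (X s) :=
    h.continuousOn_drift.comp_continuous (by fun_prop) (fun t => le_max_right t 0)
  have : X = fun t => if t < 0 then x
      else x + (∫ s in (0 : ℝ)..(max t 0), g (X s)) - S t - D t := by
    funext t
    split_ifs with ht
    · exact h.X_neg t ht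
    · rw [max_eq_left (not_lt.1 ht)]; exact h.surplus t (not_lt.1 ht)
  rw [this]
  exact Measurable.ite measurableSet_Iio measurable_const
    (((measurable_const.add hG.measurable).sub h.claims.mono.measurable).sub D.mono.measurable)

theorem bounded (h : IsControlledPath g x S D X) (t : ℝ) :
    ∃ C, ∀ r ∈ Icc 0 t, |X r| ≤ C := by
  obtain ⟨C, hC⟩ := isCompact_Icc.exists_bound_of_continuousOn
    (h.continuousOn_drift.mono (Icc_subset_Ici_self : Icc 0 t ⊆ Ici 0))
  refine ⟨|x| + C + S t + D t, fun r hr => ?_⟩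
  have h1 := hC r hr
  rw [Real.norm_eq_abs] at h1
  have h2 := h.claims.mono hr.1
  have h3 := h.claims.mono hr.2
  have h4 := h.D_nonneg r
  have h5 := D.mono hr.2
  have h6 := h.claims.zero
  rw [h.surplus r hr.1, abs_le]
  have h7 := abs_le.1 h1
  have h8 := neg_abs_le x
  have h9 := le_abs_self x
  constructor <;> linarith

theorem intervalIntegrable_comp (h : IsControlledPath g x S D X) {B : ℝ → ℝ} (hB : Continuous B)
    {s r : ℝ} (hs : 0 ≤ s) (hsr : s ≤ r) :
    IntervalIntegrable (fun v => B (X v)) volume s r := by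
  obtain ⟨C, hC⟩ := h.bounded r
  obtain ⟨C', hC'⟩ := (isCompact_Icc (a := -C) (b := C)).exists_bound_of_continuousOn
    hB.continuousOn
  rw [intervalIntegrable_iff_integrableOn_Ioc_of_le hsr]
  refine Measure.integrableOn_of_bounded (M := C') (by simp)
    (hB.measurable.comp h.measurable).aestronglyMeasurable ?_
  filter_upwards [ae_restrict_mem measurableSet_Ioc] with v hv
  exact hC' _ (abs_le.1 (hC v ⟨hs.trans hv.1.le, hv.2⟩))

theorem le_add_integral (h : IsControlledPath g x S D X) {s r : ℝ} (hs : 0 ≤ s) (hsr : s ≤ r) :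
    X r ≤ X s + ∫ v in s..r, g (X v) := by
  have h1 := h.increment hs hsr
  have h2 := h.claims.mono hsr
  have h3 := D.mono hsr
  linarith

end IsControlledPath

theorem LipschitzWith.le_add_mul {g : ℝ → ℝ} {K : ℝ≥0} (hg : LipschitzWith K g) (y z : ℝ) :
    g y ≤ g z + K * |y - z| := by
  have := hg.dist_le_mul y z
  rw [Real.dist_eq, Real.dist_eq] at this
  linarith [le_abs_self (g y - g z)]

/-- Deterministic bound, up to time `t`, of the surplus before ruin. -/
noncomputable def surplusBound (g : ℝ → ℝ) (K : ℝ≥0) (x t : ℝ) : ℝ :=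
  2 * (x + g 0 * t) * Real.exp ((2 * K + 1) * t)

/-- Claims and dividends only lower the surplus, so X ≤ x + ∫ g(X), and before ruin g(X) ≤ g(0) + KX
by the Lipschitz bound; Gronwall does the rest. Because this bound is deterministic, Φ is evaluated
on a fixed compact interval for all paths and all controls. -/
theorem IsControlledPath.le_surplusBound {g : ℝ → ℝ} {x : ℝ} {S : ℝ → ℝ} {D : StieltjesFunction ℝ}
    {X : ℝ → ℝ} (h : IsControlledPath g x S D X) {K : ℝ≥0} (hg : LipschitzWith K g)
    (hg0 : ∀ z, 0 ≤ z → 0 ≤ g z) (hx : 0 ≤ x) {s t : ℝ} (hs : 0 ≤ s) (hst : s ≤ t)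
    (hX : ∀ r ∈ Icc 0 s, 0 ≤ X r) : X s ≤ surplusBound g K x t := by
  have ht : 0 ≤ t := hs.trans hst
  have hg00 := hg0 0 le_rfl
  obtain ⟨C, hC⟩ := h.bounded s
  have h1 := gronwall_integral (u := X) (s := 0) (t := s) (a := x + g 0 * t) (C := C) (K := K)
    K.2 (by positivity) (h.intervalIntegrable_comp (B := id) continuous_id le_rfl hs)
    (fun r hr => (abs_le.1 (hC r hr)).2) (fun r hr => ?_) s ⟨hs, le_rfl⟩
  · refine h1.trans ?_
    rw [surplusBound]
    have : (0:ℝ) ≤ K := K.2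
    gcongr
    linarith
  · have h2 := h.surplus r hr.1
    have h3 := h.claims.mono hr.1
    have h4 := h.D_nonneg r
    rw [h.claims.zero] at h3
    have h5 : ∫ v in (0:ℝ)..r, g (X v) ≤ ∫ v in (0:ℝ)..r, (g 0 + K * X v) := by
      refine intervalIntegral.integral_mono_on hr.1 (h.integrable r hr.1) ?_ fun v hv => ?_
      · exact (h.intervalIntegrable_comp (B := fun y => g 0 + K * y) (by fun_prop) le_rfl hr.1)
      · have := LipschitzWith.le_add_mul hg (X v) 0
        rwa [sub_zero, abs_of_nonneg (hX v ⟨hv.1, hv.2.trans hr.2⟩)] at this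
    rw [intervalIntegral.integral_add (by simp)
      (h.intervalIntegrable_comp (B := fun y => K * y) (by fun_prop) le_rfl hr.1),
      intervalIntegral.integral_const, intervalIntegral.integral_const_mul] at h5
    have h6 : g 0 * r ≤ g 0 * t := mul_le_mul_of_nonneg_left (hr.2.trans hst) hg00
    simp only [sub_zero, smul_eq_mul] at h5
    nlinarith

/-! ### Verification functions -/

/-- Mean of `Φ` after an exponential claim at surplus `z`, the value after ruin being zero. -/
noncomputable def claimAvg (α : ℝ) (Φ : ℝ → ℝ) (z : ℝ) : ℝ :=
  ∫ y in (0 : ℝ)..z, Φ (z - y) * (α * Real.exp (-α * y))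

/-- The drift `g Φ'` that makes `Φ` harmonic for the discounted surplus process. -/
noncomputable def harmonicDrift (lam δ α : ℝ) (Φ : ℝ → ℝ) (z : ℝ) : ℝ :=
  (lam + δ) * Φ z - lam * claimAvg α Φ z

/-- The substitution takes z out of the integrand, so that the average can be differentiated for
merely continuous Φ. -/
theorem claimAvg_eq (α : ℝ) (Φ : ℝ → ℝ) (z : ℝ) :
    claimAvg α Φ z = Real.exp (-α * z) * ∫ y in (0 : ℝ)..z, Φ y * (α * Real.exp (α * y)) := by
  have h := intervalIntegral.integral_comp_sub_left
    (f := fun y => Φ y * (α * Real.exp (-α * (z - y)))) (a := 0) (b := z) z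
  simp only [sub_sub_cancel, sub_self, sub_zero] at h
  rw [claimAvg, h, ← intervalIntegral.integral_const_mul]
  congr 1
  funext y
  rw [show -α * (z - y) = -α * z + α * y by ring, Real.exp_add]
  ring

theorem claimAvg_congr {α : ℝ} {Φ Φ' : ℝ → ℝ} {z : ℝ} (hz : 0 ≤ z)
    (h : ∀ y ∈ Icc 0 z, Φ y = Φ' y) : claimAvg α Φ z = claimAvg α Φ' z := by
  refine intervalIntegral.integral_congr fun y hy => ?_
  rw [uIcc_of_le hz] at hy
  rw [h (z - y) ⟨by linarith [hy.2], by linarith [hy.1]⟩]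

/-- This local equation for a nonlocal average is where the exponential form of the claims enters
the analysis of Φ. -/
theorem hasDerivAt_claimAvg {α : ℝ} {Φ : ℝ → ℝ} (hΦ : Continuous Φ) (z : ℝ) :
    HasDerivAt (claimAvg α Φ) (α * (Φ z - claimAvg α Φ z)) z := by
  have hc : Continuous fun y => Φ y * (α * Real.exp (α * y)) := by fun_prop
  have h1 := intervalIntegral.integral_hasDerivAt_right (hc.intervalIntegrable 0 z)
    (hc.stronglyMeasurableAtFilter _ _) hc.continuousAt
  have h2 : HasDerivAt (fun z : ℝ => Real.exp (-α * z)) (Real.exp (-α * z) * (-α * 1)) z :=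
    ((hasDerivAt_id' z).const_mul (-α)).exp
  have h3 := h2.mul h1
  rw [show claimAvg α Φ = fun z => Real.exp (-α * z) *
    ∫ y in (0 : ℝ)..z, Φ y * (α * Real.exp (α * y)) from funext (claimAvg_eq α Φ)]
  refine h3.congr_deriv ?_
  have : Real.exp (-α * z) * Real.exp (α * z) = 1 := by
    rw [← Real.exp_add]; simp
  linear_combination (Φ z * α) * this

theorem continuous_claimAvg {α : ℝ} {Φ : ℝ → ℝ} (hΦ : Continuous Φ) :
    Continuous (claimAvg α Φ) :=
  continuous_iff_continuousAt.2 fun z => (hasDerivAt_claimAvg hΦ z).continuousAt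

theorem continuous_harmonicDrift {lam δ α : ℝ} {Φ : ℝ → ℝ} (hΦ : Continuous Φ) :
    Continuous (harmonicDrift lam δ α Φ) := by
  have := continuous_claimAvg (α := α) hΦ
  unfold harmonicDrift
  fun_prop

theorem integral_exp_density (α z : ℝ) :
    ∫ y in (0 : ℝ)..z, α * Real.exp (-α * y) = 1 - Real.exp (-α * z) := by
  have hc : Continuous fun y => α * Real.exp (-α * y) := by fun_prop
  rw [intervalIntegral.integral_eq_sub_of_hasDerivAt (f := fun y => -Real.exp (-α * y))
    (fun y _ => ?_) (hc.intervalIntegrable _ _)]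
  · simp; ring
  · refine (((hasDerivAt_id' y).const_mul (-α)).exp.neg).congr_deriv ?_
    ring

/-- The properties of the candidate value function that the verification argument uses. -/
structure IsVerification (g : ℝ → ℝ) (lam δ α b : ℝ) (Φ : ℝ → ℝ) : Prop where
  cont : Continuous Φ
  nonneg : ∀ z, 0 ≤ Φ z
  slope : ∀ y z, 0 ≤ y → y ≤ z → z - y ≤ Φ z - Φ y
  deriv_le : ∀ z, 0 ≤ z → 0 < g z →
    ∃ p, HasDerivWithinAt Φ p (Ici z) z ∧ g z * p ≤ harmonicDrift lam δ α Φ z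
  deriv_eq : ∀ z, 0 ≤ z → z < b → 0 < g z →
    ∃ p, HasDerivWithinAt Φ p (Ici z) z ∧ g z * p = harmonicDrift lam δ α Φ z
  drift_barrier : harmonicDrift lam δ α Φ b = g b
  g_pos : ∀ z, 0 < z → 0 < g z
  zero : g 0 = 0 → Φ 0 = 0
  b_pos : 0 < b

namespace IsVerification

variable {g : ℝ → ℝ} {lam δ α b : ℝ} {Φ : ℝ → ℝ}

theorem mono (h : IsVerification g lam δ α b Φ) : MonotoneOn Φ (Ici 0) := fun y hy z _ hyz => by
  have := h.slope y z hy hyz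
  linarith

theorem claimAvg_nonneg (h : IsVerification g lam δ α b Φ) (hα : 0 < α) {z : ℝ} (hz : 0 ≤ z) :
    0 ≤ claimAvg α Φ z :=
  intervalIntegral.integral_nonneg hz fun y _ => mul_nonneg (h.nonneg _) (by positivity)

theorem claimAvg_le (h : IsVerification g lam δ α b Φ) (hα : 0 < α) {z : ℝ} (hz : 0 ≤ z) :
    claimAvg α Φ z ≤ Φ z := by
  have hc := h.cont
  have h1 : claimAvg α Φ z ≤ ∫ y in (0 : ℝ)..z, Φ z * (α * Real.exp (-α * y)) := by
    refine intervalIntegral.integral_mono_on hz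
      (Continuous.intervalIntegrable (by fun_prop) _ _)
      (Continuous.intervalIntegrable (by fun_prop) _ _) fun y hy => ?_
    have := h.mono (show z - y ∈ Ici 0 by simpa using hy.2) hz (by linarith [hy.1])
    gcongr
  rw [intervalIntegral.integral_const_mul, integral_exp_density] at h1
  have := h.nonneg z
  have := Real.exp_pos (-α * z)
  nlinarith

/-- An average of a nondecreasing function over smaller arguments, with total mass at most 1, is at
most Φ(z); hence H ≥ δΦ ≥ 0. -/
theorem drift_nonneg (h : IsVerification g lam δ α b Φ) (hlam : 0 < lam) (hδ : 0 < δ) (hα : 0 < α)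
    {z : ℝ} (hz : 0 ≤ z) : 0 ≤ harmonicDrift lam δ α Φ z := by
  have h1 := h.claimAvg_le hα hz
  have h2 := h.nonneg z
  unfold harmonicDrift
  nlinarith

theorem drift_le (h : IsVerification g lam δ α b Φ) (hlam : 0 < lam) (hα : 0 < α)
    {z : ℝ} (hz : 0 ≤ z) : harmonicDrift lam δ α Φ z ≤ (lam + δ) * Φ z := by
  have h1 := h.claimAvg_nonneg hα hz
  unfold harmonicDrift
  nlinarith

/-- The derivative α(Φ - A) is at most αΦ(z) on [y,z]. So the average is Lipschitz even where Φ is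
not, and a lump payment changes it at most in proportion to the amount paid. -/
theorem claimAvg_sub_le (h : IsVerification g lam δ α b Φ) (hα : 0 < α) {y z : ℝ} (hy : 0 ≤ y)
    (hyz : y ≤ z) : claimAvg α Φ z - claimAvg α Φ y ≤ α * Φ z * (z - y) := by
  have hd := fun v => hasDerivAt_claimAvg (α := α) h.cont v
  refine (convex_Icc y z).image_sub_le_mul_sub_of_deriv_le
    (continuous_claimAvg h.cont).continuousOn
    (fun v _ => (hd v).differentiableAt.differentiableWithinAt) (fun v hv => ?_)
    y ⟨le_rfl, hyz⟩ z ⟨hyz, le_rfl⟩ hyz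
  rw [(hd v).deriv]
  rw [interior_Icc] at hv
  have h1 := h.claimAvg_nonneg hα (hy.trans hv.1.le)
  have h2 := h.mono (show v ∈ Ici 0 from hy.trans hv.1.le) (show z ∈ Ici 0 from hy.trans hyz) hv.2.le
  nlinarith

/-- Only a modulus of continuity is available, since no derivative of Φ at 0 is provided when g(0) =
0. -/
theorem exists_modulus (h : IsVerification g lam δ α b Φ) (M : ℝ) {ε : ℝ} (hε : 0 < ε) :
    ∃ d > 0, ∀ y z, 0 ≤ y → y ≤ z → z ≤ M → z - y ≤ d → Φ z ≤ Φ y + ε := by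
  have := (isCompact_Icc (a := (0 : ℝ)) (b := M)).uniformContinuousOn_of_continuous
    h.cont.continuousOn
  obtain ⟨d, hd, hd'⟩ := Metric.uniformContinuousOn_iff.1 this ε hε
  refine ⟨d / 2, by positivity, fun y z hy hyz hz hd2 => ?_⟩
  have h1 := hd' z ⟨hy.trans hyz, hz⟩ y ⟨hy, hyz.trans hz⟩
    (by rw [Real.dist_eq, abs_of_nonneg (by linarith)]; linarith)
  rw [Real.dist_eq] at h1
  linarith [(abs_lt.1 h1).2]

end IsVerification

/-! ### Pathwise inequality between claims for a general control -/

theorem HasDerivWithinAt.eventually_abs_sub_le {f : ℝ → ℝ} {p r u : ℝ}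
    (h : HasDerivWithinAt f p (Icc r u) r) (hru : r < u) {ε : ℝ} (hε : 0 < ε) :
    ∀ᶠ v in 𝓝[>] r, |f v - f r - p * (v - r)| ≤ ε * (v - r) := by
  have h1 := (hasDerivWithinAt_iff_isLittleO.1 h).def hε
  have h2 : 𝓝[>] r ≤ 𝓝[Icc r u] r := by
    rw [← nhdsWithin_Ioc_eq_nhdsGT hru]
    exact nhdsWithin_mono _ Ioc_subset_Icc_self
  filter_upwards [h2 h1, self_mem_nhdsWithin] with v hv hrv
  have hrv' : r < v := hrv
  simpa [Real.norm_eq_abs, abs_of_pos (sub_pos.2 hrv'), mul_comm] using hv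

namespace IsControlledPath

variable {g : ℝ → ℝ} {x : ℝ} {S : ℝ → ℝ} {D : StieltjesFunction ℝ} {X : ℝ → ℝ}

theorem hasDerivWithinAt_integral_comp (h : IsControlledPath g x S D X) {B : ℝ → ℝ}
    (hB : Continuous B) {r : ℝ} (hr : 0 ≤ r) :
    HasDerivWithinAt (fun v => ∫ w in r..v, B (X w)) (B (X r)) (Ici r) r :=
  intervalIntegral.integral_hasDerivWithinAt_right (t := Ioi r)
    (f := fun w => B (X w)) (by simp)
    (hB.measurable.comp h.measurable).stronglyMeasurable.stronglyMeasurableAtFilter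
    ((hB.continuousAt.comp_continuousWithinAt (h.continuousWithinAt hr)).mono Ioi_subset_Ici_self)

theorem exists_drift_bound (h : IsControlledPath g x S D X) (hg : Continuous g) (t : ℝ) :
    ∃ C, 0 ≤ C ∧ ∀ s r, 0 ≤ s → s ≤ r → r ≤ t → |∫ v in s..r, g (X v)| ≤ C * (r - s) := by
  obtain ⟨C, hC⟩ := h.bounded t
  obtain ⟨C', hC'⟩ := (isCompact_Icc (a := -C) (b := C)).exists_bound_of_continuousOn
    hg.continuousOn
  refine ⟨max C' 0, le_max_right _ _, fun s r hs hsr hrt => ?_⟩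
  have h3 := intervalIntegral.norm_integral_le_of_norm_le_const (a := s) (b := r) (C := max C' 0)
    (f := fun w => g (X w)) (fun w hw => by
      rw [uIoc_of_le hsr] at hw
      exact (hC' _ (abs_le.1 (hC w ⟨hs.trans hw.1.le, hw.2.trans hrt⟩))).trans (le_max_left _ _))
  rwa [Real.norm_eq_abs, abs_of_nonneg (by linarith : 0 ≤ r - s)] at h3

/-- With g(0) = 0 and X ≥ 0 the income rate is at most KX, so Gronwall from the value 0 leaves no
room. This covers the only surplus level where g can vanish, at which `IsVerification` says nothing
about Φ'. -/
theorem eq_zero_of_absorbed (h : IsControlledPath g x S D X) {K : ℝ≥0} (hg : LipschitzWith K g)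
    (hg0 : g 0 = 0) {r u : ℝ} (hr : 0 ≤ r) (hXr : X r = 0) (hX : ∀ v ∈ Icc r u, 0 ≤ X v) :
    ∀ v ∈ Icc r u, X v = 0 := by
  intro v hv
  have hru : r ≤ u := hv.1.trans hv.2
  obtain ⟨C, hC⟩ := h.bounded u
  have hi : ∀ w, r ≤ w → IntervalIntegrable X volume r w := fun w hw =>
    h.intervalIntegrable_comp (B := id) continuous_id hr hw
  have h1 := gronwall_integral (u := X) (s := r) (t := u) (a := 0) (C := C) (K := K)
    K.2 le_rfl (hi u hru) (fun w hw => (abs_le.1 (hC w ⟨hr.trans hw.1, hw.2⟩)).2)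
    (fun w hw => ?_) v hv
  · simp only [mul_zero, zero_mul] at h1
    exact le_antisymm h1 (hX v hv)
  · have h2 := h.le_add_integral hr hw.1
    have h5 : ∫ v in r..w, g (X v) ≤ ∫ v in r..w, K * X v := by
      refine intervalIntegral.integral_mono_on hw.1 (h.integrable' hr hw.1)
        ((hi w hw.1).const_mul _) fun y hy => ?_
      have := LipschitzWith.le_add_mul hg (X y) 0
      rwa [sub_zero, abs_of_nonneg (hX y ⟨hy.1, hy.2.trans hw.2⟩), hg0, zero_add] at this
    rw [intervalIntegral.integral_const_mul] at h5
    linarith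

/-- Between claims and before ruin, dividends and the growth of `Φ` along the surplus are paid for
by the harmonic drift. -/
theorem value_add_dividends_le (h : IsControlledPath g x S D X) {K : ℝ≥0} (hg : LipschitzWith K g)
    (hgn : ∀ z, 0 ≤ z → 0 ≤ g z) {lam δ α b : ℝ} {Φ : ℝ → ℝ} (hΦ : IsVerification g lam δ α b Φ)
    (hlam : 0 < lam) (hδ : 0 < δ) (hα : 0 < α) {s u : ℝ} (hs : 0 ≤ s) (hsu : s ≤ u)
    (hS : S u = S s) (hX : ∀ v ∈ Icc s u, 0 ≤ X v) :
    Φ (X u) + (D u - D s) ≤ Φ (X s) + ∫ v in s..u, harmonicDrift lam δ α Φ (X v) := by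
  set B := harmonicDrift lam δ α Φ with hBdef
  have hB : Continuous B := continuous_harmonicDrift hΦ.cont
  have hSc : ∀ v ∈ Icc s u, S v = S s := fun v hv =>
    le_antisymm ((h.claims.mono hv.2).trans hS.le) (h.claims.mono hv.1)
  have hinc : ∀ v r, s ≤ v → v ≤ r → r ≤ u →
      X r + (D r - D v) = X v + ∫ w in v..r, g (X w) := fun v r hv hvr hr => by
    have h1 := h.increment (hs.trans hv) hvr
    have h2 := hSc v ⟨hv, hvr.trans hr⟩
    have h3 := hSc r ⟨hv.trans hvr, hr⟩
    linarith
  -- Slope at least 1: returning the dividends of (v,r] to the surplus raises Φ by at least their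
  -- amount. What remains is Φ at X(v) plus the income.
  have hstep : ∀ v r, s ≤ v → v ≤ r → r ≤ u →
      Φ (X r) + (D r - D v) ≤ Φ (X v + ∫ w in v..r, g (X w)) := fun v r hv hvr hr => by
    have h1 := hΦ.slope (X r) (X r + (D r - D v)) (hX r ⟨hv.trans hvr, hr⟩)
      (by linarith [D.mono hvr])
    rw [hinc v r hv hvr hr] at h1
    linarith [hinc v r hv hvr hr]
  have hBint : ∀ v r, s ≤ v → v ≤ r → r ≤ u →
      ∫ w in s..r, B (X w) = (∫ w in s..v, B (X w)) + ∫ w in v..r, B (X w) :=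
    fun v r hv hvr hr => (intervalIntegral.integral_add_adjacent_intervals
      (h.intervalIntegrable_comp hB hs hv) (h.intervalIntegrable_comp hB (hs.trans hv) hvr)).symm
  have hBnn : ∀ v r, s ≤ v → v ≤ r → r ≤ u → 0 ≤ ∫ w in v..r, B (X w) := fun v r hv hvr hr =>
    intervalIntegral.integral_nonneg hvr fun w hw =>
      hΦ.drift_nonneg hlam hδ hα (hX w ⟨hv.trans hw.1, hw.2.trans hr⟩)
  have hgnn : ∀ v r, s ≤ v → v ≤ r → r ≤ u → 0 ≤ ∫ w in v..r, g (X w) := fun v r hv hvr hr =>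
    intervalIntegral.integral_nonneg hvr fun w hw => hgn _ (hX w ⟨hv.trans hw.1, hw.2.trans hr⟩)
  -- The compensated value cannot increase: its growth rate to the right is at most 0, and it has no
  -- upward jumps from the left.
  have key := le_of_local_right_le (F := fun r => Φ (X r) + D r - ∫ w in s..r, B (X w)) hsu ?_ ?_
  · simp only [intervalIntegral.integral_same] at key
    linarith
  · intro r hr ε hε
    have hr0 : 0 ≤ r := hs.trans hr.1
    have hXr := hX r ⟨hr.1, hr.2.le⟩
    rcases (hgn _ hXr).eq_or_lt with hgz | hgz
    · have hXr0 : X r = 0 := by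
        rcases hXr.eq_or_lt with h0 | h0
        · exact h0.symm
        · exact absurd (hΦ.g_pos _ h0) (by rw [← hgz]; exact lt_irrefl _)
      have hg0 : g 0 = 0 := by have := hgz.symm; rwa [hXr0] at this
      have hzero := h.eq_zero_of_absorbed hg hg0 hr0 hXr0
        (fun v hv => hX v ⟨hr.1.trans hv.1, hv.2⟩)
      filter_upwards [Ioo_mem_nhdsGT hr.2] with v hv
      have h1 := hzero v ⟨hv.1.le, hv.2.le⟩
      have h2 := hinc r v hr.1 hv.1.le hv.2.le
      have h3 : ∫ w in r..v, g (X w) = 0 := by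
        rw [intervalIntegral.integral_congr (g := fun _ => (0 : ℝ)) fun w hw => ?_]
        · simp
        · rw [uIcc_of_le hv.1.le] at hw
          simp only
          rw [hzero w ⟨hw.1, hw.2.trans hv.2.le⟩, hg0]
      have h4 := hBint r v hr.1 hv.1.le hv.2.le
      have h5 := hBnn r v hr.1 hv.1.le hv.2.le
      have h6 : 0 ≤ ε * (v - r) := mul_nonneg hε.le (by linarith [hv.1])
      rw [h4, h1]
      rw [hXr0] at h2 ⊢
      linarith
    · obtain ⟨p, hp, hpB⟩ := hΦ.deriv_le (X r) hXr hgz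
      have hG : HasDerivWithinAt (fun v => X r + ∫ w in r..v, g (X w)) (g (X r)) (Icc r u) r :=
        ((h.hasDerivWithinAt_integral_comp hg.continuous hr0).mono Icc_subset_Ici_self).const_add _
      -- The income makes the argument of Φ move upwards, so the right derivative of Φ is enough for
      -- the chain rule.
      have hH : HasDerivWithinAt (fun v => Φ (X r + ∫ w in r..v, g (X w))) (p * g (X r))
          (Icc r u) r := by
        refine HasDerivWithinAt.comp r (h₂ := Φ) (s' := Ici (X r)) ?_ hG ?_
        · simpa using hp
        · intro v hv
          simpa using hgnn r v hr.1 hv.1 hv.2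
      have hI := (h.hasDerivWithinAt_integral_comp hB hr0).mono
        (Icc_subset_Ici_self : Icc r u ⊆ Ici r)
      have hev := HasDerivWithinAt.eventually_abs_sub_le (hH.sub hI) hr.2 hε
      filter_upwards [hev, Ioo_mem_nhdsGT hr.2] with v hv hrv
      have h1 := hstep r v hr.1 hrv.1.le hrv.2.le
      have h4 := hBint r v hr.1 hrv.1.le hrv.2.le
      have h5 := (abs_le.1 hv).2
      simp only [Pi.sub_apply, intervalIntegral.integral_same, add_zero, sub_zero] at h5
      have h6 : 0 ≤ v - r := by linarith [hrv.1]
      rw [h4]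
      nlinarith
  · intro r hr ε hε
    obtain ⟨C, hC0, hC⟩ := h.exists_drift_bound hg.continuous u
    obtain ⟨C', hC'⟩ := h.bounded u
    obtain ⟨d, hd, hd'⟩ := hΦ.exists_modulus (C' + C * u) hε
    -- Over a time shorter than d/(C+1) the income is at most d, which the modulus converts into ε;
    -- dividends are already absorbed by `hstep`.
    have hpos : r - d / (C + 1) < r := by
      have : 0 < d / (C + 1) := by positivity
      linarith
    filter_upwards [Ioo_mem_nhdsLT (max_lt hr.1 hpos)] with v hv
    have hsv : s ≤ v := (le_max_left _ _).trans hv.1.le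
    have hrv : (r - v) * (C + 1) ≤ d := by
      have h1 := (le_max_right s _).trans_lt hv.1
      have h2 : r - v < d / (C + 1) := by linarith
      exact ((lt_div_iff₀ (by positivity)).1 h2).le
    have h0 := hgnn v r hsv hv.2.le hr.2
    have h1 := hC v r (hs.trans hsv) hv.2.le hr.2
    rw [abs_of_nonneg h0] at h1
    have h2 := hstep v r hsv hv.2.le hr.2
    have hvu : v ≤ u := hv.2.le.trans hr.2
    have h3 := hX v ⟨hsv, hvu⟩
    have h7 := (abs_le.1 (hC' v ⟨hs.trans hsv, hvu⟩)).2
    have h8 : C * (r - v) ≤ C * u := by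
      refine mul_le_mul_of_nonneg_left ?_ hC0
      linarith [hr.2, hs.trans hsv]
    have h4 := hd' (X v) (X v + ∫ w in v..r, g (X w)) h3 (by linarith) (by linarith)
      (by nlinarith [hv.2])
    have h5 := hBint v r hsv hv.2.le hr.2
    have h6 := hBnn v r hsv hv.2.le hr.2
    rw [h5]
    linarith

end IsControlledPath

/-! ### Estimates over one grid interval for a general control -/

theorem IsVerification.claimAvg_mono {g : ℝ → ℝ} {lam δ α b : ℝ} {Φ : ℝ → ℝ}
    (h : IsVerification g lam δ α b Φ) (hα : 0 < α) {y z : ℝ} (hy : 0 ≤ y)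
    (hyz : y ≤ z) : claimAvg α Φ y ≤ claimAvg α Φ z := by
  have hd := fun v => hasDerivAt_claimAvg (α := α) h.cont v
  refine monotoneOn_of_deriv_nonneg (convex_Icc y z)
    (continuous_claimAvg h.cont).continuousOn
    (fun v _ => (hd v).differentiableAt.differentiableWithinAt) (fun v hv => ?_)
    ⟨le_rfl, hyz⟩ ⟨hyz, le_rfl⟩ hyz
  rw [(hd v).deriv]
  rw [interior_Icc] at hv
  have h1 := h.claimAvg_le hα (hy.trans hv.1.le)
  exact mul_nonneg hα.le (by linarith)

namespace IsControlledPath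

variable {g : ℝ → ℝ} {x : ℝ} {S : ℝ → ℝ} {D : StieltjesFunction ℝ} {X : ℝ → ℝ}

theorem integral_drift_mem (h : IsControlledPath g x S D X) {K : ℝ≥0} (hg : LipschitzWith K g)
    (hgn : ∀ z, 0 ≤ z → 0 ≤ g z) {M s u : ℝ} (hs : 0 ≤ s) (hsu : s ≤ u)
    (hX : ∀ v ∈ Icc s u, X v ∈ Icc 0 M) :
    (∫ v in s..u, g (X v)) ∈ Icc 0 ((g 0 + K * M) * (u - s)) := by
  refine ⟨intervalIntegral.integral_nonneg hsu fun v hv => hgn _ (hX v hv).1, ?_⟩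
  have h1 : ∫ v in s..u, g (X v) ≤ ∫ v in s..u, (g 0 + K * M) := by
    refine intervalIntegral.integral_mono_on hsu (h.integrable' hs hsu) (by simp) fun v hv => ?_
    have h2 := LipschitzWith.le_add_mul hg (X v) 0
    have h3 := hX v hv
    rw [sub_zero, abs_of_nonneg h3.1] at h2
    have h4 : (K : ℝ) * X v ≤ K * M := mul_le_mul_of_nonneg_left h3.2 K.2
    linarith
  rw [intervalIntegral.integral_const, smul_eq_mul] at h1
  linarith

/-- Freezes the drift at the left endpoint. An upward move of the surplus is at most the income and
costs ε through the modulus; a downward move is at most the dividends paid and costs a multiple of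
them through `claimAvg_sub_le`. The dividend term stays in the bound because a control may pay a
large lump in an arbitrarily short time. -/
theorem value_add_dividends_le_of_noClaim (h : IsControlledPath g x S D X) {K : ℝ≥0}
    (hg : LipschitzWith K g) (hgn : ∀ z, 0 ≤ z → 0 ≤ g z) {lam δ α b : ℝ} {Φ : ℝ → ℝ}
    (hΦ : IsVerification g lam δ α b Φ) (hlam : 0 < lam) (hδ : 0 < δ) (hα : 0 < α)
    {M s u d ε : ℝ} (hε : 0 ≤ ε) (hs : 0 ≤ s) (hsu : s ≤ u) (hS : S u = S s)
    (hX : ∀ v ∈ Icc s u, X v ∈ Icc 0 M)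
    (hd : ∀ y z, 0 ≤ y → y ≤ z → z ≤ M → z - y ≤ d → Φ z ≤ Φ y + ε)
    (hdu : (g 0 + K * M) * (u - s) ≤ d) :
    Φ (X u) + (D u - D s) ≤ Φ (X s) + (u - s) * (harmonicDrift lam δ α Φ (X s) + (lam + δ) * ε
      + lam * α * Φ M * (D u - D s)) := by
  have h1 := h.value_add_dividends_le hg hgn hΦ hlam hδ hα hs hsu hS (fun v hv => (hX v hv).1)
  have hB : Continuous (harmonicDrift lam δ α Φ) := continuous_harmonicDrift hΦ.cont
  have hXs := hX s ⟨le_rfl, hsu⟩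
  have hM : 0 ≤ M := hXs.1.trans hXs.2
  have hDsu := D.mono hsu
  have hΦM := hΦ.nonneg M
  have h2 : ∫ v in s..u, harmonicDrift lam δ α Φ (X v) ≤ ∫ v in s..u,
      (harmonicDrift lam δ α Φ (X s) + (lam + δ) * ε + lam * α * Φ M * (D u - D s)) := by
    refine intervalIntegral.integral_mono_on hsu (h.intervalIntegrable_comp hB hs hsu)
      (by simp) fun v hv => ?_
    have hXv := hX v hv
    have hinc := h.increment hs hv.1
    have hdr := h.integral_drift_mem hg hgn hs hv.1
      (fun w hw => hX w ⟨hw.1, hw.2.trans hv.2⟩)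
    have hDv := D.mono hv.1
    have hDv' := D.mono hv.2
    have hSv := h.claims.mono hv.1
    have hSv' := h.claims.mono hv.2
    have hC : 0 ≤ g 0 + K * M := add_nonneg (hgn 0 le_rfl) (mul_nonneg K.2 hM)
    have hdv : (∫ v in s..v, g (X v)) ≤ d := by
      refine hdr.2.trans (le_trans ?_ hdu)
      exact mul_le_mul_of_nonneg_left (by linarith [hv.2]) hC
    have e1 : Φ (X v) ≤ Φ (X s) + ε := by
      rcases le_total (X s) (X v) with hc | hc
      · exact hd _ _ hXs.1 hc hXv.2 (by linarith)
      · have := hΦ.mono hXv.1 hXs.1 hc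
        linarith
    have e2 : claimAvg α Φ (X s) - claimAvg α Φ (X v) ≤ α * Φ M * (D u - D s) := by
      have h0 : 0 ≤ α * Φ M := by positivity
      rcases le_total (X s) (X v) with hc | hc
      · have := hΦ.claimAvg_mono hα hXs.1 hc
        have := mul_nonneg h0 (sub_nonneg.2 hDsu)
        linarith
      · have h3 := hΦ.claimAvg_sub_le hα hXv.1 hc
        have h4 := hΦ.mono hXs.1 (show M ∈ Ici 0 from hM) hXs.2
        have h5 : X s - X v ≤ D u - D s := by linarith [hdr.1]
        calc _ ≤ _ := h3
          _ ≤ α * Φ M * (D u - D s) := by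
            apply mul_le_mul (by gcongr) h5 (by linarith) h0
    unfold harmonicDrift
    have e3 := mul_le_mul_of_nonneg_left e2 hlam.le
    have e4 := mul_le_mul_of_nonneg_left e1 (add_pos hlam hδ).le
    linarith
  rw [intervalIntegral.integral_const, smul_eq_mul] at h2
  linarith

/-- X(u) plus the dividends equals X(s) minus the claims plus an income of at most ε, and slope at
least 1 trades the dividends for surplus. The order of claims and payments inside the interval
therefore does not matter, and ε is the upward shift built into `stepValue`. -/
theorem value_add_dividends_le_of_claim (h : IsControlledPath g x S D X) {K : ℝ≥0}
    (hg : LipschitzWith K g) (hgn : ∀ z, 0 ≤ z → 0 ≤ g z) {lam δ α b : ℝ} {Φ : ℝ → ℝ}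
    (hΦ : IsVerification g lam δ α b Φ)
    {M s u ε : ℝ} (hs : 0 ≤ s) (hsu : s ≤ u)
    (hX : ∀ v ∈ Icc s u, X v ∈ Icc 0 M) (hdu : (g 0 + K * M) * (u - s) ≤ ε) :
    0 ≤ X s - (S u - S s) + ε ∧ Φ (X u) + (D u - D s) ≤ Φ (X s - (S u - S s) + ε) := by
  have hinc := h.increment hs hsu
  have hdr := h.integral_drift_mem hg hgn hs hsu hX
  have hD := D.mono hsu
  have hXu := (hX u ⟨hsu, le_rfl⟩).1
  have h0 : 0 ≤ X s - (S u - S s) + ε := by linarith [hdr.2]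
  refine ⟨h0, ?_⟩
  have h1 := hΦ.slope (X u) (X s - (S u - S s) + ε) hXu (by linarith [hdr.2])
  linarith [hdr.2]

end IsControlledPath

/-! ### Barrier paths -/

/-- A path controlled by the barrier strategy at level `b`. -/
structure IsBarrierPath (g : ℝ → ℝ) (b x : ℝ) (S : ℝ → ℝ) (D : StieltjesFunction ℝ)
    (X : ℝ → ℝ) : Prop extends IsControlledPath g x S D X where
  le_barrier : ∀ t, 0 ≤ t → X t ≤ b
  D_zero : D 0 = max (x - b) 0
  D_eq : ∀ t, 0 ≤ t → D t = D 0 + ∫ s in (0 : ℝ)..t, Set.indicator {s | X s = b} (fun _ => g b) s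

theorem IsControlledPath.leftLim_D_zero {g : ℝ → ℝ} {x : ℝ} {S : ℝ → ℝ} {D : StieltjesFunction ℝ}
    {X : ℝ → ℝ} (h : IsControlledPath g x S D X) : Function.leftLim D 0 = 0 := by
  refine leftLim_eq_of_tendsto ?_
  refine tendsto_const_nhds.congr' ?_
  filter_upwards [self_mem_nhdsWithin] with v hv using (h.D_neg v hv).symm

/-- The payment rule at t reads ΔD ≥ X + ΔD - b, which forces X(t) ≤ b. At t > 0 the surplus
available before the payment is at most the left limit, hence at most b, so nothing jumps after time
0 and the sum of jumps reduces to D(0). -/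
theorem IsBarrier.isBarrierPath {Ω : Type*} {g : ℝ → ℝ} (hg : Continuous g) {b x : ℝ}
    {D : Ω → StieltjesFunction ℝ} {X : Ω → ℝ → ℝ} (hb : IsBarrier g b D X) {ω : Ω} {S : ℝ → ℝ}
    (h : IsControlledPath g x S (D ω) (X ω)) : IsBarrierPath g b x S (D ω) (X ω) := by
  have hle : ∀ t, 0 ≤ t → X ω t ≤ b := fun t ht => by
    by_contra hlt
    have h1 := hb.singular ω t ht
    have h2 := le_max_left (X ω t + jump (D ω) t - b) 0
    linarith [not_le.1 hlt]
  have hj0 : jump (D ω) 0 = D ω 0 := by rw [jump, h.leftLim_D_zero, sub_zero]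
  have hj : ∀ t, 0 < t → jump (D ω) t = 0 := by
    intro t ht
    -- For v slightly less than t, X(t) + D(t) - D(v) exceeds X(v) ≤ b by at most the income C(t-v);
    -- then v tends to t.
    obtain ⟨C, hC0, hC⟩ := h.exists_drift_bound hg t
    have h1 : Tendsto (fun v => X ω t + (D ω t - D ω v) - C * (t - v)) (𝓝[<] t)
        (𝓝 (X ω t + (D ω t - Function.leftLim (D ω) t) - C * (t - t))) := by
      have hD := (D ω).mono.tendsto_leftLim t
      have hv : Tendsto (fun v : ℝ => C * (t - v)) (𝓝[<] t) (𝓝 (C * (t - t))) :=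
        (Continuous.tendsto (by fun_prop) t).mono_left nhdsWithin_le_nhds
      exact ((hD.const_sub _).const_add _).sub hv
    have h2 : X ω t + (D ω t - Function.leftLim (D ω) t) - C * (t - t) ≤ b := by
      refine le_of_tendsto h1 ?_
      filter_upwards [Ioo_mem_nhdsLT ht] with v hv
      have h3 := h.increment hv.1.le hv.2.le
      have h4 := (abs_le.1 (hC v t hv.1.le hv.2.le le_rfl)).2
      have h5 := h.claims.mono hv.2.le
      have h6 := hle v hv.1.le
      linarith
    rw [hb.singular ω t ht.le]
    refine max_eq_right ?_
    rw [jump]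
    linarith
  refine { h with le_barrier := hle, D_zero := ?_, D_eq := fun t ht => ?_ }
  · have h1 := hb.singular ω 0 le_rfl
    have h2 := h.surplus 0 le_rfl
    rw [hj0, h2, h.claims.zero, intervalIntegral.integral_same] at h1
    rw [h1]
    congr 1
    ring
  · have h1 := hb.continuous ω t ht
    rw [tsum_eq_single (⟨0, le_rfl, ht⟩ : Set.Icc (0 : ℝ) t) (fun s hs => hj _ ?_)] at h1
    · simp only [hj0] at h1
      linarith
    · refine lt_of_le_of_ne s.2.1 fun h0 => hs ?_
      exact Subtype.ext h0.symm

namespace IsBarrierPath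

variable {g : ℝ → ℝ} {x b : ℝ} {S : ℝ → ℝ} {D : StieltjesFunction ℝ} {X : ℝ → ℝ}

theorem intervalIntegrable_indicator (h : IsBarrierPath g b x S D X) (s r : ℝ) :
    IntervalIntegrable (fun v => Set.indicator {s | X s = b} (fun _ => g b) v) volume s r := by
  have hm : MeasurableSet {s | X s = b} := h.measurable (measurableSet_singleton b)
  constructor <;>
  · exact (integrableOn_const (by simp) (by simp)).indicator hm

theorem D_increment (h : IsBarrierPath g b x S D X) {s r : ℝ} (hs : 0 ≤ s) (hsr : s ≤ r) :
    D r - D s = ∫ v in s..r, Set.indicator {s | X s = b} (fun _ => g b) v := by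
  have h1 := h.D_eq s hs
  have h2 := h.D_eq r (hs.trans hsr)
  have h3 := intervalIntegral.integral_add_adjacent_intervals
    (h.intervalIntegrable_indicator 0 s) (h.intervalIntegrable_indicator s r)
  linarith

theorem net_increment (h : IsBarrierPath g b x S D X) {s r : ℝ} (hs : 0 ≤ s) (hsr : s ≤ r) :
    X r = X s - (S r - S s)
      + ∫ v in s..r, (g (X v) - Set.indicator {s | X s = b} (fun _ => g b) v) := by
  rw [intervalIntegral.integral_sub (h.integrable' hs hsr) (h.intervalIntegrable_indicator s r),
    ← h.D_increment hs hsr]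
  linarith [h.increment hs hsr]

theorem intervalIntegrable_net (h : IsBarrierPath g b x S D X) {s r : ℝ} (hs : 0 ≤ s)
    (hsr : s ≤ r) : IntervalIntegrable
      (fun v => g (X v) - Set.indicator {s | X s = b} (fun _ => g b) v) volume s r :=
  (h.integrable' hs hsr).sub (h.intervalIntegrable_indicator s r)

/-- At b the dividends consume the income exactly, so the net rate of a barrier path vanishes there
and equals g(X) elsewhere. -/
theorem net_eq (v : ℝ) : g (X v) - Set.indicator {s | X s = b} (fun _ => g b) v
    = if X v = b then 0 else g (X v) := by
  by_cases hv : X v = b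
  · simp [hv]
  · simp [hv]

/-- The gap b - X starts at 0. Where it is positive, the net rate is g(X) ≥ g(b) - K(b - X) ≥ -K(b -
X), so Gronwall with zero initial value keeps it at 0. Equality of S at the endpoints is all that is
asked of the claims. -/
theorem eq_barrier (h : IsBarrierPath g b x S D X) {K : ℝ≥0} (hg : LipschitzWith K g)
    (hgb : 0 ≤ g b) {s t : ℝ} (hs : 0 ≤ s) (hS : S t = S s) (hXs : X s = b) :
    ∀ v ∈ Icc s t, X v = b := by
  intro v hv
  have hst : s ≤ t := hv.1.trans hv.2
  obtain ⟨C, hC⟩ := h.bounded t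
  have hi : ∀ w, s ≤ w → IntervalIntegrable (fun r => b - X r) volume s w := fun w hw =>
    h.intervalIntegrable_comp (B := fun y => b - y) (by fun_prop) hs hw
  have h1 := gronwall_integral (u := fun r => b - X r) (s := s) (t := t) (a := 0) (C := b + C)
    (K := K) K.2 le_rfl (hi t hst) (fun w hw => by
      have := (abs_le.1 (hC w ⟨hs.trans hw.1, hw.2⟩)).1
      linarith) (fun w hw => ?_) v hv
  · simp only [mul_zero, zero_mul] at h1
    exact le_antisymm (h.le_barrier v (hs.trans hv.1)) (by linarith)
  · have h2 := h.net_increment hs hw.1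
    have hSw : S w ≤ S s := (h.claims.mono hw.2).trans hS.le
    have h5 : ∫ v in s..w, -(K * (b - X v)) ≤
        ∫ v in s..w, (g (X v) - Set.indicator {s | X s = b} (fun _ => g b) v) := by
      refine intervalIntegral.integral_mono_on hw.1 ((hi w hw.1).const_mul _).neg
        (h.intervalIntegrable_net hs hw.1) fun y hy => ?_
      rw [net_eq]
      split_ifs with hy'
      · simp [hy']
      · have h3 := LipschitzWith.le_add_mul hg b (X y)
        rw [abs_of_nonneg (by linarith [h.le_barrier y (hs.trans hy.1)])] at h3
        linarith
    rw [intervalIntegral.integral_neg, intervalIntegral.integral_const_mul] at h5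
    linarith

/-- Starting with enough surplus to pay the claims of `(s,u]`, a barrier path stays nonnegative. -/
theorem nonneg_of_claims_le (h : IsBarrierPath g b x S D X) {K : ℝ≥0} (hg : LipschitzWith K g)
    (hgn : ∀ z, 0 ≤ z → 0 ≤ g z) {s u : ℝ} (hs : 0 ≤ s)
    (hS : 0 ≤ X s - (S u - S s)) : ∀ r ∈ Icc s u, 0 ≤ X r := by
  intro v hv
  have hsu : s ≤ u := hv.1.trans hv.2
  obtain ⟨C, hC⟩ := h.bounded u
  have hi : ∀ w, s ≤ w → IntervalIntegrable (fun r => max (-X r) 0) volume s w := fun w hw =>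
    h.intervalIntegrable_comp (B := fun y => max (-y) 0) (by fun_prop) hs hw
  -- Gronwall with zero initial value for the negative part. Below 0 the income may be negative, but
  -- there g(X) ≥ g(0) - K|X| ≥ -K|X|.
  have h1 := gronwall_integral (u := fun r => max (-X r) 0) (s := s) (t := u) (a := 0)
    (C := max C 0) (K := K) K.2 le_rfl (hi u hsu) (fun w hw => by
      have := (abs_le.1 (hC w ⟨hs.trans hw.1, hw.2⟩)).1
      exact max_le_max_right _ (by linarith)) (fun w hw => ?_) v hv
  · simp only [mul_zero, zero_mul] at h1
    linarith [le_max_left (-X v) 0]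
  · have h2 := h.net_increment hs hw.1
    have hSw := h.claims.mono hw.2
    have h5 : ∫ v in s..w, -(K * max (-X v) 0) ≤
        ∫ v in s..w, (g (X v) - Set.indicator {s | X s = b} (fun _ => g b) v) := by
      refine intervalIntegral.integral_mono_on hw.1 ((hi w hw.1).const_mul _).neg
        (h.intervalIntegrable_net hs hw.1) fun y hy => ?_
      rw [net_eq]
      have h0 : 0 ≤ (K : ℝ) * max (-X y) 0 := mul_nonneg K.2 (le_max_right _ _)
      split_ifs with hy'
      · linarith
      · rcases le_total 0 (X y) with hc | hc
        · linarith [hgn _ hc]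
        · have h3 := LipschitzWith.le_add_mul hg 0 (X y)
          rw [zero_sub, abs_of_nonneg (by linarith)] at h3
          rw [max_eq_left (by linarith)]
          linarith [hgn 0 le_rfl]
    rw [intervalIntegral.integral_neg, intervalIntegral.integral_const_mul] at h5
    have h6 : 0 ≤ ∫ v in s..w, max (-X v) 0 :=
      intervalIntegral.integral_nonneg hw.1 fun y _ => le_max_right _ _
    refine max_le (by linarith) ?_
    have := mul_nonneg K.2 h6
    simpa using this

theorem sub_claims_le (h : IsBarrierPath g b x S D X)
    (hgn : ∀ z, 0 ≤ z → 0 ≤ g z) {s u : ℝ} (hs : 0 ≤ s) (hsu : s ≤ u)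
    (hX : ∀ r ∈ Icc s u, 0 ≤ X r) : X s - (S u - S s) ≤ X u := by
  have h1 := h.net_increment hs hsu
  have h2 : 0 ≤ ∫ v in s..u, (g (X v) - Set.indicator {s | X s = b} (fun _ => g b) v) := by
    refine intervalIntegral.integral_nonneg hsu fun v hv => ?_
    rw [net_eq]
    split_ifs
    · exact le_rfl
    · exact hgn _ (hX v hv)
  linarith

/-- The reverse of `value_add_dividends_le`, with equality in each regime of the barrier path:
strictly below b nothing is paid and gΦ' = H; at b the value is constant and dividends flow at rate
g(b) = H(b); if g(0) = 0, then Φ(0) = 0 and an absorbed path has neither value nor drift. -/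
theorem le_value_add_dividends (h : IsBarrierPath g b x S D X) {K : ℝ≥0} (hg : LipschitzWith K g)
    (hgn : ∀ z, 0 ≤ z → 0 ≤ g z) {lam δ α : ℝ} {Φ : ℝ → ℝ} (hΦ : IsVerification g lam δ α b Φ)
    (hlam : 0 < lam) (hδ : 0 < δ) (hα : 0 < α) {s u : ℝ} (hs : 0 ≤ s) (hsu : s ≤ u)
    (hS : S u = S s) (hX : ∀ v ∈ Icc s u, 0 ≤ X v) :
    Φ (X s) + (∫ v in s..u, harmonicDrift lam δ α Φ (X v)) ≤ Φ (X u) + (D u - D s) := by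
  set B := harmonicDrift lam δ α Φ with hBdef
  have hB : Continuous B := continuous_harmonicDrift hΦ.cont
  have hSc : ∀ v ∈ Icc s u, S v = S s := fun v hv =>
    le_antisymm ((h.claims.mono hv.2).trans hS.le) (h.claims.mono hv.1)
  have hBint : ∀ v r, s ≤ v → v ≤ r → r ≤ u →
      ∫ w in s..r, B (X w) = (∫ w in s..v, B (X w)) + ∫ w in v..r, B (X w) :=
    fun v r hv hvr hr => (intervalIntegral.integral_add_adjacent_intervals
      (h.intervalIntegrable_comp hB hs hv) (h.intervalIntegrable_comp hB (hs.trans hv) hvr)).symm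
  have key := le_of_local_right_le
    (F := fun r => (∫ w in s..r, B (X w)) - (Φ (X r) + D r)) hsu ?_ ?_
  · simp only [intervalIntegral.integral_same] at key
    linarith
  · intro r hr ε hε
    have hr0 : 0 ≤ r := hs.trans hr.1
    have hXr := hX r ⟨hr.1, hr.2.le⟩
    rcases (h.le_barrier r hr0).eq_or_lt with hXb | hXb
    · have hb := h.eq_barrier hg (hΦ.g_pos b hΦ.b_pos).le hr0
        (show S u = S r by rw [hS, hSc r ⟨hr.1, hr.2.le⟩]) hXb
      filter_upwards [Ioo_mem_nhdsGT hr.2] with v hv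
      have hb' : ∀ w ∈ uIcc r v, X w = b := fun w hw => by
        rw [uIcc_of_le hv.1.le] at hw
        exact hb w ⟨hw.1, hw.2.trans hv.2.le⟩
      have h1 : ∫ w in r..v, B (X w) = (v - r) * g b := by
        rw [intervalIntegral.integral_congr (g := fun _ => g b) fun w hw => ?_]
        · simp
        · rw [hb' w hw]
          exact hΦ.drift_barrier
      have h2 : D v - D r = (v - r) * g b := by
        rw [h.D_increment hr0 hv.1.le,
          intervalIntegral.integral_congr (g := fun _ => g b) fun w hw => ?_]
        · simp
        · simp [hb' w hw]
      have h4 := hBint r v hr.1 hv.1.le hv.2.le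
      have h6 : 0 ≤ ε * (v - r) := mul_nonneg hε.le (by linarith [hv.1])
      rw [h4, hb' v right_mem_uIcc, hXb]
      linarith
    · rcases (hgn _ hXr).eq_or_lt with hgz | hgz
      · have hXr0 : X r = 0 := by
          rcases hXr.eq_or_lt with h0 | h0
          · exact h0.symm
          · exact absurd (hΦ.g_pos _ h0) (by rw [← hgz]; exact lt_irrefl _)
        have hg0 : g 0 = 0 := by have := hgz.symm; rwa [hXr0] at this
        have hzero := h.eq_zero_of_absorbed hg hg0 hr0 hXr0
          (fun v hv => hX v ⟨hr.1.trans hv.1, hv.2⟩)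
        filter_upwards [Ioo_mem_nhdsGT hr.2] with v hv
        have h3 : ∫ w in r..v, B (X w) = 0 := by
          rw [intervalIntegral.integral_congr (g := fun _ => (0 : ℝ)) fun w hw => ?_]
          · simp
          · rw [uIcc_of_le hv.1.le] at hw
            rw [hzero w ⟨hw.1, hw.2.trans hv.2.le⟩]
            simp [hBdef, harmonicDrift, claimAvg, hΦ.zero hg0]
        have h4 := hBint r v hr.1 hv.1.le hv.2.le
        have h5 := D.mono hv.1.le
        have h6 : 0 ≤ ε * (v - r) := mul_nonneg hε.le (by linarith [hv.1])
        rw [h4, h3, hzero v ⟨hv.1.le, hv.2.le⟩, hXr0]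
        linarith
      · obtain ⟨p, hp, hpB⟩ := hΦ.deriv_eq (X r) hXr hXb hgz
        have hG : HasDerivWithinAt (fun v => X r + ∫ w in r..v, g (X w)) (g (X r)) (Icc r u) r :=
          ((h.hasDerivWithinAt_integral_comp hg.continuous hr0).mono
            Icc_subset_Ici_self).const_add _
        have hH : HasDerivWithinAt (fun v => Φ (X r + ∫ w in r..v, g (X w))) (p * g (X r))
            (Icc r u) r := by
          refine HasDerivWithinAt.comp r (h₂ := Φ) (s' := Ici (X r)) ?_ hG ?_
          · simpa using hp
          · intro v hv
            have : 0 ≤ ∫ w in r..v, g (X w) := intervalIntegral.integral_nonneg hv.1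
              fun w hw => hgn _ (hX w ⟨hr.1.trans hw.1, hw.2.trans hv.2⟩)
            simpa using this
        have hI := (h.hasDerivWithinAt_integral_comp hB hr0).mono
          (Icc_subset_Ici_self : Icc r u ⊆ Ici r)
        have hev := HasDerivWithinAt.eventually_abs_sub_le (hH.sub hI) hr.2 hε
        have hlt : ∀ᶠ w in 𝓝[Ici r] r, X w < b :=
          (h.continuousWithinAt hr0).eventually (Iio_mem_nhds hXb)
        -- By right-continuity the path remains below b for a while, so no dividends are paid there
        -- and X is driven by income alone.
        obtain ⟨d, hd, hd'⟩ := mem_nhdsGE_iff_exists_Ico_subset.1 hlt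
        filter_upwards [hev, Ioo_mem_nhdsGT hr.2, Ioo_mem_nhdsGT hd] with v hv hrv hvd
        have h2 : D v - D r = 0 := by
          rw [h.D_increment hr0 hrv.1.le,
            intervalIntegral.integral_congr (g := fun _ => (0 : ℝ)) fun w hw => ?_]
          · simp
          · rw [uIcc_of_le hrv.1.le] at hw
            have : X w < b := hd' ⟨hw.1, hw.2.trans_lt hvd.2⟩
            simp [this.ne]
        have h1 : X v = X r + ∫ w in r..v, g (X w) := by
          have h3 := h.increment hr0 hrv.1.le
          rw [hSc v ⟨hr.1.trans hrv.1.le, hrv.2.le⟩, hSc r ⟨hr.1, hr.2.le⟩, h2] at h3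
          linarith
        have h4 := hBint r v hr.1 hrv.1.le hrv.2.le
        have h5 := (abs_le.1 hv).1
        simp only [Pi.sub_apply, intervalIntegral.integral_same, add_zero, sub_zero] at h5
        rw [h4, h1]
        rw [show p * g (X r) - B (X r) = 0 by rw [hBdef, ← hpB]; ring] at h5
        linarith
  · intro r hr ε hε
    -- From the left, Φ(X) + D is nondecreasing between claims, and the drift integral over (v,r] is
    -- at most C(r-v).
    set C := (lam + δ) * Φ b with hC
    have hC0 : 0 ≤ C := mul_nonneg (by positivity) (hΦ.nonneg _)
    have hpos : r - ε / (C + 1) < r := by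
      have : 0 < ε / (C + 1) := by positivity
      linarith
    filter_upwards [Ioo_mem_nhdsLT (max_lt hr.1 hpos)] with v hv
    have hsv : s ≤ v := (le_max_left _ _).trans hv.1.le
    have hrv : (r - v) * (C + 1) ≤ ε := by
      have h1 := (le_max_right s _).trans_lt hv.1
      have h2 : r - v < ε / (C + 1) := by linarith
      exact ((lt_div_iff₀ (by positivity)).1 h2).le
    have hv0 : 0 ≤ v := hs.trans hsv
    have hX' : ∀ w ∈ Icc v r, 0 ≤ X w := fun w hw => hX w ⟨hsv.trans hw.1, hw.2.trans hr.2⟩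
    have h1 := h.sub_claims_le hgn hv0 hv.2.le hX'
    rw [hSc v ⟨hsv, hv.2.le.trans hr.2⟩, hSc r ⟨hr.1.le, hr.2⟩] at h1
    have h2 := hΦ.mono (hX' v ⟨le_rfl, hv.2.le⟩) (hX' r ⟨hv.2.le, le_rfl⟩) (by linarith)
    have h3 := D.mono hv.2.le
    have h4 := hBint v r hsv hv.2.le hr.2
    have h5 : ∫ w in v..r, B (X w) ≤ ∫ w in v..r, C := by
      refine intervalIntegral.integral_mono_on hv.2.le (h.intervalIntegrable_comp hB hv0 hv.2.le)
        (by simp) fun w hw => ?_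
      have h6 := hX' w hw
      have h7 := h.le_barrier w (hv0.trans hw.1)
      refine (hΦ.drift_le hlam hα h6).trans ?_
      exact mul_le_mul_of_nonneg_left (hΦ.mono h6 hΦ.b_pos.le h7) (by positivity)
    rw [intervalIntegral.integral_const, smul_eq_mul] at h5
    rw [h4]
    nlinarith [hv.2]

/-- Between claims a barrier path is nondecreasing and rises by at most (g(0) + Kb)(u-s). Only the
growth of the claim average has to be estimated, and the error is quadratic in the step, without a
modulus of Φ. -/
theorem le_value_add_dividends_of_noClaim (h : IsBarrierPath g b x S D X) {K : ℝ≥0}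
    (hg : LipschitzWith K g)
    (hgn : ∀ z, 0 ≤ z → 0 ≤ g z) {lam δ α : ℝ} {Φ : ℝ → ℝ} (hΦ : IsVerification g lam δ α b Φ)
    (hlam : 0 < lam) (hδ : 0 < δ) (hα : 0 < α) {s u : ℝ} (hs : 0 ≤ s) (hsu : s ≤ u)
    (hS : S u = S s) (hX : ∀ v ∈ Icc s u, 0 ≤ X v) :
    Φ (X s) + (u - s) * (harmonicDrift lam δ α Φ (X s)
      - lam * α * Φ b * (g 0 + K * b) * (u - s)) ≤ Φ (X u) + (D u - D s) := by
  refine le_trans ?_ (h.le_value_add_dividends hg hgn hΦ hlam hδ hα hs hsu hS hX)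
  have hB : Continuous (harmonicDrift lam δ α Φ) := continuous_harmonicDrift hΦ.cont
  have h2 : ∫ v in s..u, (harmonicDrift lam δ α Φ (X s)
      - lam * α * Φ b * (g 0 + K * b) * (u - s)) ≤ ∫ v in s..u, harmonicDrift lam δ α Φ (X v) := by
    refine intervalIntegral.integral_mono_on hsu (by simp) (h.intervalIntegrable_comp hB hs hsu)
      fun v hv => ?_
    have hXv := hX v hv
    have hX' : ∀ w ∈ Icc s v, 0 ≤ X w := fun w hw => hX w ⟨hw.1, hw.2.trans hv.2⟩
    have hXs := hX s ⟨le_rfl, hsu⟩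
    have h1 := h.sub_claims_le hgn hs hv.1 hX'
    have hSv : S v = S s := le_antisymm ((h.claims.mono hv.2).trans hS.le) (h.claims.mono hv.1)
    rw [hSv] at h1
    have h3 := h.le_add_integral hs hv.1
    have h4 := (h.integral_drift_mem hg hgn (M := b) hs hv.1
      (fun w hw => ⟨hX' w hw, h.le_barrier w (hs.trans hw.1)⟩)).2
    have h5 := hΦ.mono hXs hXv (by linarith)
    have h6 := hΦ.claimAvg_sub_le hα hXs (by linarith : X s ≤ X v)
    have h7 := hΦ.mono hXv hΦ.b_pos.le (h.le_barrier v (hs.trans hv.1))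
    have h8 : α * Φ (X v) * (X v - X s) ≤ α * Φ b * ((g 0 + K * b) * (u - s)) := by
      have hC : 0 ≤ g 0 + K * b := add_nonneg (hgn 0 le_rfl) (mul_nonneg K.2 hΦ.b_pos.le)
      have h9 : (g 0 + K * b) * (v - s) ≤ (g 0 + K * b) * (u - s) :=
        mul_le_mul_of_nonneg_left (by linarith [hv.2]) hC
      exact mul_le_mul (by gcongr) (by linarith) (by linarith)
        (mul_nonneg hα.le (hΦ.nonneg _))
    unfold harmonicDrift
    have e3 := mul_le_mul_of_nonneg_left (h6.trans h8) hlam.le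
    have e4 := mul_le_mul_of_nonneg_left h5 (add_pos hlam hδ).le
    linarith
  rw [intervalIntegral.integral_const, smul_eq_mul] at h2
  linarith

end IsBarrierPath

/-! ### Law of the claim increments -/

theorem expMeasure_real_Iic {r x : ℝ} (hr : 0 < r) (hx : 0 ≤ x) :
    (expMeasure r).real (Iic x) = 1 - Real.exp (-(r * x)) := by
  have := isProbabilityMeasure_expMeasure hr
  rw [← cdf_eq_real, cdf_expMeasure_eq hr, if_pos hx]

theorem expMeasure_real_Ioc {r s u : ℝ} (hr : 0 < r) (hs : 0 ≤ s) (hsu : s ≤ u) :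
    (expMeasure r).real (Ioc s u) = Real.exp (-(r * s)) * (1 - Real.exp (-(r * (u - s)))) := by
  have := isProbabilityMeasure_expMeasure hr
  rw [← Iic_sdiff_Iic, measureReal_sdiff (Iic_subset_Iic.2 hsu) measurableSet_Iic,
    expMeasure_real_Iic hr hs, expMeasure_real_Iic hr (hs.trans hsu), mul_sub, ← Real.exp_add]
  ring_nf

/-- Joint increment of the number and the amount of claims. -/
noncomputable def claimIncrement {Ω : Type*} (T Y : ℕ → Ω → ℝ) (s t : ℝ≥0) (ω : Ω) : ℝ × ℝ :=
  ((claimCount T t ω : ℝ) - (claimCount T s ω : ℝ),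
    aggregateClaims T Y t ω - aggregateClaims T Y s ω)

theorem claimIncrement_fst {Ω : Type*} (T Y : ℕ → Ω → ℝ) (s t : ℝ≥0) (ω : Ω) :
    (claimIncrement T Y s t ω).1 = 0 ↔ claimCount T t ω = claimCount T s ω := by
  rw [claimIncrement, sub_eq_zero, Nat.cast_inj]

namespace IsClaimProcess

variable {Ω : Type*} [mΩ : MeasurableSpace Ω] {P : Measure Ω}
    {ℱ : Filtration ℝ≥0 mΩ} {lam α : ℝ} {T Y : ℕ → Ω → ℝ}

theorem measurable_interarrival (hc : IsClaimProcess P ℱ lam α T Y) (i : ℕ) :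
    Measurable fun ω => T (i + 1) ω - T i ω :=
  (hc.measurable_T _).sub (hc.measurable_T _)

theorem measurable_count (hc : IsClaimProcess P ℱ lam α T Y) (t : ℝ≥0) :
    Measurable (claimCount T (t : ℝ)) := (hc.adapted_count t).mono (ℱ.le t) le_rfl

theorem measurable_claims (hc : IsClaimProcess P ℱ lam α T Y) (t : ℝ≥0) :
    Measurable (aggregateClaims T Y (t : ℝ)) := (hc.adapted_claims t).mono (ℱ.le t) le_rfl

theorem measurable_claimIncrement (hc : IsClaimProcess P ℱ lam α T Y) (s t : ℝ≥0) :
    Measurable (claimIncrement T Y s t) := by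
  have h1 : Measurable fun n : ℕ => (n : ℝ) := measurable_from_top
  exact ((h1.comp (hc.measurable_count t)).sub (h1.comp (hc.measurable_count s))).prodMk
    ((hc.measurable_claims t).sub (hc.measurable_claims s))

theorem indepFun_claimIncrement (hc : IsClaimProcess P ℱ lam α T Y) {s t : ℝ≥0} (hst : s ≤ t)
    {ξ : Ω → ℝ} (hξ : Measurable[ℱ s] ξ) : IndepFun ξ (claimIncrement T Y s t) P :=
  indep_of_indep_of_le_left (hc.indep_increments s t hst) hξ.comap_le

theorem claimCount_eq_zero_iff (hc : IsClaimProcess P ℱ lam α T Y) (s : ℝ≥0) (ω : Ω) :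
    claimCount T s ω = 0 ↔ (s : ℝ) < T 1 ω := by
  obtain ⟨n, h1, h2⟩ := exists_mem_interarrival (hc.T_zero ω) s.coe_nonneg (hc.T_tendsto ω)
  have hn := claimCount_eq (hc.T_strictMono ω) h1 h2
  rw [show claimCount T (s : ℝ) ω = n from hn]
  constructor
  · rintro rfl; exact h2
  · intro h
    have := (hc.T_strictMono ω).lt_iff_lt.1 (h1.trans_lt h)
    omega

/-- The event that no claim has occurred by time s belongs to the past, and on it later increments
are explicit in T 1, T 2 and Y 0. Conditioning on it recovers the law of an increment, for which
only independence of the past is given. -/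
theorem measurableSet_noClaim (hc : IsClaimProcess P ℱ lam α T Y) (s : ℝ≥0) :
    MeasurableSet[ℱ s] {ω | (s : ℝ) < T 1 ω} := by
  have : {ω | (s : ℝ) < T 1 ω} = claimCount T (s : ℝ) ⁻¹' {0} := by
    ext ω
    exact (hc.claimCount_eq_zero_iff s ω).symm
  rw [this]
  exact hc.adapted_count s (measurableSet_singleton 0)

theorem real_interarrival (hc : IsClaimProcess P ℱ lam α T Y) (i : ℕ) {B : Set ℝ}
    (hB : MeasurableSet B) :
    P.real {ω | T (i + 1) ω - T i ω ∈ B} = (expMeasure lam).real B := by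
  rw [← hc.law_interarrival i, map_measureReal_apply (hc.measurable_interarrival i) hB]
  rfl

theorem real_T_one (hc : IsClaimProcess P ℱ lam α T Y) {B : Set ℝ} (hB : MeasurableSet B) :
    P.real {ω | T 1 ω ∈ B} = (expMeasure lam).real B := by
  rw [← hc.real_interarrival 0 hB]
  simp [hc.T_zero]

/-- Conditioning on no claim before `s`: the increment over `(s,t]` is independent of it. -/
theorem integral_noClaim_mul (hc : IsClaimProcess P ℱ lam α T Y) (hlam : 0 < lam) {s t : ℝ≥0}
    (hst : s ≤ t) {f : ℝ × ℝ → ℝ} (hf : Measurable f) :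
    ∫ ω, ({ω | (s : ℝ) < T 1 ω}.indicator (fun _ => (1 : ℝ)) ω) * f (claimIncrement T Y s t ω) ∂P
      = Real.exp (-(lam * s)) * ∫ ω, f (claimIncrement T Y s t ω) ∂P := by
  have hm := hc.measurableSet_noClaim s
  have hξ : Measurable[ℱ s] ({ω | (s : ℝ) < T 1 ω}.indicator (fun _ => (1 : ℝ))) :=
    measurable_const.indicator hm
  have h1 := (hc.indepFun_claimIncrement hst hξ).integral_fun_comp_mul_comp (f := id) (g := f)
    (hξ.mono (ℱ.le s) le_rfl).aemeasurable (hc.measurable_claimIncrement s t).aemeasurable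
    measurable_id.aestronglyMeasurable hf.aestronglyMeasurable
  simp only [id_eq] at h1
  rw [h1, integral_indicator_const _ (ℱ.le s _ hm)]
  congr 1
  have := isProbabilityMeasure_expMeasure hlam
  have h2 := hc.real_T_one (measurableSet_Ioi (a := (s : ℝ)))
  rw [smul_eq_mul, mul_one]
  refine h2.trans ?_
  rw [← compl_Iic, probReal_compl_eq_one_sub measurableSet_Iic, expMeasure_real_Iic hlam s.coe_nonneg]
  ring

/-- No claim up to t means none up to s and none in (s,t]. The two events are independent, so the
probability is a quotient of two exponential tails. -/
theorem real_noClaim_increment (hc : IsClaimProcess P ℱ lam α T Y) (hlam : 0 < lam) {s t : ℝ≥0}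
    (hst : s ≤ t) : P.real {ω | claimCount T t ω = claimCount T s ω}
      = Real.exp (-(lam * (t - s))) := by
  have hS : MeasurableSet {w : ℝ × ℝ | w.1 = 0} := measurable_fst (measurableSet_singleton 0)
  have h1 := hc.integral_noClaim_mul hlam hst
    (f := {w : ℝ × ℝ | w.1 = 0}.indicator fun _ => (1 : ℝ)) (measurable_const.indicator hS)
  have h2 : ∀ ω, ({w : ℝ × ℝ | w.1 = 0}.indicator (fun _ => (1 : ℝ))) (claimIncrement T Y s t ω)
      = {ω | claimCount T t ω = claimCount T s ω}.indicator (fun _ => (1 : ℝ)) ω := fun ω => by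
    simp only [indicator, mem_ofPred_eq, claimIncrement_fst]
  have hm : MeasurableSet {ω | claimCount T t ω = claimCount T s ω} :=
    measurableSet_eq_fun (hc.measurable_count t) (hc.measurable_count s)
  have hmT : ∀ a : ℝ, MeasurableSet {ω | a < T 1 ω} := fun a =>
    measurableSet_lt measurable_const (hc.measurable_T 1)
  have h3 : ∀ ω, {ω | (s : ℝ) < T 1 ω}.indicator (fun _ => (1 : ℝ)) ω *
      {ω | claimCount T t ω = claimCount T s ω}.indicator (fun _ => (1 : ℝ)) ω
      = {ω | (t : ℝ) < T 1 ω}.indicator (fun _ => (1 : ℝ)) ω := fun ω => by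
    have e1 := hc.claimCount_eq_zero_iff s ω
    have e2 := hc.claimCount_eq_zero_iff t ω
    have hst' : (s : ℝ) ≤ t := hst
    simp only [indicator, mem_ofPred_eq]
    by_cases hs : (s : ℝ) < T 1 ω
    · simp [hs, e1.2 hs, e2]
    · have : ¬ (t : ℝ) < T 1 ω := fun h => hs (hst'.trans_lt h)
      simp [hs, this]
  simp only [h2, h3] at h1
  rw [integral_indicator_const _ hm, integral_indicator_const _ (hmT t), smul_eq_mul, mul_one,
    smul_eq_mul, mul_one] at h1
  have := isProbabilityMeasure_expMeasure hlam
  have h4 := hc.real_T_one (measurableSet_Ioi (a := (t : ℝ)))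
  rw [← compl_Iic, probReal_compl_eq_one_sub measurableSet_Iic, expMeasure_real_Iic hlam t.coe_nonneg] at h4
  simp only [mem_compl_iff, mem_Iic, not_le] at h4
  rw [h4] at h1
  have h5 : Real.exp (-(lam * s)) * Real.exp (-(lam * (t - s))) = Real.exp (-(lam * t)) := by
    rw [← Real.exp_add]; ring_nf
  have h6 := Real.exp_pos (-(lam * s))
  refine mul_left_cancel₀ h6.ne' ?_
  rw [h5, ← h1]
  ring

variable [IsProbabilityMeasure P]

/-- On the event {T 1 > s}, an increment with a claim consists of the single amount Y 0 unless a
second claim also falls in (s,t]. The exception is quadratic in the probability a of a claim, and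
the factor exp(-λs) of the conditioning event cancels at the end. -/
theorem abs_integral_claim_sub_le (hc : IsClaimProcess P ℱ lam α T Y) (hlam : 0 < lam)
    {s t : ℝ≥0} (hst : s ≤ t) {q : ℝ → ℝ} (hq : Measurable q) {C : ℝ}
    (hq0 : ∀ y, 0 ≤ q y) (hqC : ∀ y, q y ≤ C) :
    |(∫ ω, {w : ℝ × ℝ | w.1 ≠ 0}.indicator (fun w => q w.2) (claimIncrement T Y s t ω) ∂P)
      - (1 - Real.exp (-(lam * (t - s)))) * ∫ y, q y ∂(expMeasure α)|
      ≤ C * (1 - Real.exp (-(lam * (t - s)))) ^ 2 := by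
  have hst' : (s : ℝ) ≤ t := hst
  set a := 1 - Real.exp (-(lam * ((t : ℝ) - s))) with ha
  have hS : MeasurableSet {w : ℝ × ℝ | w.1 ≠ 0} :=
    (measurable_fst (measurableSet_singleton 0)).compl
  have hf : Measurable ({w : ℝ × ℝ | w.1 ≠ 0}.indicator fun w => q w.2) :=
    (hq.comp measurable_snd).indicator hS
  have h1 := hc.integral_noClaim_mul hlam hst hf
  set E : Set Ω := {ω | T 1 ω ∈ Ioc (s : ℝ) t} with hE
  have hEm : MeasurableSet E := hc.measurable_T 1 measurableSet_Ioc
  -- Contains the event of two claims in (s,t], but is expressed by two independent interarrival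
  -- times, so its probability is a product.
  set E2 : Set Ω := E ∩ {ω | T 2 ω - T 1 ω ∈ Iic ((t : ℝ) - s)} with hE2
  have hE2m : MeasurableSet E2 :=
    hEm.inter (hc.measurable_interarrival 1 measurableSet_Iic)
  have hC : 0 ≤ C := (hq0 0).trans (hqC 0)
  have hPE : P.real E = Real.exp (-(lam * s)) * a := by
    rw [hE, hc.real_T_one measurableSet_Ioc, expMeasure_real_Ioc hlam s.coe_nonneg hst']
  have hPE2 : P.real E2 = Real.exp (-(lam * s)) * a * a := by
    have hi := (hc.indep.indepFun (i := Sum.inl 0) (j := Sum.inl 1)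
      (by simp)).measure_inter_preimage_eq_mul (Ioc (s : ℝ) t) (Iic ((t : ℝ) - s)) measurableSet_Ioc
      measurableSet_Iic
    have e1 : E2 = (fun ω => T 1 ω - T 0 ω) ⁻¹' (Ioc (s : ℝ) t) ∩
        (fun ω => T 2 ω - T 1 ω) ⁻¹' (Iic ((t : ℝ) - s)) := by
      ext ω
      simp [hE2, hE, hc.T_zero]
    have e2 : E = (fun ω => T 1 ω - T 0 ω) ⁻¹' (Ioc (s : ℝ) t) := by
      ext ω
      simp [hE, hc.T_zero]
    have e3 : P.real E2 = P.real E * P.real ((fun ω => T 2 ω - T 1 ω) ⁻¹' (Iic ((t : ℝ) - s))) := by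
      rw [Measure.real, Measure.real, Measure.real, ← ENNReal.toReal_mul, e1, e2]
      exact congrArg _ hi
    have e4 := hc.real_interarrival 1 (measurableSet_Iic (a := (t : ℝ) - s))
    rw [expMeasure_real_Iic hlam (sub_nonneg.2 hst')] at e4
    rw [e3, hPE]
    congr 1
  have hprod : ∫ ω, E.indicator (fun _ => (1 : ℝ)) ω * q (Y 0 ω) ∂P
      = Real.exp (-(lam * s)) * a * ∫ y, q y ∂(expMeasure α) := by
    have hi := (hc.indep.indepFun (i := Sum.inl 0) (j := Sum.inr 0)
      (by simp)).integral_fun_comp_mul_comp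
      (f := (Ioc (s : ℝ) t).indicator fun _ => (1 : ℝ)) (g := q)
      (hc.measurable_interarrival 0).aemeasurable (hc.measurable_Y 0).aemeasurable
      (measurable_const.indicator measurableSet_Ioc).aestronglyMeasurable hq.aestronglyMeasurable
    have e2 : ∀ ω, (Ioc (s : ℝ) t).indicator (fun _ => (1 : ℝ)) (T 1 ω - T 0 ω)
        = E.indicator (fun _ => (1 : ℝ)) ω := fun ω => by
      simp [hE, hc.T_zero, indicator]
    have e3 : ∫ ω, q (Y 0 ω) ∂P = ∫ y, q y ∂(expMeasure α) := by
      rw [← hc.law_Y 0, integral_map (hc.measurable_Y 0).aemeasurable hq.aestronglyMeasurable]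
    simp only [Sum.elim_inl, Sum.elim_inr, zero_add, e2, e3] at hi
    rw [hi, integral_indicator_const _ hEm, hPE, smul_eq_mul, mul_one]
  set F : Ω → ℝ := fun ω => {ω | (s : ℝ) < T 1 ω}.indicator (fun _ => (1 : ℝ)) ω *
    {w : ℝ × ℝ | w.1 ≠ 0}.indicator (fun w => q w.2) (claimIncrement T Y s t ω) with hF
  set G : Ω → ℝ := fun ω => E.indicator (fun _ => (1 : ℝ)) ω * q (Y 0 ω) with hG
  have hFm : Measurable F := by
    refine Measurable.mul (measurable_const.indicator (ℱ.le s _ (hc.measurableSet_noClaim s))) ?_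
    exact hf.comp (hc.measurable_claimIncrement s t)
  have hGm : Measurable G :=
    (measurable_const.indicator hEm).mul (hq.comp (hc.measurable_Y 0))
  -- F carries the true increment, G the first claim amount; they can differ only on `E2`, where
  -- both lie in [0,C].
  have hdiff : ∀ ω, |F ω - G ω| ≤ E2.indicator (fun _ => C) ω := by
    intro ω
    have e1 := hc.claimCount_eq_zero_iff s ω
    have e2 := hc.claimCount_eq_zero_iff t ω
    by_cases hs : (s : ℝ) < T 1 ω
    · by_cases ht : (t : ℝ) < T 1 ω
      · have hF0 : F ω = 0 := by
          have : claimCount T t ω = claimCount T s ω := by rw [e1.2 hs, e2.2 ht]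
          simp [hF, indicator, claimIncrement_fst, this]
        have hG0 : G ω = 0 := by
          have : ω ∉ E := fun h => absurd h.2 (not_le.2 ht)
          simp [hG, this]
        rw [hF0, hG0, sub_self, abs_zero]
        exact indicator_nonneg (fun _ _ => hC) _
      · have hωE : ω ∈ E := ⟨hs, not_lt.1 ht⟩
        have hne : claimCount T t ω ≠ claimCount T s ω := by
          rw [e1.2 hs]; exact fun h => ht (e2.1 h)
        have hFe : F ω = q (aggregateClaims T Y t ω - aggregateClaims T Y s ω) := by
          have : ¬ (claimIncrement T Y s t ω).1 = 0 := by
            rw [claimIncrement_fst]; exact hne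
          simp only [hF, indicator, mem_ofPred_eq, hs, if_true, ne_eq, this, not_false_eq_true,
            one_mul]
          rfl
        have hGe : G ω = q (Y 0 ω) := by simp [hG, hωE]
        by_cases h2 : (t : ℝ) < T 2 ω
        · have hN : claimCount T t ω = 1 := claimCount_eq (hc.T_strictMono ω) (not_lt.1 ht) h2
          have hFG : F ω = G ω := by
            rw [hFe, hGe]
            simp [aggregateClaims, hN, e1.2 hs]
          rw [hFG, sub_self, abs_zero]
          exact indicator_nonneg (fun _ _ => hC) _
        · have hω2 : ω ∈ E2 := by
            refine ⟨hωE, ?_⟩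
            have := not_lt.1 h2
            simp only [mem_ofPred_eq, mem_Iic]
            linarith
          rw [indicator_of_mem hω2, hFe, hGe, abs_le]
          constructor <;> linarith [hq0 (Y 0 ω), hqC (Y 0 ω),
            hq0 (aggregateClaims T Y t ω - aggregateClaims T Y s ω),
            hqC (aggregateClaims T Y t ω - aggregateClaims T Y s ω)]
    · have hF0 : F ω = 0 := by simp [hF, hs]
      have hG0 : G ω = 0 := by
        have : ω ∉ E := fun h => hs h.1
        simp [hG, this]
      rw [hF0, hG0, sub_self, abs_zero]
      exact indicator_nonneg (fun _ _ => hC) _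
  have hGi : Integrable G P := by
    refine Integrable.of_bound hGm.aestronglyMeasurable C (ae_of_all _ fun ω => ?_)
    rw [Real.norm_eq_abs, hG]
    by_cases h : ω ∈ E
    · simp [h, abs_of_nonneg (hq0 _), hqC]
    · simp [h, hC]
  have hFi : Integrable F P := by
    refine Integrable.of_bound hFm.aestronglyMeasurable (C + C) (ae_of_all _ fun ω => ?_)
    have e1 := hdiff ω
    have e2 : E2.indicator (fun _ => C) ω ≤ C := indicator_le_self' (fun _ _ => hC) ω
    have e3 : |G ω| ≤ C := by
      rw [hG]
      by_cases h : ω ∈ E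
      · simp [h, abs_of_nonneg (hq0 _), hqC]
      · simp [h, hC]
    rw [Real.norm_eq_abs]
    have := abs_add_le (F ω - G ω) (G ω)
    rw [sub_add_cancel] at this
    linarith
  have hfin : |(∫ ω, F ω ∂P) - ∫ ω, G ω ∂P| ≤ C * (Real.exp (-(lam * s)) * a * a) := by
    rw [← integral_sub hFi hGi]
    refine (abs_integral_le_integral_abs).trans ?_
    calc ∫ ω, |F ω - G ω| ∂P ≤ ∫ ω, E2.indicator (fun _ => C) ω ∂P :=
          integral_mono (hFi.sub hGi).abs ((integrable_const C).indicator hE2m) hdiff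
      _ = C * (Real.exp (-(lam * s)) * a * a) := by
          rw [integral_indicator_const _ hE2m, hPE2, smul_eq_mul, mul_comm]
  rw [show ∫ ω, F ω ∂P = _ from h1, show ∫ ω, G ω ∂P = _ from hprod, mul_assoc, ← mul_sub,
    abs_mul, abs_of_pos (Real.exp_pos _)] at hfin
  have h6 := Real.exp_pos (-(lam * s))
  refine le_of_mul_le_mul_left (hfin.trans_eq ?_) h6
  ring

end IsClaimProcess

/-! ### Exponential averages of the value with ruin -/

theorem integral_expMeasure {α : ℝ} (hα : 0 < α) (f : ℝ → ℝ) :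
    ∫ y, f y ∂(expMeasure α) = ∫ y in Ici 0, f y * (α * Real.exp (-α * y)) := by
  have h0 : expMeasure α = volume.withDensity (exponentialPDF α) := rfl
  have hm : Measurable (exponentialPDF α) := (measurable_exponentialPDFReal α).ennreal_ofReal
  rw [h0, integral_withDensity_eq_integral_toReal_smul hm (ae_of_all _ fun y => by
    simp [exponentialPDF]), ← integral_indicator measurableSet_Ici]
  congr 1
  funext y
  rw [exponentialPDF_eq, smul_eq_mul]
  by_cases hy : 0 ≤ y
  · rw [if_pos hy, indicator_of_mem (show y ∈ Ici 0 from hy),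
      ENNReal.toReal_ofReal (by positivity), neg_mul]
    ring
  · rw [if_neg hy, indicator_of_notMem (show y ∉ Ici 0 from hy)]
    simp

/-- The value `Φ`, set to zero after ruin and frozen above `m`. -/
noncomputable def ruinValue (Φ : ℝ → ℝ) (m z : ℝ) : ℝ := (Ici 0).indicator Φ (min z m)

/-- The zero value after ruin cuts the integral off at y = z, and the cap m is inert because z - y ≤
z ≤ m. The cap only serves to make the integrand bounded on the whole line. -/
theorem integral_ruinValue {α : ℝ} (hα : 0 < α) (Φ : ℝ → ℝ) {m z : ℝ} (hz : z ≤ m) :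
    ∫ y, ruinValue Φ m (z - y) ∂(expMeasure α) = if 0 ≤ z then claimAvg α Φ z else 0 := by
  rw [integral_expMeasure hα]
  split_ifs with h0
  · rw [claimAvg, intervalIntegral.integral_of_le h0, ← integral_Icc_eq_integral_Ioc,
      ← integral_indicator measurableSet_Ici, ← integral_indicator measurableSet_Icc]
    congr 1
    funext y
    by_cases hy : 0 ≤ y
    · rw [indicator_of_mem (show y ∈ Ici 0 from hy)]
      by_cases hyz : y ≤ z
      · rw [indicator_of_mem (show y ∈ Icc 0 z from ⟨hy, hyz⟩), ruinValue,
          min_eq_left (by linarith), indicator_of_mem (show z - y ∈ Ici 0 from sub_nonneg.2 hyz)]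
      · rw [indicator_of_notMem (show y ∉ Icc 0 z from fun h => hyz h.2), ruinValue,
          indicator_of_notMem, zero_mul]
        simp only [mem_Ici, le_min_iff, not_and_or, not_le]
        exact Or.inl (by linarith [not_le.1 hyz])
    · rw [indicator_of_notMem (show y ∉ Ici 0 from hy),
        indicator_of_notMem (show y ∉ Icc 0 z from fun h => hy h.1)]
  · rw [setIntegral_congr_fun (g := fun _ => (0 : ℝ)) measurableSet_Ici fun y hy => ?_]
    · simp
    · have hy0 : (0 : ℝ) ≤ y := hy
      simp only [ruinValue]
      rw [indicator_of_notMem, zero_mul]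
      simp only [mem_Ici, le_min_iff, not_and_or, not_le]
      exact Or.inl (by linarith [not_le.1 h0])

namespace IsVerification

variable {g : ℝ → ℝ} {lam δ α b : ℝ} {Φ : ℝ → ℝ}

theorem ruinValue_nonneg (h : IsVerification g lam δ α b Φ) (m z : ℝ) : 0 ≤ ruinValue Φ m z :=
  indicator_nonneg (fun y _ => h.nonneg y) _

theorem ruinValue_le (h : IsVerification g lam δ α b Φ) {m : ℝ} (hm : 0 ≤ m) (z : ℝ) :
    ruinValue Φ m z ≤ Φ m := by
  unfold ruinValue
  by_cases hz : min z m ∈ Ici (0 : ℝ)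
  · rw [indicator_of_mem hz]
    exact h.mono hz hm (min_le_right _ _)
  · rw [indicator_of_notMem hz]
    exact h.nonneg m

theorem measurable_ruinValue (h : IsVerification g lam δ α b Φ) (m : ℝ) :
    Measurable (ruinValue Φ m) :=
  (h.cont.measurable.indicator measurableSet_Ici).comp (measurable_id.min measurable_const)

end IsVerification

theorem ruinValue_of_mem {Φ : ℝ → ℝ} {m z : ℝ} (h0 : 0 ≤ z) (hz : z ≤ m) :
    ruinValue Φ m z = Φ z := by
  rw [ruinValue, min_eq_left hz, indicator_of_mem (show z ∈ Ici (0 : ℝ) from h0)]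

theorem ruinValue_of_neg {Φ : ℝ → ℝ} {m z : ℝ} (h0 : z < 0) : ruinValue Φ m z = 0 := by
  rw [ruinValue, indicator_of_notMem]
  simp only [mem_Ici, le_min_iff, not_and_or, not_le]
  exact Or.inl h0

/-! ### Claim increments seen from a random surplus -/

namespace IsClaimProcess

variable {Ω : Type*} [mΩ : MeasurableSpace Ω] {P : Measure Ω}
    {ℱ : Filtration ℝ≥0 mΩ} {lam α : ℝ} {T Y : ℕ → Ω → ℝ}

theorem sum_indicator_claims (hc : IsClaimProcess P ℱ lam α T Y) {t : ℝ} (ht : 0 ≤ t) (ω : Ω) :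
    (claimCount T t ω : ℝ≥0∞) ≤ ∑' i : ℕ, {ω | T (i + 1) ω ≤ t}.indicator (fun _ => 1) ω := by
  obtain ⟨n, h1, h2⟩ := exists_mem_interarrival (hc.T_zero ω) ht (hc.T_tendsto ω)
  rw [claimCount_eq (hc.T_strictMono ω) h1 h2]
  refine le_trans (le_of_eq ?_) (ENNReal.sum_le_tsum (Finset.range n))
  rw [Finset.sum_congr rfl (g := fun _ => (1 : ℝ≥0∞)) fun i hi => ?_]
  · simp
  · refine indicator_of_mem ?_ _
    exact ((hc.T_strictMono ω).monotone (Finset.mem_range.1 hi)).trans h1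

theorem integral_noClaim_comp (hc : IsClaimProcess P ℱ lam α T Y) (hlam : 0 < lam)
    {s t : ℝ≥0} (hst : s ≤ t) {ξ : Ω → ℝ} (hξ : Measurable[ℱ s] ξ) :
    ∫ ω, {ω | claimCount T t ω = claimCount T s ω}.indicator ξ ω ∂P
      = Real.exp (-(lam * (t - s))) * ∫ ω, ξ ω ∂P := by
  have hS : MeasurableSet {w : ℝ × ℝ | w.1 = 0} := measurable_fst (measurableSet_singleton 0)
  have h1 := (hc.indepFun_claimIncrement hst hξ).integral_fun_comp_mul_comp (f := id)
    (g := {w : ℝ × ℝ | w.1 = 0}.indicator fun _ => (1 : ℝ))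
    (hξ.mono (ℱ.le s) le_rfl).aemeasurable (hc.measurable_claimIncrement s t).aemeasurable
    measurable_id.aestronglyMeasurable (measurable_const.indicator hS).aestronglyMeasurable
  have h2 : ∀ ω, ({w : ℝ × ℝ | w.1 = 0}.indicator (fun _ => (1 : ℝ))) (claimIncrement T Y s t ω)
      = {ω | claimCount T t ω = claimCount T s ω}.indicator (fun _ => (1 : ℝ)) ω := fun ω => by
    simp only [indicator, mem_ofPred_eq, claimIncrement_fst]
  have hm : MeasurableSet {ω | claimCount T t ω = claimCount T s ω} :=
    measurableSet_eq_fun (hc.measurable_count t) (hc.measurable_count s)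
  simp only [id_eq, h2] at h1
  rw [integral_indicator_const _ hm, hc.real_noClaim_increment hlam hst, smul_eq_mul, mul_one,
    mul_comm] at h1
  rw [← h1]
  congr 1
  funext ω
  simp only [indicator]
  split_ifs <;> simp

variable [IsProbabilityMeasure P]

/-- The number of claims up to a fixed time has finite mean. -/
theorem lintegral_claimCount_ne_top (hc : IsClaimProcess P ℱ lam α T Y) (hlam : 0 < lam)
    {t : ℝ} (ht : 0 ≤ t) : ∫⁻ ω, (claimCount T t ω : ℝ≥0∞) ∂P ≠ ⊤ := by
  set p : ℝ≥0∞ := ENNReal.ofReal (1 - Real.exp (-(lam * t))) with hp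
  have hp1 : p < 1 := by
    rw [hp, ENNReal.ofReal_lt_one]
    linarith [Real.exp_pos (-(lam * t))]
  have hP : ∀ j, P {ω | T (j + 1) ω - T j ω ∈ Iic t} = p := fun j => by
    have := isProbabilityMeasure_expMeasure hlam
    rw [hp, ← expMeasure_real_Iic hlam ht, ← hc.real_interarrival j measurableSet_Iic,
      ofReal_measureReal]
  -- A claim numbered i+1 by time t forces i+1 independent interarrival times to be at most t, so
  -- the tail of the count is geometric with ratio p < 1.
  have hbound : ∀ i, P {ω | T (i + 1) ω ≤ t} ≤ p ^ (i + 1) := by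
    intro i
    have h1 := hc.indep.measure_inter_preimage_eq_mul
      ((Finset.range (i + 1)).map ⟨Sum.inl, Sum.inl_injective⟩) (sets := fun _ => Iic t)
      (fun _ _ => measurableSet_Iic)
    simp only [Finset.mem_map, Function.Embedding.coeFn_mk, iInter_exists, biInter_and',
      iInter_iInter_eq_right, Finset.prod_map, Sum.elim_inl] at h1
    calc P {ω | T (i + 1) ω ≤ t}
        ≤ P (⋂ j ∈ Finset.range (i + 1), (fun ω => T (j + 1) ω - T j ω) ⁻¹' Iic t) := by
          refine measure_mono fun ω hω => ?_
          simp only [mem_iInter, mem_preimage, mem_Iic]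
          intro j hj
          have hj' : j + 1 ≤ i + 1 := Finset.mem_range.1 hj
          have e1 : T (j + 1) ω ≤ T (i + 1) ω := (hc.T_strictMono ω).monotone hj'
          have e2 : T 0 ω ≤ T j ω := (hc.T_strictMono ω).monotone (Nat.zero_le j)
          rw [hc.T_zero] at e2
          have e3 : T (i + 1) ω ≤ t := hω
          linarith
      _ = ∏ j ∈ Finset.range (i + 1), P ((fun ω => T (j + 1) ω - T j ω) ⁻¹' Iic t) := h1
      _ = p ^ (i + 1) := by
          exact (Finset.prod_congr rfl fun j _ => hP j).trans (by simp)
  have h1 : ∫⁻ ω, (claimCount T t ω : ℝ≥0∞) ∂P ≤ ∑' i : ℕ, p ^ (i + 1) := by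
    refine (lintegral_mono fun ω => hc.sum_indicator_claims ht ω).trans ?_
    have hm : ∀ i : ℕ, MeasurableSet {ω | T (i + 1) ω ≤ t} := fun i =>
      measurableSet_le (hc.measurable_T _) measurable_const
    rw [lintegral_tsum fun i => (measurable_const.indicator (hm i)).aemeasurable]
    refine ENNReal.tsum_le_tsum fun i => ?_
    rw [lintegral_indicator_const (hm i), one_mul]
    exact hbound i
  refine ne_top_of_le_ne_top ?_ h1
  simp_rw [pow_succ]
  rw [ENNReal.tsum_mul_right, ENNReal.tsum_geometric]
  refine ENNReal.mul_ne_top (ENNReal.inv_ne_top.2 (tsub_pos_of_lt hp1).ne') (hp1.trans ENNReal.one_lt_top).ne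

/-- Independence and Fubini: the surplus known at time s may be frozen while the increment is
integrated out. -/
theorem integral_claimIncrement (hc : IsClaimProcess P ℱ lam α T Y) {s t : ℝ≥0}
    (hst : s ≤ t) {ξ : Ω → ℝ} (hξ : Measurable[ℱ s] ξ) {F : ℝ × (ℝ × ℝ) → ℝ} (hF : Measurable F)
    {C : ℝ} (hFC : ∀ w, |F w| ≤ C) :
    ∫ ω, F (ξ ω, claimIncrement T Y s t ω) ∂P
      = ∫ z, (∫ ω, F (z, claimIncrement T Y s t ω) ∂P) ∂(P.map ξ) := by
  have hξ' : Measurable ξ := hξ.mono (ℱ.le s) le_rfl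
  have hW := hc.measurable_claimIncrement s t
  have h1 := (hc.indepFun_claimIncrement hst hξ).map_prod_eq_prod_map_map hξ'.aemeasurable
    hW.aemeasurable
  have := Measure.isProbabilityMeasure_map (μ := P) hξ'.aemeasurable
  have := Measure.isProbabilityMeasure_map (μ := P) hW.aemeasurable
  rw [← integral_map (φ := fun ω => (ξ ω, claimIncrement T Y s t ω))
    (hξ'.prodMk hW).aemeasurable hF.aestronglyMeasurable, h1, integral_prod]
  · congr 1
    funext z
    rw [integral_map hW.aemeasurable]
    exact (hF.comp measurable_prodMk_left).aestronglyMeasurable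
  · exact Integrable.of_bound hF.aestronglyMeasurable C (ae_of_all _ hFC)

/-- The estimate for a deterministic function of the claim is uniform in that function up to the
bound C, so it can be applied for each frozen value z and integrated over the law of the surplus. -/
theorem abs_integral_claim_comp_sub_le (hc : IsClaimProcess P ℱ lam α T Y) (hlam : 0 < lam)
    (hα : 0 < α) {s t : ℝ≥0} (hst : s ≤ t) {ξ : Ω → ℝ} (hξ : Measurable[ℱ s] ξ) {Q : ℝ → ℝ}
    (hQ : Measurable Q) {C : ℝ} (hQ0 : ∀ w, 0 ≤ Q w) (hQC : ∀ w, Q w ≤ C) :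
    |(∫ ω, {ω | claimCount T t ω ≠ claimCount T s ω}.indicator
        (fun ω => Q (ξ ω - (aggregateClaims T Y t ω - aggregateClaims T Y s ω))) ω ∂P)
      - (1 - Real.exp (-(lam * (t - s)))) * ∫ ω, (∫ y, Q (ξ ω - y) ∂(expMeasure α)) ∂P|
      ≤ C * (1 - Real.exp (-(lam * (t - s)))) ^ 2 := by
  have := isProbabilityMeasure_expMeasure hα
  set a := 1 - Real.exp (-(lam * ((t : ℝ) - s))) with ha
  have hξ' : Measurable ξ := hξ.mono (ℱ.le s) le_rfl
  have hC : 0 ≤ C := (hQ0 0).trans (hQC 0)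
  set F : ℝ × (ℝ × ℝ) → ℝ := fun w => {w : ℝ × ℝ | w.1 ≠ 0}.indicator
    (fun v => Q (w.1 - v.2)) w.2 with hFdef
  have hF : Measurable F := by
    have hS : MeasurableSet {w : ℝ × (ℝ × ℝ) | w.2.1 ≠ 0} :=
      ((measurable_fst.comp measurable_snd) (measurableSet_singleton 0)).compl
    have : Measurable fun w : ℝ × (ℝ × ℝ) => Q (w.1 - w.2.2) := hQ.comp (by fun_prop)
    exact this.indicator hS
  have hFC : ∀ w, |F w| ≤ C := fun w => by
    simp only [hFdef, indicator]
    split_ifs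
    · rw [abs_of_nonneg (hQ0 _)]; exact hQC _
    · simpa using hC
  have h1 := hc.integral_claimIncrement hst hξ hF hFC
  have h2 : ∀ ω, {ω | claimCount T t ω ≠ claimCount T s ω}.indicator
        (fun ω => Q (ξ ω - (aggregateClaims T Y t ω - aggregateClaims T Y s ω))) ω
      = F (ξ ω, claimIncrement T Y s t ω) := fun ω => by
    simp only [hFdef, indicator, mem_ofPred_eq, ne_eq, claimIncrement_fst]
    rfl
  simp_rw [h2]
  have hQm : StronglyMeasurable fun z => ∫ y, Q (z - y) ∂(expMeasure α) :=
    StronglyMeasurable.integral_prod_right (f := fun z y => Q (z - y))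
      (hQ.comp (by fun_prop)).stronglyMeasurable
  have h3 : ∫ ω, (∫ y, Q (ξ ω - y) ∂(expMeasure α)) ∂P
      = ∫ z, (∫ y, Q (z - y) ∂(expMeasure α)) ∂(P.map ξ) :=
    (integral_map hξ'.aemeasurable hQm.aestronglyMeasurable).symm
  have hp := Measure.isProbabilityMeasure_map (μ := P) hξ'.aemeasurable
  have hW := hc.measurable_claimIncrement s t
  have hFm : StronglyMeasurable fun z => ∫ ω, F (z, claimIncrement T Y s t ω) ∂P :=
    StronglyMeasurable.integral_prod_right (f := fun z ω => F (z, claimIncrement T Y s t ω))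
      (hF.comp (measurable_fst.prodMk (hW.comp measurable_snd))).stronglyMeasurable
  have hbd : ∀ (f : Ω → ℝ), (∀ ω, |f ω| ≤ C) → |∫ ω, f ω ∂P| ≤ C := fun f hf => by
    have := norm_integral_le_of_norm_le_const (μ := P) (f := f) (C := C) (ae_of_all _ hf)
    simpa using this
  have hi1 : Integrable (fun z => ∫ ω, F (z, claimIncrement T Y s t ω) ∂P) (P.map ξ) :=
    Integrable.of_bound hFm.aestronglyMeasurable C (ae_of_all _ fun z => hbd _ fun ω => hFC _)
  have hi2 : Integrable (fun z => ∫ y, Q (z - y) ∂(expMeasure α)) (P.map ξ) := by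
    refine Integrable.of_bound hQm.aestronglyMeasurable C (ae_of_all _ fun z => ?_)
    have := norm_integral_le_of_norm_le_const (μ := expMeasure α) (f := fun y => Q (z - y)) (C := C)
      (ae_of_all _ fun y => by rw [Real.norm_eq_abs, abs_of_nonneg (hQ0 _)]; exact hQC _)
    simpa using this
  rw [h1, h3, ← integral_const_mul, ← integral_sub hi1 (hi2.const_mul a)]
  have h4 := norm_integral_le_of_norm_le_const (μ := P.map ξ) (C := C * a ^ 2)
    (f := fun z => (∫ ω, F (z, claimIncrement T Y s t ω) ∂P)
      - a * ∫ y, Q (z - y) ∂(expMeasure α)) (ae_of_all _ fun z =>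
        hc.abs_integral_claim_sub_le hlam hst (q := fun y => Q (z - y)) (hQ.comp (by fun_prop))
          (fun y => hQ0 _) (fun y => hQC _))
  simpa using h4

end IsClaimProcess

/-! ### One step of the discretised value process -/

/-- Value after one step from surplus `ξ` at time `s`, when between claims the surplus grows at
the harmonic drift, and `ε` is added before the claims are paid. -/
noncomputable def stepValue {Ω : Type*} (lam δ α : ℝ) (Φ : ℝ → ℝ) (T Y : ℕ → Ω → ℝ)
    (m ε : ℝ) (s t : ℝ≥0) (ξ : Ω → ℝ) (ω : Ω) : ℝ :=
  {ω | claimCount T t ω = claimCount T s ω}.indicator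
      (fun ω => ruinValue Φ m (ξ ω) + (t - s) * ruinValue (harmonicDrift lam δ α Φ) m (ξ ω)) ω
    + {ω | claimCount T t ω ≠ claimCount T s ω}.indicator (fun ω => ruinValue Φ m
        (ξ ω + ε - (aggregateClaims T Y t ω - aggregateClaims T Y s ω))) ω

theorem exp_bounds {x : ℝ} (hx : 0 ≤ x) :
    1 - Real.exp (-x) ≤ x ∧ x - x ^ 2 ≤ 1 - Real.exp (-x) ∧ 0 ≤ 1 - Real.exp (-x) := by
  have h1 := Real.add_one_le_exp (-x)
  have h2 := Real.add_one_le_exp x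
  have h3 : Real.exp (-x) * Real.exp x = 1 := by rw [← Real.exp_add]; simp
  have h4 := Real.exp_pos (-x)
  refine ⟨by linarith, ?_, ?_⟩
  · have h5 : Real.exp (-x) * (1 + x) ≤ 1 := by nlinarith
    nlinarith [mul_nonneg hx (sq_nonneg x), mul_nonneg hx hx]
  · have := Real.exp_le_one_iff.2 (neg_nonpos.2 hx)
    linarith

theorem exp_le_quadratic {x : ℝ} (hx : 0 ≤ x) (hx1 : x ≤ 1) : Real.exp x ≤ 1 + x + x ^ 2 := by
  have := Real.abs_exp_sub_one_sub_id_le (x := x) (by rwa [abs_of_nonneg hx])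
  have := (abs_le.1 this).2
  linarith

namespace IsVerification

variable {g : ℝ → ℝ} {lam δ α b : ℝ} {Φ : ℝ → ℝ}

theorem ruinDrift_nonneg (h : IsVerification g lam δ α b Φ) (hlam : 0 < lam) (hδ : 0 < δ)
    (hα : 0 < α) (m z : ℝ) : 0 ≤ ruinValue (harmonicDrift lam δ α Φ) m z :=
  indicator_nonneg (fun _ hy => h.drift_nonneg hlam hδ hα hy) _

theorem ruinDrift_le (h : IsVerification g lam δ α b Φ) (hlam : 0 < lam) (hδ : 0 < δ)
    (hα : 0 < α) {m : ℝ} (hm : 0 ≤ m) (z : ℝ) :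
    ruinValue (harmonicDrift lam δ α Φ) m z ≤ (lam + δ) * Φ m := by
  have h0 : 0 ≤ (lam + δ) * Φ m := mul_nonneg (by positivity) (h.nonneg _)
  unfold ruinValue
  by_cases hz : min z m ∈ Ici (0 : ℝ)
  · rw [indicator_of_mem hz]
    refine (h.drift_le hlam hα hz).trans ?_
    exact mul_le_mul_of_nonneg_left (h.mono hz hm (min_le_right _ _)) (by positivity)
  · rwa [indicator_of_notMem hz]

theorem measurable_ruinDrift (h : IsVerification g lam δ α b Φ) (m : ℝ) :
    Measurable (ruinValue (harmonicDrift lam δ α Φ) m) :=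
  ((continuous_harmonicDrift h.cont).measurable.indicator measurableSet_Ici).comp
    (measurable_id.min measurable_const)

/-- To first order the left side is (1 - λk)Φ + k((λ+δ)Φ - λA) + λkA = (1 + δk)Φ: the claim averages
cancel, which is what H is designed for. The shift ε costs its effect on A, weighted by λk, and
replacing 1 - exp(-λk) by λk costs (λk)². -/
theorem step_le (h : IsVerification g lam δ α b Φ) (hlam : 0 < lam) (hδ : 0 < δ)
    (hα : 0 < α) {m ε z k : ℝ} (hk : 0 ≤ k) (hε : 0 ≤ ε) (hz : 0 ≤ z) (hzm : z + ε ≤ m) :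
    Real.exp (-(lam * k)) * (Φ z + k * harmonicDrift lam δ α Φ z)
      + (1 - Real.exp (-(lam * k))) * claimAvg α Φ (z + ε)
      ≤ Real.exp (δ * k) * Φ z + lam * α * Φ m * ε * k + lam ^ 2 * Φ m * k ^ 2 := by
  obtain ⟨h1, h2, h3⟩ := exp_bounds (mul_nonneg hlam.le hk)
  set a := 1 - Real.exp (-(lam * k)) with ha
  have h4 : Real.exp (-(lam * k)) = 1 - a := by rw [ha]; ring
  rw [h4]
  have h5 := Real.add_one_le_exp (δ * k)
  have h6 := h.nonneg z
  have h7 := h.drift_nonneg hlam hδ hα hz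
  have hm0 : (0 : ℝ) ≤ m := by linarith
  have h8 := h.claimAvg_sub_le hα hz (by linarith : z ≤ z + ε)
  have h9 := h.mono (show z ∈ Ici 0 from hz) (show m ∈ Ici 0 from hm0) (by linarith)
  have h10 := h.mono (show z + ε ∈ Ici 0 by simp only [mem_Ici]; linarith)
    (show m ∈ Ici 0 from hm0) hzm
  have h11 := h.claimAvg_nonneg hα (by linarith : 0 ≤ z + ε)
  have h12 : claimAvg α Φ (z + ε) ≤ claimAvg α Φ z + α * Φ m * ε := by
    have : α * Φ (z + ε) * (z + ε - z) ≤ α * Φ m * ε := by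
      rw [add_sub_cancel_left]
      gcongr
    linarith
  have e1 : a * claimAvg α Φ (z + ε) ≤ lam * k * (claimAvg α Φ z + α * Φ m * ε) :=
    (mul_le_mul_of_nonneg_right h1 h11).trans (mul_le_mul_of_nonneg_left h12 (by positivity))
  -- This second-order product has a favourable sign here and is dropped; in the reverse estimate it
  -- must be bounded.
  have e2 : 0 ≤ a * (k * harmonicDrift lam δ α Φ z) := by positivity
  have e3 : (δ * k + 1) * Φ z ≤ Real.exp (δ * k) * Φ z := mul_le_mul_of_nonneg_right h5 h6
  have e4 : (lam * k - (lam * k) ^ 2) * Φ z ≤ a * Φ z := mul_le_mul_of_nonneg_right h2 h6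
  have e5 : (lam * k) ^ 2 * Φ z ≤ (lam * k) ^ 2 * Φ m := by gcongr
  have e6 : harmonicDrift lam δ α Φ z = (lam + δ) * Φ z - lam * claimAvg α Φ z := rfl
  have e7 : k * harmonicDrift lam δ α Φ z
      = k * ((lam + δ) * Φ z) - k * (lam * claimAvg α Φ z) := by rw [e6]; ring
  nlinarith

/-- The same cancellation in the other direction. The condition δk ≤ 1 permits the quadratic upper
bound on exp(δk). -/
theorem le_step (h : IsVerification g lam δ α b Φ) (hlam : 0 < lam) (hδ : 0 < δ)
    (hα : 0 < α) {m z k : ℝ} (hk : 0 ≤ k) (hδk : δ * k ≤ 1) (hz : 0 ≤ z) (hzm : z ≤ m) :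
    Real.exp (δ * k) * Φ z - (lam * (lam + δ) + δ ^ 2) * Φ m * k ^ 2 ≤
    Real.exp (-(lam * k)) * (Φ z + k * harmonicDrift lam δ α Φ z)
      + (1 - Real.exp (-(lam * k))) * claimAvg α Φ z := by
  obtain ⟨h1, h2, h3⟩ := exp_bounds (mul_nonneg hlam.le hk)
  set a := 1 - Real.exp (-(lam * k)) with ha
  have h4 : Real.exp (-(lam * k)) = 1 - a := by rw [ha]; ring
  rw [h4]
  have h5 := exp_le_quadratic (mul_nonneg hδ.le hk) hδk
  have h6 := h.nonneg z
  have h7 := h.drift_le (δ := δ) hlam hα hz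
  have h7' := h.drift_nonneg hlam hδ hα hz
  have hm0 : (0 : ℝ) ≤ m := by linarith
  have h8 := h.claimAvg_le hα hz
  have h9 := h.mono (show z ∈ Ici 0 from hz) (show m ∈ Ici 0 from hm0) hzm
  have e1 : a * (Φ z - claimAvg α Φ z) ≤ lam * k * (Φ z - claimAvg α Φ z) :=
    mul_le_mul_of_nonneg_right h1 (by linarith)
  have e2 : a * (k * harmonicDrift lam δ α Φ z) ≤ (lam * k) * (k * ((lam + δ) * Φ m)) := by
    refine mul_le_mul h1 ?_ (by positivity) (by positivity)
    refine mul_le_mul_of_nonneg_left (h7.trans ?_) hk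
    exact mul_le_mul_of_nonneg_left h9 (by positivity)
  have e3 : Real.exp (δ * k) * Φ z ≤ (1 + δ * k + (δ * k) ^ 2) * Φ z :=
    mul_le_mul_of_nonneg_right h5 h6
  have e5 : (δ * k) ^ 2 * Φ z ≤ (δ * k) ^ 2 * Φ m := by gcongr
  have e7 : k * harmonicDrift lam δ α Φ z
      = k * ((lam + δ) * Φ z) - k * (lam * claimAvg α Φ z) := by unfold harmonicDrift; ring
  nlinarith

theorem stepValue_mem {Ω : Type*} {T Y : ℕ → Ω → ℝ} (h : IsVerification g lam δ α b Φ) (hlam : 0 < lam) (hδ : 0 < δ)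
    (hα : 0 < α) {m : ℝ} (hm : 0 ≤ m) (ε : ℝ) {s t : ℝ≥0} (hst : s ≤ t) (ξ : Ω → ℝ) (ω : Ω) :
    stepValue lam δ α Φ T Y m ε s t ξ ω ∈ Icc 0 (Φ m + (t - s) * ((lam + δ) * Φ m)) := by
  have hst' : (0 : ℝ) ≤ t - s := sub_nonneg.2 hst
  have h1 := h.ruinValue_nonneg m (ξ ω)
  have h2 := h.ruinDrift_nonneg hlam hδ hα m (ξ ω)
  have h3 := h.ruinValue_nonneg m (ξ ω + ε - (aggregateClaims T Y t ω - aggregateClaims T Y s ω))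
  have h4 := h.ruinValue_le hm (ξ ω)
  have h5 := h.ruinDrift_le hlam hδ hα hm (ξ ω)
  have h6 := h.ruinValue_le hm (ξ ω + ε - (aggregateClaims T Y t ω - aggregateClaims T Y s ω))
  have h7 : 0 ≤ (lam + δ) * Φ m := mul_nonneg (by positivity) (h.nonneg _)
  have h8 := mul_le_mul_of_nonneg_left h5 hst'
  have h9 := mul_nonneg hst' h2
  have h10 := mul_nonneg hst' h7
  unfold stepValue
  by_cases hN : claimCount T t ω = claimCount T s ω
  · simp only [indicator, mem_ofPred_eq, hN, ne_eq, not_true_eq_false, if_true, if_false, add_zero]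
    constructor <;> linarith
  · simp only [indicator, mem_ofPred_eq, hN, ne_eq, not_false_eq_true, if_true, if_false, zero_add]
    constructor <;> linarith

end IsVerification

namespace IsClaimProcess

variable {Ω : Type*} [mΩ : MeasurableSpace Ω] {P : Measure Ω}
    {ℱ : Filtration ℝ≥0 mΩ} {lam δ α : ℝ} {T Y : ℕ → Ω → ℝ} {g : ℝ → ℝ} {b : ℝ} {Φ : ℝ → ℝ}

theorem measurable_stepValue (hc : IsClaimProcess P ℱ lam α T Y)
    (h : IsVerification g lam δ α b Φ) (m ε : ℝ) {s t : ℝ≥0} {ξ : Ω → ℝ} (hξ : Measurable ξ) :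
    Measurable (stepValue lam δ α Φ T Y m ε s t ξ) := by
  have hm : MeasurableSet {ω | claimCount T t ω = claimCount T s ω} :=
    measurableSet_eq_fun (hc.measurable_count t) (hc.measurable_count s)
  refine Measurable.add (Measurable.indicator ?_ hm) (Measurable.indicator ?_ hm.compl)
  · exact ((h.measurable_ruinValue m).comp hξ).add
      (((h.measurable_ruinDrift m).comp hξ).const_mul _)
  · exact (h.measurable_ruinValue m).comp ((hξ.add_const ε).sub
      ((hc.measurable_claims t).sub (hc.measurable_claims s)))

variable [IsProbabilityMeasure P]

/-- The part without claims factorises exactly by independence; the whole error comes from intervals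
with more than one claim. -/
theorem abs_integral_stepValue_sub_le (hc : IsClaimProcess P ℱ lam α T Y)
    (h : IsVerification g lam δ α b Φ) (hlam : 0 < lam) (hδ : 0 < δ) (hα : 0 < α)
    {m ε : ℝ} (hm : 0 ≤ m) {s t : ℝ≥0} (hst : s ≤ t) {ξ : Ω → ℝ} (hξ : Measurable[ℱ s] ξ) :
    |(∫ ω, stepValue lam δ α Φ T Y m ε s t ξ ω ∂P)
      - ∫ ω, (Real.exp (-(lam * (t - s))) * (ruinValue Φ m (ξ ω)
          + (t - s) * ruinValue (harmonicDrift lam δ α Φ) m (ξ ω))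
        + (1 - Real.exp (-(lam * (t - s)))) * ∫ y, ruinValue Φ m (ξ ω + ε - y) ∂(expMeasure α)) ∂P|
      ≤ Φ m * (lam * (t - s)) ^ 2 := by
  have := isProbabilityMeasure_expMeasure hα
  have hst' : (0 : ℝ) ≤ t - s := sub_nonneg.2 hst
  have hξ' : Measurable ξ := hξ.mono (ℱ.le s) le_rfl
  have hN : MeasurableSet {ω | claimCount T t ω = claimCount T s ω} :=
    measurableSet_eq_fun (hc.measurable_count t) (hc.measurable_count s)
  have hΦm := h.nonneg m
  set R : Ω → ℝ := fun ω => ruinValue Φ m (ξ ω)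
    + (t - s) * ruinValue (harmonicDrift lam δ α Φ) m (ξ ω) with hR
  have hRm' : Measurable fun z => ruinValue Φ m z
    + (t - s) * ruinValue (harmonicDrift lam δ α Φ) m z :=
    (h.measurable_ruinValue m).add ((h.measurable_ruinDrift m).const_mul _)
  have hRm : Measurable[ℱ s] R := hRm'.comp hξ
  have hRi : Integrable R P := by
    refine Integrable.of_bound (hRm'.comp hξ').aestronglyMeasurable
      (Φ m + (t - s) * ((lam + δ) * Φ m)) (ae_of_all _ fun ω => ?_)
    have h1 := h.ruinValue_nonneg m (ξ ω)
    have h2 := h.ruinDrift_nonneg hlam hδ hα m (ξ ω)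
    have h4 := h.ruinValue_le hm (ξ ω)
    have h5 := h.ruinDrift_le hlam hδ hα hm (ξ ω)
    simp only [hR]
    rw [Real.norm_eq_abs, abs_of_nonneg (by positivity)]
    gcongr
  set J : Ω → ℝ := fun ω => ∫ y, ruinValue Φ m (ξ ω + ε - y) ∂(expMeasure α) with hJ
  have hQm : StronglyMeasurable fun z => ∫ y, ruinValue Φ m (z + ε - y) ∂(expMeasure α) :=
    StronglyMeasurable.integral_prod_right (f := fun z y => ruinValue Φ m (z + ε - y))
      ((h.measurable_ruinValue m).comp (by fun_prop)).stronglyMeasurable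
  have hJi : Integrable J P := by
    refine Integrable.of_bound (hQm.measurable.comp hξ').aestronglyMeasurable (Φ m)
      (ae_of_all _ fun ω => ?_)
    have := norm_integral_le_of_norm_le_const (μ := expMeasure α)
      (f := fun y => ruinValue Φ m (ξ ω + ε - y)) (C := Φ m) (ae_of_all _ fun y => by
        rw [Real.norm_eq_abs, abs_of_nonneg (h.ruinValue_nonneg _ _)]; exact h.ruinValue_le hm _)
    simpa using this
  have h1 := hc.abs_integral_claim_comp_sub_le hlam hα hst (ξ := fun ω => ξ ω + ε)
    (hξ.add_const ε) (h.measurable_ruinValue m) (h.ruinValue_nonneg m) (h.ruinValue_le hm)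
  have h2 := hc.integral_noClaim_comp hlam hst hRm
  have hi2 : Integrable ({ω | claimCount T t ω ≠ claimCount T s ω}.indicator
      (fun ω => ruinValue Φ m
        (ξ ω + ε - (aggregateClaims T Y t ω - aggregateClaims T Y s ω)))) P := by
    refine Integrable.indicator ?_ hN.compl
    refine Integrable.of_bound ((h.measurable_ruinValue m).comp ((hξ'.add_const ε).sub
      ((hc.measurable_claims t).sub (hc.measurable_claims s)))).aestronglyMeasurable (Φ m)
      (ae_of_all _ fun ω => ?_)
    rw [Real.norm_eq_abs, abs_of_nonneg (h.ruinValue_nonneg _ _)]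
    exact h.ruinValue_le hm _
  have h3 : ∫ ω, stepValue lam δ α Φ T Y m ε s t ξ ω ∂P = _ :=
    integral_add (hRi.indicator hN) hi2
  rw [h3, integral_add (hRi.const_mul _) (hJi.const_mul _), integral_const_mul, integral_const_mul]
  have h4 : ∫ ω, {ω | claimCount T t ω = claimCount T s ω}.indicator R ω ∂P = _ := h2
  rw [h4]
  rw [add_sub_add_left_eq_sub]
  refine h1.trans ?_
  obtain ⟨e1, e2, e3⟩ := exp_bounds (mul_nonneg hlam.le hst')
  gcongr

theorem integral_stepValue_le (hc : IsClaimProcess P ℱ lam α T Y)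
    (h : IsVerification g lam δ α b Φ) (hlam : 0 < lam) (hδ : 0 < δ) (hα : 0 < α)
    {m ε : ℝ} (hε : 0 ≤ ε) (hε1 : ε < 1) (hm : 0 ≤ m) {s t : ℝ≥0} (hst : s ≤ t) {ξ : Ω → ℝ}
    (hξ : Measurable[ℱ s] ξ) (hξm : ∀ ω, ξ ω = -1 ∨ (0 ≤ ξ ω ∧ ξ ω + ε ≤ m)) :
    ∫ ω, stepValue lam δ α Φ T Y m ε s t ξ ω ∂P
      ≤ Real.exp (δ * (t - s)) * (∫ ω, ruinValue Φ m (ξ ω) ∂P)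
        + lam * α * Φ m * ε * (t - s) + 2 * lam ^ 2 * Φ m * (t - s) ^ 2 := by
  have hst' : (0 : ℝ) ≤ t - s := sub_nonneg.2 hst
  have h1 := (abs_le.1 (hc.abs_integral_stepValue_sub_le h hlam hδ hα (ε := ε) hm hst hξ)).2
  have hξ' : Measurable ξ := hξ.mono (ℱ.le s) le_rfl
  have hΦm := h.nonneg m
  have hi : Integrable (fun ω => ruinValue Φ m (ξ ω)) P := by
    refine Integrable.of_bound ((h.measurable_ruinValue m).comp hξ').aestronglyMeasurable (Φ m)
      (ae_of_all _ fun ω => ?_)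
    rw [Real.norm_eq_abs, abs_of_nonneg (h.ruinValue_nonneg _ _)]
    exact h.ruinValue_le hm _
  have h2 : ∫ ω, (Real.exp (-(lam * (t - s))) * (ruinValue Φ m (ξ ω)
          + (t - s) * ruinValue (harmonicDrift lam δ α Φ) m (ξ ω))
        + (1 - Real.exp (-(lam * (t - s)))) * ∫ y, ruinValue Φ m (ξ ω + ε - y) ∂(expMeasure α)) ∂P
      ≤ ∫ ω, (Real.exp (δ * (t - s)) * ruinValue Φ m (ξ ω)
        + (lam * α * Φ m * ε * (t - s) + lam ^ 2 * Φ m * (t - s) ^ 2)) ∂P := by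
    refine integral_mono_of_nonneg (ae_of_all _ fun ω => ?_)
      ((hi.const_mul _).add (integrable_const _)) (ae_of_all _ fun ω => ?_)
    · have e1 := h.ruinValue_nonneg m (ξ ω)
      have e2 := h.ruinDrift_nonneg hlam hδ hα m (ξ ω)
      have e3 := (exp_bounds (mul_nonneg hlam.le hst')).2.2
      have e4 : 0 ≤ ∫ y, ruinValue Φ m (ξ ω + ε - y) ∂(expMeasure α) :=
        integral_nonneg fun y => h.ruinValue_nonneg _ _
      simp only [Pi.zero_apply]
      positivity
    · beta_reduce
      rcases hξm ω with hω | ⟨hω0, hω1⟩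
      -- A ruined path is coded by -1, and -1 + ε is still negative because ε < 1, so the shift does
      -- not revive it.
      · rw [hω, integral_ruinValue hα Φ (by linarith), if_neg (by linarith),
          ruinValue_of_neg (by norm_num), ruinValue_of_neg (by norm_num)]
        simp only [mul_zero, add_zero, zero_add]
        positivity
      · rw [integral_ruinValue hα Φ hω1, if_pos (by linarith),
          ruinValue_of_mem hω0 (by linarith), ruinValue_of_mem hω0 (by linarith)]
        linarith [h.step_le hlam hδ hα hst' hε hω0 hω1]
  rw [integral_add (hi.const_mul _) (integrable_const _), integral_const_mul, integral_const,
    probReal_univ, one_smul] at h2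
  linarith

theorem le_integral_stepValue (hc : IsClaimProcess P ℱ lam α T Y)
    (h : IsVerification g lam δ α b Φ) (hlam : 0 < lam) (hδ : 0 < δ) (hα : 0 < α)
    {m : ℝ} (hm : 0 ≤ m) {s t : ℝ≥0} (hst : s ≤ t) (hδt : δ * (t - s) ≤ 1) {ξ : Ω → ℝ}
    (hξ : Measurable[ℱ s] ξ) (hξm : ∀ ω, ξ ω = -1 ∨ (0 ≤ ξ ω ∧ ξ ω ≤ m)) :
    Real.exp (δ * (t - s)) * (∫ ω, ruinValue Φ m (ξ ω) ∂P)
        - (lam * (lam + δ) + δ ^ 2 + lam ^ 2) * Φ m * (t - s) ^ 2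
      ≤ ∫ ω, stepValue lam δ α Φ T Y m 0 s t ξ ω ∂P := by
  have := isProbabilityMeasure_expMeasure hα
  have hst' : (0 : ℝ) ≤ t - s := sub_nonneg.2 hst
  have h1 := (abs_le.1 (hc.abs_integral_stepValue_sub_le h hlam hδ hα (ε := 0) hm hst hξ)).1
  have hξ' : Measurable ξ := hξ.mono (ℱ.le s) le_rfl
  have hΦm := h.nonneg m
  have hi : Integrable (fun ω => ruinValue Φ m (ξ ω)) P := by
    refine Integrable.of_bound ((h.measurable_ruinValue m).comp hξ').aestronglyMeasurable (Φ m)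
      (ae_of_all _ fun ω => ?_)
    rw [Real.norm_eq_abs, abs_of_nonneg (h.ruinValue_nonneg _ _)]
    exact h.ruinValue_le hm _
  have hd : Integrable (fun ω => ruinValue (harmonicDrift lam δ α Φ) m (ξ ω)) P := by
    refine Integrable.of_bound ((h.measurable_ruinDrift m).comp hξ').aestronglyMeasurable
      ((lam + δ) * Φ m) (ae_of_all _ fun ω => ?_)
    rw [Real.norm_eq_abs, abs_of_nonneg (h.ruinDrift_nonneg hlam hδ hα _ _)]
    exact h.ruinDrift_le hlam hδ hα hm _
  have hQm : StronglyMeasurable fun z => ∫ y, ruinValue Φ m (z + 0 - y) ∂(expMeasure α) :=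
    StronglyMeasurable.integral_prod_right (f := fun z y => ruinValue Φ m (z + 0 - y))
      ((h.measurable_ruinValue m).comp (by fun_prop)).stronglyMeasurable
  have hJi : Integrable (fun ω => ∫ y, ruinValue Φ m (ξ ω + 0 - y) ∂(expMeasure α)) P := by
    refine Integrable.of_bound (hQm.measurable.comp hξ').aestronglyMeasurable (Φ m)
      (ae_of_all _ fun ω => ?_)
    have := norm_integral_le_of_norm_le_const (μ := expMeasure α)
      (f := fun y => ruinValue Φ m (ξ ω + 0 - y)) (C := Φ m) (ae_of_all _ fun y => by
        rw [Real.norm_eq_abs, abs_of_nonneg (h.ruinValue_nonneg _ _)]; exact h.ruinValue_le hm _)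
    simpa using this
  have h2 : ∫ ω, (Real.exp (δ * (t - s)) * ruinValue Φ m (ξ ω)
        - (lam * (lam + δ) + δ ^ 2) * Φ m * (t - s) ^ 2) ∂P ≤
      ∫ ω, (Real.exp (-(lam * (t - s))) * (ruinValue Φ m (ξ ω)
          + (t - s) * ruinValue (harmonicDrift lam δ α Φ) m (ξ ω))
        + (1 - Real.exp (-(lam * (t - s)))) * ∫ y, ruinValue Φ m (ξ ω + 0 - y) ∂(expMeasure α)) ∂P := by
    refine integral_mono ((hi.const_mul _).sub (integrable_const _))
      (((hi.add (hd.const_mul _)).const_mul _).add (hJi.const_mul _)) fun ω => ?_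
    beta_reduce
    rcases hξm ω with hω | ⟨hω0, hω1⟩
    · rw [hω, integral_ruinValue hα Φ (by linarith), if_neg (by linarith),
        ruinValue_of_neg (by norm_num), ruinValue_of_neg (by norm_num)]
      simp only [mul_zero, add_zero, zero_sub]
      have : 0 ≤ (lam * (lam + δ) + δ ^ 2) * Φ m * (t - s) ^ 2 := by positivity
      linarith
    · rw [integral_ruinValue hα Φ (by linarith), if_pos (by linarith),
        ruinValue_of_mem hω0 hω1, ruinValue_of_mem hω0 hω1, add_zero]
      exact h.le_step hlam hδ hα hst' hδt hω0 hω1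
  rw [integral_sub (hi.const_mul _) (integrable_const _), integral_const_mul, integral_const,
    probReal_univ, one_smul] at h2
  linarith

end IsClaimProcess

/-! ### Upper bound for admissible controls -/

open Classical in
/-- The surplus at time `s` if there was no ruin up to `s`, and `-1` otherwise. -/
noncomputable def aliveSurplus (X : ℝ → ℝ) (s : ℝ) : ℝ :=
  if ∀ r ∈ Icc 0 s, 0 ≤ X r then X s else -1

theorem aliveSurplus_of_alive {X : ℝ → ℝ} {s : ℝ} (h : ∀ r ∈ Icc 0 s, 0 ≤ X r) :
    aliveSurplus X s = X s := if_pos h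

theorem aliveSurplus_of_not_alive {X : ℝ → ℝ} {s : ℝ} (h : ¬ ∀ r ∈ Icc 0 s, 0 ≤ X r) :
    aliveSurplus X s = -1 := if_neg h

/-- A negative value persists on a short interval to the right, so rational times and the endpoint
decide survival. This makes survival up to s an event of the σ-algebra at time s. -/
theorem IsControlledPath.alive_iff {g : ℝ → ℝ} {x : ℝ} {S : ℝ → ℝ} {D : StieltjesFunction ℝ}
    {X : ℝ → ℝ} (h : IsControlledPath g x S D X) {s : ℝ} (hs : 0 ≤ s) :
    (∀ r ∈ Icc 0 s, 0 ≤ X r) ↔ (∀ q : ℚ, (q : ℝ) ∈ Icc 0 s → 0 ≤ X q) ∧ 0 ≤ X s := by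
  refine ⟨fun H => ⟨fun q hq => H q hq, H s ⟨hs, le_rfl⟩⟩, fun ⟨H1, H2⟩ r hr => ?_⟩
  rcases hr.2.eq_or_lt with h1 | h1
  · rwa [h1]
  · by_contra hneg
    have h2 : ∀ᶠ v in 𝓝[Ici r] r, X v < 0 :=
      (h.continuousWithinAt hr.1).eventually (Iio_mem_nhds (not_le.1 hneg))
    obtain ⟨d, hd, hd'⟩ := mem_nhdsGE_iff_exists_Ico_subset.1 h2
    obtain ⟨q, hq1, hq2⟩ := exists_rat_btwn (lt_min h1 hd)
    have h3 : X q < 0 := hd' ⟨hq1.le, hq2.trans_le (min_le_right _ _)⟩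
    exact absurd (H1 q ⟨hr.1.trans hq1.le, (hq2.trans_le (min_le_left _ _)).le⟩) (not_le.2 h3)

theorem IsAdmissible.measurable_aliveSurplus {Ω : Type*} [mΩ : MeasurableSpace Ω] {P : Measure Ω}
    {ℱ : Filtration ℝ≥0 mΩ} {lam α : ℝ} {T Y : ℕ → Ω → ℝ} (hc : IsClaimProcess P ℱ lam α T Y)
    {g : ℝ → ℝ} {x : ℝ} {D : Ω → StieltjesFunction ℝ} {X : Ω → ℝ → ℝ}
    (h : IsAdmissible ℱ g T Y x D X) (s : ℝ≥0) :
    Measurable[ℱ s] fun ω => aliveSurplus (X ω) s := by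
  have hset : MeasurableSet[ℱ s] {ω | ∀ r ∈ Icc 0 (s : ℝ), 0 ≤ X ω r} := by
    have h1 : {ω | ∀ r ∈ Icc 0 (s : ℝ), 0 ≤ X ω r}
        = (⋂ q : ℚ, {ω | (q : ℝ) ∈ Icc 0 (s : ℝ) → 0 ≤ X ω q}) ∩ {ω | 0 ≤ X ω s} := by
      ext ω
      simp only [mem_ofPred_eq, mem_inter_iff, mem_iInter]
      exact (h.isControlledPath hc ω).alive_iff s.coe_nonneg
    rw [h1]
    refine MeasurableSet.inter (MeasurableSet.iInter fun q => ?_) (h.adapted_X s measurableSet_Ici)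
    by_cases hq : (q : ℝ) ∈ Icc 0 (s : ℝ)
    · have h2 : Measurable[ℱ s] fun ω => X ω q :=
        (h.adapted_X ⟨q, hq.1⟩).mono (ℱ.mono (show (⟨q, hq.1⟩ : ℝ≥0) ≤ s from hq.2)) le_rfl
      simp only [hq, true_imp_iff]
      exact h2 measurableSet_Ici
    · simp [hq]
  exact Measurable.ite hset (h.adapted_X s) measurable_const

/-- Grid points of mesh `h`. -/
noncomputable def node (h : ℝ≥0) (k : ℕ) : ℝ≥0 := k * h

theorem node_zero (h : ℝ≥0) : node h 0 = 0 := by simp [node]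

theorem node_succ (h : ℝ≥0) (k : ℕ) : node h (k + 1) = node h k + h := by
  simp [node, add_mul]

theorem node_mono (h : ℝ≥0) : Monotone (node h) := fun i j hij => by
  unfold node
  gcongr

theorem node_le_succ (h : ℝ≥0) (k : ℕ) : node h k ≤ node h (k + 1) := node_mono h k.le_succ

theorem coe_node_succ (h : ℝ≥0) (k : ℕ) : (node h (k + 1) : ℝ) = node h k + h := by
  rw [node_succ]; simp

/-- Discounted gain of the value process over the `k`-th grid interval. -/
noncomputable def stepGain {Ω : Type*} (lam δ α : ℝ) (Φ : ℝ → ℝ) (T Y : ℕ → Ω → ℝ)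
    (X : Ω → ℝ → ℝ) (m ε : ℝ) (h : ℝ≥0) (k : ℕ) (ω : Ω) : ℝ :=
  Real.exp (-δ * node h (k + 1)) * stepValue lam δ α Φ T Y m ε (node h k) (node h (k + 1))
      (fun ω => aliveSurplus (X ω) (node h k)) ω
    - Real.exp (-δ * node h k) * ruinValue Φ m (aliveSurplus (X ω) (node h k))

theorem setLIntegral_exp_le {D : StieltjesFunction ℝ} {δ a c : ℝ} (hδ : 0 ≤ δ) :
    ∫⁻ v in Ioc a c, ENNReal.ofReal (Real.exp (-δ * v)) ∂D.measure
      ≤ ENNReal.ofReal (Real.exp (-δ * a) * (D c - D a)) := by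
  calc ∫⁻ v in Ioc a c, ENNReal.ofReal (Real.exp (-δ * v)) ∂D.measure
      ≤ ∫⁻ v in Ioc a c, ENNReal.ofReal (Real.exp (-δ * a)) ∂D.measure := by
        refine setLIntegral_mono measurable_const fun v hv => ?_
        refine ENNReal.ofReal_le_ofReal (Real.exp_le_exp.2 ?_)
        nlinarith [hv.1]
    _ = _ := by
        rw [setLIntegral_const, D.measure_Ioc, ENNReal.ofReal_mul (Real.exp_pos _).le]

/-- An upper Riemann-Stieltjes sum: each payment is discounted at the left node of its grid
interval, and the payment at time 0 is the atom D(0). Stopping at r allows r to lie off the grid. -/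
theorem IsControlledPath.setLIntegral_exp_Icc_le {g : ℝ → ℝ} {x : ℝ} {S : ℝ → ℝ}
    {D : StieltjesFunction ℝ} {X : ℝ → ℝ} (hp : IsControlledPath g x S D X) {δ r : ℝ} (hδ : 0 ≤ δ)
    (hr : 0 ≤ r) (h : ℝ≥0) (n : ℕ) (hn : r ≤ node h n) :
    ∫⁻ v in Icc 0 r, ENNReal.ofReal (Real.exp (-δ * v)) ∂D.measure
      ≤ ENNReal.ofReal (D 0 + ∑ k ∈ Finset.range n, Real.exp (-δ * node h k)
          * (D (min (node h (k + 1) : ℝ) r) - D (min (node h k : ℝ) r))) := by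
  have hnn : ∀ k, 0 ≤ Real.exp (-δ * node h k)
      * (D (min (node h (k + 1) : ℝ) r) - D (min (node h k : ℝ) r)) := fun k =>
    mul_nonneg (Real.exp_pos _).le (sub_nonneg.2 (D.mono (min_le_min_right _ (node_le_succ h k))))
  have key : ∀ j : ℕ, ∫⁻ v in Icc 0 (min (node h j : ℝ) r),
      ENNReal.ofReal (Real.exp (-δ * v)) ∂D.measure
      ≤ ENNReal.ofReal (D 0 + ∑ k ∈ Finset.range j, Real.exp (-δ * node h k)
          * (D (min (node h (k + 1) : ℝ) r) - D (min (node h k : ℝ) r))) := by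
    intro j
    induction j with
    | zero =>
      rw [node_zero, NNReal.coe_zero, min_eq_left hr]
      simp [D.measure_singleton, hp.leftLim_D_zero]
    | succ j ih =>
      have h0 : 0 ≤ min (node h j : ℝ) r := le_min (NNReal.coe_nonneg _) hr
      have hle : min (node h j : ℝ) r ≤ min (node h (j + 1) : ℝ) r :=
        min_le_min_right _ (node_le_succ h j)
      rw [← Icc_union_Ioc_eq_Icc h0 hle]
      refine (lintegral_union_le _ _ _).trans ?_
      rw [Finset.sum_range_succ, ← add_assoc,
        ENNReal.ofReal_add (add_nonneg (hp.D_nonneg 0) (Finset.sum_nonneg fun k _ => hnn k)) (hnn j)]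
      refine add_le_add ih ?_
      rcases le_total (node h j : ℝ) r with hc | hc
      · rw [min_eq_left hc]
        exact setLIntegral_exp_le hδ
      · rw [min_eq_right hc, min_eq_right
          (hc.trans (show (node h j : ℝ) ≤ node h (j + 1) from node_le_succ h j))]
        simp
  have := key n
  rwa [min_eq_right hn] at this

section PathUpper

variable {Ω : Type*} {T Y : ℕ → Ω → ℝ} {ω : Ω} {g : ℝ → ℝ} {x : ℝ} {D : StieltjesFunction ℝ}
    {X : Ω → ℝ → ℝ} {lam δ α b : ℝ} {Φ : ℝ → ℝ} {K : ℝ≥0}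

/-- Joins the two interval estimates to `stepValue`. If ruin occurs by the end of the interval, the
value there is 0 and, by `hr`, the payments counted up to r ended before the interval, so
nonnegativity of `stepValue` suffices. Dividends paid at or after ruin thus never enter. -/
theorem step_upper
    (hp : IsControlledPath g x (fun t => aggregateClaims T Y t ω) D (X ω))
    (hg : LipschitzWith K g) (hgn : ∀ z, 0 ≤ z → 0 ≤ g z)
    (hΦ : IsVerification g lam δ α b Φ) (hlam : 0 < lam) (hδ : 0 < δ) (hα : 0 < α) (hx : 0 ≤ x)
    {t : ℝ} {ε d ε' : ℝ} (hε : 0 < ε) (hε' : 0 ≤ ε')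
    (hd : ∀ y z, 0 ≤ y → y ≤ z → z ≤ surplusBound g K x t → z - y ≤ d → Φ z ≤ Φ y + ε')
    {h : ℝ≥0} {k : ℕ} (hkt : node h (k + 1) ≤ t)
    (hd' : (g 0 + K * surplusBound g K x t) * h ≤ min d ε) {r : ℝ}
    (hr : (¬ ∀ v ∈ Icc 0 (node h (k + 1) : ℝ), 0 ≤ X ω v) → r ≤ node h k) :
    ruinValue Φ (surplusBound g K x t + ε) (aliveSurplus (X ω) (node h (k + 1)))
      + (D (min (node h (k + 1) : ℝ) r) - D (min (node h k : ℝ) r))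
      ≤ stepValue lam δ α Φ T Y (surplusBound g K x t + ε) ε (node h k) (node h (k + 1))
          (fun ω => aliveSurplus (X ω) (node h k)) ω
        + h * ((lam + δ) * ε' + lam * α * Φ (surplusBound g K x t)
          * (D (node h (k + 1)) - D (node h k))) := by
  set M := surplusBound g K x t with hM
  have hs : (0 : ℝ) ≤ node h k := NNReal.coe_nonneg _
  have hsu : (node h k : ℝ) ≤ node h (k + 1) := node_le_succ h k
  have hsh := coe_node_succ h k
  have hDm := D.mono hsu
  have hΦM := hΦ.nonneg M
  have ht : 0 ≤ t := (hs.trans hsu).trans hkt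
  have hM0 : 0 ≤ M := by
    have := hgn 0 le_rfl
    rw [hM, surplusBound]
    positivity
  have herr : 0 ≤ (h : ℝ) * ((lam + δ) * ε' + lam * α * Φ M
      * (D (node h (k + 1)) - D (node h k))) := by
    have := sub_nonneg.2 hDm
    positivity
  by_cases hal : ∀ v ∈ Icc 0 (node h (k + 1) : ℝ), 0 ≤ X ω v
  · have hals : ∀ v ∈ Icc 0 (node h k : ℝ), 0 ≤ X ω v := fun v hv => hal v ⟨hv.1, hv.2.trans hsu⟩
    have hXM : ∀ v ∈ Icc 0 (node h (k + 1) : ℝ), X ω v ∈ Icc 0 M := fun v hv =>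
      ⟨hal v hv, hp.le_surplusBound hg hgn hx hv.1 (hv.2.trans hkt)
        fun w hw => hal w ⟨hw.1, hw.2.trans hv.2⟩⟩
    have hXM' : ∀ v ∈ Icc (node h k : ℝ) (node h (k + 1)), X ω v ∈ Icc 0 M := fun v hv =>
      hXM v ⟨hs.trans hv.1, hv.2⟩
    have hXu := hXM _ ⟨hs.trans hsu, le_rfl⟩
    have hXs := hXM _ ⟨hs, hsu⟩
    have hDmin : D (min (node h (k + 1) : ℝ) r) - D (min (node h k : ℝ) r)
        ≤ D (node h (k + 1)) - D (node h k) := by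
      rcases le_total r (node h k) with hc | hc
      · rw [min_eq_right hc, min_eq_right (hc.trans hsu)]
        linarith
      · rw [min_eq_left hc]
        linarith [D.mono (min_le_left (node h (k + 1) : ℝ) r)]
    have hmesh : (node h (k + 1) : ℝ) - node h k = h := by rw [hsh]; ring
    rw [aliveSurplus_of_alive hal, ruinValue_of_mem hXu.1 (by linarith [hXu.2])]
    unfold stepValue
    by_cases hN : claimCount T (node h (k + 1)) ω = claimCount T (node h k) ω
    · have h1 := hp.value_add_dividends_le_of_noClaim hg hgn hΦ hlam hδ hα hε' hs hsu
        (by simp only [aggregateClaims, hN]) hXM' hd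
        (by rw [hmesh]; exact hd'.trans (min_le_left _ _))
      rw [hmesh] at h1
      simp only [indicator, mem_ofPred_eq, hN, ne_eq, not_true_eq_false, if_true, if_false,
        add_zero, aliveSurplus_of_alive hals]
      rw [ruinValue_of_mem hXs.1 (by linarith [hXs.2]),
        ruinValue_of_mem hXs.1 (by linarith [hXs.2]), hmesh]
      linarith
    · have h1 := hp.value_add_dividends_le_of_claim (ε := ε) hg hgn hΦ hs hsu hXM'
        (by rw [hmesh]; exact hd'.trans (min_le_right _ _))
      beta_reduce at h1
      have hSm := hp.claims.mono hsu
      simp only [indicator, mem_ofPred_eq, hN, ne_eq, not_false_eq_true, if_true, if_false,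
        zero_add, aliveSurplus_of_alive hals]
      beta_reduce at hSm
      rw [show X ω (node h k) + ε - (aggregateClaims T Y (node h (k + 1)) ω
          - aggregateClaims T Y (node h k) ω) = X ω (node h k) - (aggregateClaims T Y
          (node h (k + 1)) ω - aggregateClaims T Y (node h k) ω) + ε by ring,
        ruinValue_of_mem h1.1 (by linarith [hXs.2])]
      linarith [h1.2]
  · have hrs := hr hal
    rw [aliveSurplus_of_not_alive hal, ruinValue_of_neg (by norm_num), min_eq_right hrs,
      min_eq_right (hrs.trans hsu)]
    have := (hΦ.stepValue_mem (T := T) (Y := Y) hlam hδ hα (m := M + ε) (by linarith) ε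
      (node_le_succ h k) (fun ω => aliveSurplus (X ω) (node h k)) ω).1
    linarith

/-- Telescoping of discounted values. Dividends are discounted at left nodes but values at right
nodes; the mismatch is at most δh per unit paid, which explains the extra δ in the coefficient of h
D(t). -/
theorem path_upper
    (hp : IsControlledPath g x (fun t => aggregateClaims T Y t ω) D (X ω))
    (hg : LipschitzWith K g) (hgn : ∀ z, 0 ≤ z → 0 ≤ g z)
    (hΦ : IsVerification g lam δ α b Φ) (hlam : 0 < lam) (hδ : 0 < δ) (hα : 0 < α) (hx : 0 ≤ x)
    (hX0 : 0 ≤ X ω 0)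
    {t : ℝ} {ε d ε' : ℝ} (hε : 0 < ε) (hε' : 0 ≤ ε')
    (hd : ∀ y z, 0 ≤ y → y ≤ z → z ≤ surplusBound g K x t → z - y ≤ d → Φ z ≤ Φ y + ε')
    {h : ℝ≥0} {n : ℕ} (hnt : node h n = t)
    (hd' : (g 0 + K * surplusBound g K x t) * h ≤ min d ε) {r : ℝ}
    (hr : ∀ k < n, (¬ ∀ v ∈ Icc 0 (node h (k + 1) : ℝ), 0 ≤ X ω v) → r ≤ node h k) :
    D 0 + ∑ k ∈ Finset.range n, Real.exp (-δ * node h k)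
          * (D (min (node h (k + 1) : ℝ) r) - D (min (node h k : ℝ) r))
      ≤ Φ x + ∑ k ∈ Finset.range n,
          stepGain lam δ α Φ T Y X (surplusBound g K x t + ε) ε h k ω
        + (t * ((lam + δ) * ε')
          + h * ((lam * α * Φ (surplusBound g K x t) + δ) * D t)) := by
  set M := surplusBound g K x t with hM
  set m := M + ε with hm
  have hΦM := hΦ.nonneg M
  have hC : 0 ≤ lam * α * Φ M + δ := by positivity
  have hh : (0 : ℝ) ≤ h := h.coe_nonneg
  have key : ∀ j ≤ n, Real.exp (-δ * node h j) * ruinValue Φ m (aliveSurplus (X ω) (node h j))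
      + (D 0 + ∑ k ∈ Finset.range j, Real.exp (-δ * node h k)
          * (D (min (node h (k + 1) : ℝ) r) - D (min (node h k : ℝ) r)))
      ≤ Φ x + ∑ k ∈ Finset.range j, stepGain lam δ α Φ T Y X m ε h k ω
        + (node h j * ((lam + δ) * ε')
          + h * ((lam * α * Φ M + δ) * D (node h j))) := by
    intro j
    induction j with
    | zero =>
      intro _
      have h1 := hp.surplus 0 le_rfl
      rw [hp.claims.zero, intervalIntegral.integral_same] at h1
      have hD0 := hp.D_nonneg 0
      have h2 := hΦ.slope (X ω 0) x hX0 (by linarith)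
      have hal : ∀ v ∈ Icc (0 : ℝ) 0, 0 ≤ X ω v := fun v hv => by
        rw [le_antisymm hv.2 hv.1]; exact hX0
      have ht : 0 ≤ t := by rw [← hnt]; exact NNReal.coe_nonneg _
      have h3 := hp.le_surplusBound hg hgn hx le_rfl ht hal
      simp only [node_zero, NNReal.coe_zero, mul_zero, Real.exp_zero, one_mul, Finset.range_zero,
        Finset.sum_empty, add_zero, zero_mul, zero_add]
      rw [aliveSurplus_of_alive hal, ruinValue_of_mem hX0 (by linarith)]
      have := mul_nonneg hh (mul_nonneg hC hD0)
      linarith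
    | succ j ih =>
      intro hj
      have h1 := ih (by omega)
      have hjt : (node h (j + 1) : ℝ) ≤ t := by rw [← hnt]; exact node_mono h hj
      have h2 := step_upper hp hg hgn hΦ hlam hδ hα hx hε hε' hd hjt hd' (hr j (by omega))
      rw [Finset.sum_range_succ, Finset.sum_range_succ]
      set E1 := Real.exp (-δ * node h (j + 1)) with hE1
      set E0 := Real.exp (-δ * node h j) with hE0
      have hE1p : 0 < E1 := Real.exp_pos _
      have hE11 : E1 ≤ 1 := by
        rw [hE1]
        refine Real.exp_le_one_iff.2 ?_
        have : (0 : ℝ) ≤ node h (j + 1) := NNReal.coe_nonneg _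
        nlinarith
      have hE01 : E0 ≤ 1 := by
        rw [hE0]
        refine Real.exp_le_one_iff.2 ?_
        have : (0 : ℝ) ≤ node h j := NNReal.coe_nonneg _
        nlinarith
      have hEdiff : E0 - E1 ≤ δ * h := by
        have e1 : E1 = E0 * Real.exp (-(δ * h)) := by
          rw [hE1, hE0, ← Real.exp_add, coe_node_succ]
          ring_nf
        have e2 := (exp_bounds (mul_nonneg hδ.le hh)).1
        have e3 := (exp_bounds (mul_nonneg hδ.le hh)).2.2
        have e4 : 0 < E0 := Real.exp_pos _
        rw [e1]
        nlinarith
      set ΔD := D (min (node h (j + 1) : ℝ) r) - D (min (node h j : ℝ) r) with hΔ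
      have hΔ0 : 0 ≤ ΔD := sub_nonneg.2 (D.mono (min_le_min_right _ (node_le_succ h j)))
      have hΔ1 : ΔD ≤ D (node h (j + 1)) - D (node h j) := by
        have hsu : (node h j : ℝ) ≤ node h (j + 1) := node_le_succ h j
        rcases le_total r (node h j) with hc | hc
        · rw [hΔ, min_eq_right hc, min_eq_right (hc.trans hsu)]
          linarith [D.mono hsu]
        · rw [hΔ, min_eq_left hc]
          linarith [D.mono (min_le_left (node h (j + 1) : ℝ) r)]
      set ΔF := D (node h (j + 1)) - D (node h j) with hΔF
      have h3 := mul_le_mul_of_nonneg_left h2 hE1p.le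
      have h4 : (E0 - E1) * ΔD ≤ δ * h * ΔF :=
        (mul_le_mul_of_nonneg_right hEdiff hΔ0).trans
          (mul_le_mul_of_nonneg_left hΔ1 (by positivity))
      have hQ : 0 ≤ (h : ℝ) * ((lam + δ) * ε' + lam * α * Φ M * ΔF) := by
        have := hΔ0.trans hΔ1
        positivity
      have h5 : E1 * (h * ((lam + δ) * ε' + lam * α * Φ M * ΔF))
          ≤ h * ((lam + δ) * ε' + lam * α * Φ M * ΔF) := mul_le_of_le_one_left hQ hE11
      have hsh := coe_node_succ h j
      have hSG : stepGain lam δ α Φ T Y X m ε h j ω = E1 * stepValue lam δ α Φ T Y m ε (node h j)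
          (node h (j + 1)) (fun ω => aliveSurplus (X ω) (node h j)) ω
          - E0 * ruinValue Φ m (aliveSurplus (X ω) (node h j)) := rfl
      have hM1 : (node h (j + 1) : ℝ) * ((lam + δ) * ε')
          = node h j * ((lam + δ) * ε') + h * ((lam + δ) * ε') := by rw [hsh]; ring
      have hDF : D (node h (j + 1)) = D (node h j) + ΔF := by rw [hΔF]; ring
      rw [← hM, ← hm] at h3
      rw [hSG, hM1, hDF]
      linarith
  have h1 := key n le_rfl
  rw [hnt] at h1
  -- The discounted value left at the horizon is nonnegative and is discarded.
  have h2 : 0 ≤ Real.exp (-δ * t) * ruinValue Φ m (aliveSurplus (X ω) t) :=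
    mul_nonneg (Real.exp_pos _).le (hΦ.ruinValue_nonneg _ _)
  linarith

end PathUpper

/-! ### Ruin time and discounted gains on the grid -/

theorem le_ruinTime_iff {X : ℝ → ℝ} {a : EReal} :
    a ≤ ruinTime X ↔ ∀ t : ℝ, 0 ≤ t → X t < 0 → a ≤ t := by
  refine ⟨fun h t ht hX => h.trans (sInf_le ⟨t, ht, hX, rfl⟩), fun h => le_sInf ?_⟩
  rintro s ⟨t, ht, hX, rfl⟩
  exact h t ht hX

theorem nonneg_of_lt_ruinTime {X : ℝ → ℝ} {r : ℝ} (h0 : 0 ≤ r) (h : (r : EReal) < ruinTime X) :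
    0 ≤ X r := by
  by_contra hX
  exact absurd (le_ruinTime_iff.1 le_rfl r h0 (not_le.1 hX)) (not_le.2 h)

theorem zero_le_ruinTime (X : ℝ → ℝ) : 0 ≤ ruinTime X :=
  le_ruinTime_iff.2 fun t ht _ => by exact_mod_cast ht

section

variable {Ω : Type*} [mΩ : MeasurableSpace Ω] {P : Measure Ω} {ℱ : Filtration ℝ≥0 mΩ}
  {lam δ α b : ℝ} {T Y : ℕ → Ω → ℝ} {g : ℝ → ℝ} {x : ℝ} {D : Ω → StieltjesFunction ℝ}
  {X : Ω → ℝ → ℝ} {Φ : ℝ → ℝ} {K : ℝ≥0}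

/-- Ruin cannot precede time 0, so the payment constraint applies at 0, where the left limit of the
surplus is x and that of D is 0. -/
theorem IsAdmissible.surplus_zero_nonneg (hc : IsClaimProcess P ℱ lam α T Y)
    (h : IsAdmissible ℱ g T Y x D X) (ω : Ω) : 0 ≤ X ω 0 := by
  have hp := h.isControlledPath hc ω
  have h1 := h.jump_le ω 0 le_rfl (zero_le_ruinTime _)
  have h2 : Function.leftLim (X ω) 0 = x := by
    refine leftLim_eq_of_tendsto ?_
    refine tendsto_const_nhds.congr' ?_
    filter_upwards [self_mem_nhdsWithin] with v hv
    exact (hp.X_neg v hv).symm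
  rw [jump, hp.leftLim_D_zero, h2] at h1
  have h3 := hp.surplus 0 le_rfl
  rw [hp.claims.zero, intervalIntegral.integral_same] at h3
  linarith

theorem IsAdmissible.aliveSurplus_mem (hc : IsClaimProcess P ℱ lam α T Y)
    (h : IsAdmissible ℱ g T Y x D X) (hg : LipschitzWith K g) (hgn : ∀ z, 0 ≤ z → 0 ≤ g z)
    (hx : 0 ≤ x) {s t : ℝ} (hs : 0 ≤ s) (hst : s ≤ t) (ω : Ω) :
    aliveSurplus (X ω) s = -1
      ∨ (0 ≤ aliveSurplus (X ω) s ∧ aliveSurplus (X ω) s ≤ surplusBound g K x t) := by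
  by_cases hal : ∀ v ∈ Icc 0 s, 0 ≤ X ω v
  · right
    rw [aliveSurplus_of_alive hal]
    exact ⟨hal s ⟨hs, le_rfl⟩, (h.isControlledPath hc ω).le_surplusBound hg hgn hx hs hst hal⟩
  · exact Or.inl (aliveSurplus_of_not_alive hal)

/-- Without a claim `stepValue` is at least the current value, so only discounting is lost; with a
claim at most Φ(m) is lost, which is charged to the claim count. The sum over any grid is then at
least -Φ(m)(1 + N(t)), an integrable bound independent of the mesh. -/
theorem stepGain_ge (hc : IsClaimProcess P ℱ lam α T Y) (hΦ : IsVerification g lam δ α b Φ)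
    (hlam : 0 < lam) (hδ : 0 < δ) (hα : 0 < α) {m : ℝ} (hm : 0 ≤ m) (ε : ℝ) (h : ℝ≥0) (k : ℕ)
    (ω : Ω) :
    -(Φ m * (Real.exp (-δ * node h k) - Real.exp (-δ * node h (k + 1))
      + (claimCount T (node h (k + 1)) ω - claimCount T (node h k) ω)))
      ≤ stepGain lam δ α Φ T Y X m ε h k ω := by
  unfold stepGain
  set E0 := Real.exp (-δ * node h k) with hE0
  set E1 := Real.exp (-δ * node h (k + 1)) with hE1
  have hs : (node h k : ℝ) ≤ node h (k + 1) := node_le_succ h k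
  have hs0 : (0 : ℝ) ≤ node h k := NNReal.coe_nonneg _
  have hE1p : 0 < E1 := Real.exp_pos _
  have hE01 : E0 ≤ 1 := Real.exp_le_one_iff.2 (by nlinarith)
  have hE10 : E1 ≤ E0 := Real.exp_le_exp.2 (by nlinarith)
  set ξ := aliveSurplus (X ω) (node h k) with hξ
  have hR0 := hΦ.ruinValue_nonneg m ξ
  have hR1 := hΦ.ruinValue_le hm ξ
  have hN : claimCount T (node h k) ω ≤ claimCount T (node h (k + 1)) ω :=
    claimCount_mono (hc.T_tendsto ω) hs
  by_cases hN' : claimCount T (node h (k + 1)) ω = claimCount T (node h k) ω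
  · have h1 : ruinValue Φ m ξ ≤ stepValue lam δ α Φ T Y m ε (node h k) (node h (k + 1))
        (fun ω => aliveSurplus (X ω) (node h k)) ω := by
      have := mul_nonneg (sub_nonneg.2 hs) (hΦ.ruinDrift_nonneg hlam hδ hα m ξ)
      simp only [stepValue, indicator, mem_ofPred_eq, hN', ne_eq, not_true_eq_false, if_true,
        if_false, add_zero]
      linarith
    have h2 := mul_le_mul_of_nonneg_left h1 hE1p.le
    rw [hN', sub_self, add_zero]
    nlinarith
  · have h1 := (hΦ.stepValue_mem (T := T) (Y := Y) hlam hδ hα hm ε (node_le_succ h k)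
      (fun ω => aliveSurplus (X ω) (node h k)) ω).1
    have h2 : (claimCount T (node h k) ω : ℝ) + 1 ≤ claimCount T (node h (k + 1)) ω := by
      exact_mod_cast lt_of_le_of_ne hN (Ne.symm hN')
    have h3 := mul_nonneg hE1p.le h1
    have h4 : E0 * ruinValue Φ m ξ ≤ Φ m := by
      nlinarith
    have h5 : Φ m * 1 ≤ Φ m * (E0 - E1
        + (claimCount T (node h (k + 1)) ω - claimCount T (node h k) ω)) :=
      mul_le_mul_of_nonneg_left (by linarith) (hΦ.nonneg m)
    linarith

theorem sum_stepGain_ge (hc : IsClaimProcess P ℱ lam α T Y) (hΦ : IsVerification g lam δ α b Φ)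
    (hlam : 0 < lam) (hδ : 0 < δ) (hα : 0 < α) {m : ℝ} (hm : 0 ≤ m) (ε : ℝ) (h : ℝ≥0) (n : ℕ)
    (ω : Ω) :
    -(Φ m * (1 + claimCount T (node h n) ω))
      ≤ ∑ k ∈ Finset.range n, stepGain lam δ α Φ T Y X m ε h k ω := by
  have h1 : -(Φ m * (1 - Real.exp (-δ * node h n) + claimCount T (node h n) ω))
      ≤ ∑ k ∈ Finset.range n, stepGain lam δ α Φ T Y X m ε h k ω := by
    induction n with
    | zero => simp [node_zero, claimCount_zero (hc.T_zero ω) (hc.T_strictMono ω)]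
    | succ n ih =>
      rw [Finset.sum_range_succ]
      have := stepGain_ge (X := X) hc hΦ hlam hδ hα hm ε h n ω
      linarith
  have h2 := mul_nonneg (hΦ.nonneg m) (Real.exp_pos (-δ * node h n)).le
  linarith

theorem measurable_stepGain (hc : IsClaimProcess P ℱ lam α T Y)
    (hA : IsAdmissible ℱ g T Y x D X) (hΦ : IsVerification g lam δ α b Φ)
    (m ε : ℝ) (h : ℝ≥0) (k : ℕ) : Measurable (stepGain lam δ α Φ T Y X m ε h k) := by
  have h1 : Measurable fun ω => aliveSurplus (X ω) (node h k) :=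
    (hA.measurable_aliveSurplus hc (node h k)).mono (ℱ.le _) le_rfl
  exact ((hc.measurable_stepValue hΦ m ε h1).const_mul _).sub
    (((hΦ.measurable_ruinValue m).comp h1).const_mul _)

variable [IsProbabilityMeasure P]

theorem integrable_stepValue (hc : IsClaimProcess P ℱ lam α T Y)
    (hΦ : IsVerification g lam δ α b Φ) (hlam : 0 < lam) (hδ : 0 < δ) (hα : 0 < α)
    {m : ℝ} (hm : 0 ≤ m) (ε : ℝ) {s t : ℝ≥0} (hst : s ≤ t) {ξ : Ω → ℝ} (hξ : Measurable ξ) :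
    Integrable (stepValue lam δ α Φ T Y m ε s t ξ) P := by
  refine Integrable.of_bound (hc.measurable_stepValue hΦ m ε hξ).aestronglyMeasurable
    (Φ m + (t - s) * ((lam + δ) * Φ m)) (ae_of_all _ fun ω => ?_)
  have := hΦ.stepValue_mem (T := T) (Y := Y) hlam hδ hα hm ε hst ξ ω
  rw [Real.norm_eq_abs, abs_of_nonneg this.1]
  exact this.2

theorem integrable_ruinValue (hΦ : IsVerification g lam δ α b Φ)
    {m : ℝ} (hm : 0 ≤ m) {ξ : Ω → ℝ} (hξ : Measurable ξ) :
    Integrable (fun ω => ruinValue Φ m (ξ ω)) P := by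
  refine Integrable.of_bound ((hΦ.measurable_ruinValue m).comp hξ).aestronglyMeasurable
    (Φ m) (ae_of_all _ fun ω => ?_)
  rw [Real.norm_eq_abs, abs_of_nonneg (hΦ.ruinValue_nonneg m _)]
  exact hΦ.ruinValue_le hm _

theorem integrable_stepGain (hc : IsClaimProcess P ℱ lam α T Y)
    (hA : IsAdmissible ℱ g T Y x D X) (hΦ : IsVerification g lam δ α b Φ)
    (hlam : 0 < lam) (hδ : 0 < δ) (hα : 0 < α)
    {m : ℝ} (hm : 0 ≤ m) (ε : ℝ) (h : ℝ≥0) (k : ℕ) :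
    Integrable (stepGain lam δ α Φ T Y X m ε h k) P := by
  have h1 : Measurable fun ω => aliveSurplus (X ω) (node h k) :=
    (hA.measurable_aliveSurplus hc (node h k)).mono (ℱ.le _) le_rfl
  exact ((integrable_stepValue hc hΦ hlam hδ hα hm ε (node_le_succ h k) h1).const_mul _).sub
    ((integrable_ruinValue hΦ hm h1).const_mul _)

theorem integral_stepGain (hc : IsClaimProcess P ℱ lam α T Y)
    (hA : IsAdmissible ℱ g T Y x D X) (hΦ : IsVerification g lam δ α b Φ)
    (hlam : 0 < lam) (hδ : 0 < δ) (hα : 0 < α)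
    {m : ℝ} (hm : 0 ≤ m) (ε : ℝ) (h : ℝ≥0) (k : ℕ) :
    ∫ ω, stepGain lam δ α Φ T Y X m ε h k ω ∂P
      = Real.exp (-δ * node h (k + 1)) * ((∫ ω, stepValue lam δ α Φ T Y m ε (node h k)
          (node h (k + 1)) (fun ω => aliveSurplus (X ω) (node h k)) ω ∂P)
        - Real.exp (δ * (node h (k + 1) - node h k))
          * ∫ ω, ruinValue Φ m (aliveSurplus (X ω) (node h k)) ∂P) := by
  have h1 : Measurable fun ω => aliveSurplus (X ω) (node h k) :=
    (hA.measurable_aliveSurplus hc (node h k)).mono (ℱ.le _) le_rfl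
  have h2 : Real.exp (-δ * node h k)
      = Real.exp (-δ * node h (k + 1)) * Real.exp (δ * (node h (k + 1) - node h k)) := by
    rw [← Real.exp_add]
    ring_nf
  unfold stepGain
  rw [integral_sub ((integrable_stepValue hc hΦ hlam hδ hα hm ε (node_le_succ h k) h1).const_mul _)
    ((integrable_ruinValue hΦ hm h1).const_mul _), integral_const_mul, integral_const_mul, h2]
  ring

/-- The mean of `stepValue` exceeds exp(δh) times the old value only by small terms, and the factor
exp(δh) is what discounting over one step removes. -/
theorem integral_stepGain_le (hc : IsClaimProcess P ℱ lam α T Y)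
    (hA : IsAdmissible ℱ g T Y x D X) (hΦ : IsVerification g lam δ α b Φ)
    (hg : LipschitzWith K g) (hgn : ∀ z, 0 ≤ z → 0 ≤ g z)
    (hlam : 0 < lam) (hδ : 0 < δ) (hα : 0 < α) (hx : 0 ≤ x)
    {t ε : ℝ} (hε : 0 ≤ ε) (hε1 : ε < 1) (ht : 0 ≤ t) {h : ℝ≥0} {k : ℕ} (hkt : node h (k + 1) ≤ t) :
    ∫ ω, stepGain lam δ α Φ T Y X (surplusBound g K x t + ε) ε h k ω ∂P
      ≤ lam * α * Φ (surplusBound g K x t + ε) * ε * h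
        + 2 * lam ^ 2 * Φ (surplusBound g K x t + ε) * h ^ 2 := by
  have hs : (node h k : ℝ) ≤ node h (k + 1) := node_le_succ h k
  have hs0 : (0 : ℝ) ≤ node h k := NNReal.coe_nonneg _
  set m := surplusBound g K x t + ε with hm
  have hM : 0 ≤ surplusBound g K x t := by
    have := hgn 0 le_rfl
    rw [surplusBound]
    positivity
  have hm0 : 0 ≤ m := by positivity
  rw [integral_stepGain hc hA hΦ hlam hδ hα hm0]
  have h1 := hc.integral_stepValue_le hΦ hlam hδ hα hε hε1 hm0 (node_le_succ h k)
    (hA.measurable_aliveSurplus hc (node h k)) (fun ω => by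
      rcases hA.aliveSurplus_mem hc hg hgn hx hs0 (hs.trans hkt) ω with h1 | h1
      · exact Or.inl h1
      · exact Or.inr ⟨h1.1, by linarith [h1.2]⟩)
  have h2 : (node h (k + 1) : ℝ) - node h k = h := by rw [coe_node_succ]; ring
  rw [h2] at h1 ⊢
  have hE : Real.exp (-δ * node h (k + 1)) ≤ 1 := Real.exp_le_one_iff.2 (by nlinarith)
  have hE0 := Real.exp_pos (-δ * node h (k + 1))
  have hΦm := hΦ.nonneg m
  have hQ : 0 ≤ lam * α * Φ m * ε * h + 2 * lam ^ 2 * Φ m * h ^ 2 := by positivity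
  refine le_trans ?_ (mul_le_of_le_one_left hQ hE)
  refine mul_le_mul_of_nonneg_left ?_ hE0.le
  linarith

end

/-! ### Limits in the mesh and the horizon for a general control -/

theorem tendsto_mesh (t : ℝ≥0) :
    Tendsto (fun n : ℕ => ((t / (n + 1 : ℕ) : ℝ≥0) : ℝ)) atTop (𝓝 0) := by
  have := (tendsto_one_div_add_atTop_nhds_zero_nat (𝕜 := ℝ)).const_mul (t : ℝ)
  rw [mul_zero] at this
  refine this.congr fun n => ?_
  push_cast
  ring

theorem node_mesh (t : ℝ≥0) (n : ℕ) : node (t / (n + 1 : ℕ)) (n + 1) = t := by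
  rw [node]
  field_simp

section

variable {Ω : Type*} [mΩ : MeasurableSpace Ω] {P : Measure Ω}
  {ℱ : Filtration ℝ≥0 mΩ}
  {lam δ α b : ℝ} {T Y : ℕ → Ω → ℝ} {g : ℝ → ℝ} {x : ℝ} {D : Ω → StieltjesFunction ℝ}
  {X : Ω → ℝ → ℝ} {Φ : ℝ → ℝ} {K : ℝ≥0}

/-- For a fixed path D(t) is a finite number, so the error h D(t) is eventually below the slack in
η; no integrability of D is needed. The case r = 0 is allowed without comparison with the ruin time,
because the lower bound in the Fatou argument must hold on every path. -/
theorem IsAdmissible.eventually_dividends_le (hc : IsClaimProcess P ℱ lam α T Y)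
    (hA : IsAdmissible ℱ g T Y x D X) (hΦ : IsVerification g lam δ α b Φ)
    (hg : LipschitzWith K g) (hgn : ∀ z, 0 ≤ z → 0 ≤ g z)
    (hlam : 0 < lam) (hδ : 0 < δ) (hα : 0 < α) (hx : 0 ≤ x)
    {t : ℝ≥0} {η ε ε' : ℝ} (hε : 0 < ε) (hε' : 0 < ε')
    (hη : t * ((lam + δ) * ε') < η) (ω : Ω) {r : ℝ} (hr0 : 0 ≤ r) (hrt : r ≤ t)
    (hr : r = 0 ∨ (r : EReal) < ruinTime (X ω)) :
    ∀ᶠ n : ℕ in atTop,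
      0 ≤ Φ x + ∑ k ∈ Finset.range (n + 1), stepGain lam δ α Φ T Y X (surplusBound g K x t + ε) ε
        (t / (n + 1 : ℕ)) k ω + η ∧
      ∫⁻ v in Icc 0 r, ENNReal.ofReal (Real.exp (-δ * v)) ∂(D ω).measure
        ≤ ENNReal.ofReal (Φ x + ∑ k ∈ Finset.range (n + 1),
          stepGain lam δ α Φ T Y X (surplusBound g K x t + ε) ε (t / (n + 1 : ℕ)) k ω + η) := by
  have hp := hA.isControlledPath hc ω
  obtain ⟨d, hd0, hd⟩ := hΦ.exists_modulus (surplusBound g K x t) hε'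
  have hlim := tendsto_mesh t
  have e1 : ∀ᶠ n : ℕ in atTop, (g 0 + K * surplusBound g K x t) * ((t / (n + 1 : ℕ) : ℝ≥0) : ℝ)
      < min d ε := by
    have h1 := hlim.const_mul (g 0 + K * surplusBound g K x t)
    rw [mul_zero] at h1
    exact h1.eventually (Iio_mem_nhds (lt_min hd0 hε))
  have e2 : ∀ᶠ n : ℕ in atTop, ((t / (n + 1 : ℕ) : ℝ≥0) : ℝ)
      * ((lam * α * Φ (surplusBound g K x t) + δ) * D ω t) < η - t * ((lam + δ) * ε') := by
    have h1 := hlim.mul_const ((lam * α * Φ (surplusBound g K x t) + δ) * D ω t)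
    rw [zero_mul] at h1
    exact h1.eventually (Iio_mem_nhds (by linarith))
  have e3 : ∀ᶠ n : ℕ in atTop, ∀ k, (¬ ∀ v ∈ Icc 0 (node (t / (n + 1 : ℕ)) (k + 1) : ℝ),
      0 ≤ X ω v) → r ≤ node (t / (n + 1 : ℕ)) k := by
    rcases hr with hr | hr
    · exact Eventually.of_forall fun n k _ => by rw [hr]; exact NNReal.coe_nonneg _
    -- Once the mesh is below ρ - r, with ρ still before ruin, a grid interval by whose end ruin has
    -- occurred must start after r.
    · obtain ⟨ρ, h1, h2⟩ := EReal.lt_iff_exists_real_btwn.1 hr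
      have h1' : r < ρ := by exact_mod_cast h1
      filter_upwards [hlim.eventually (Iio_mem_nhds (sub_pos.2 h1'))] with n hn k hk
      by_contra hcon
      refine hk fun v hv => ?_
      refine nonneg_of_lt_ruinTime hv.1 (lt_of_le_of_lt ?_ h2)
      have h3 := hv.2
      rw [coe_node_succ] at h3
      have h4 : v ≤ ρ := by linarith [not_le.1 hcon, show ((t / (n + 1 : ℕ) : ℝ≥0) : ℝ) < ρ - r from hn]
      exact_mod_cast h4
  filter_upwards [e1, e2, e3] with n h1 h2 h3
  have hnode : (node (t / (n + 1 : ℕ)) (n + 1) : ℝ) = t := by rw [node_mesh]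
  have h4 := path_upper (K := K) (T := T) (Y := Y) (ω := ω) hp hg hgn hΦ hlam hδ hα hx
    (hA.surplus_zero_nonneg hc ω) hε hε'.le hd hnode h1.le (r := r) fun k _ => h3 k
  have h5 := hp.setLIntegral_exp_Icc_le hδ.le hr0 (t / (n + 1 : ℕ)) (n + 1) (by rw [hnode]; exact hrt)
  have h6 : 0 ≤ D ω 0 + ∑ k ∈ Finset.range (n + 1), Real.exp (-δ * node (t / (n + 1 : ℕ)) k)
      * (D ω (min (node (t / (n + 1 : ℕ)) (k + 1) : ℝ) r)
        - D ω (min (node (t / (n + 1 : ℕ)) k : ℝ) r)) :=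
    add_nonneg (hp.D_nonneg 0) (Finset.sum_nonneg fun k _ => mul_nonneg (Real.exp_pos _).le
      (sub_nonneg.2 ((D ω).mono (min_le_min_right _ (node_le_succ _ k)))))
  exact ⟨by linarith, h5.trans (ENNReal.ofReal_le_ofReal (by linarith))⟩

variable [IsProbabilityMeasure P]

theorem integral_const_add_sum_add_const {f : ℕ → Ω → ℝ} (hf : ∀ k, Integrable (f k) P) (a c : ℝ)
    (n : ℕ) : Integrable (fun ω => a + ∑ k ∈ Finset.range n, f k ω + c) P ∧
      ∫ ω, (a + ∑ k ∈ Finset.range n, f k ω + c) ∂P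
        = a + ∑ k ∈ Finset.range n, (∫ ω, f k ω ∂P) + c := by
  have h1 : Integrable (fun ω => ∑ k ∈ Finset.range n, f k ω) P :=
    integrable_finsetSum _ fun k _ => hf k
  have h2 : Integrable (fun ω => a + ∑ k ∈ Finset.range n, f k ω) P := (integrable_const a).add h1
  refine ⟨h2.add (integrable_const c), ?_⟩
  rw [integral_add h2 (integrable_const c), integral_add (integrable_const a) h1,
    integral_finsetSum _ fun k _ => hf k]
  simp

/-- Fatou's lemma applied to the nonnegative variables A_n + C, where C is the integrable
claim-count bound, followed by subtraction of C. A measurable majorant is produced so that the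
discounted dividends themselves need not be shown measurable in ω. -/
theorem IsAdmissible.exists_majorant (hc : IsClaimProcess P ℱ lam α T Y)
    (hA : IsAdmissible ℱ g T Y x D X) (hΦ : IsVerification g lam δ α b Φ)
    (hg : LipschitzWith K g) (hgn : ∀ z, 0 ≤ z → 0 ≤ g z)
    (hlam : 0 < lam) (hδ : 0 < δ) (hα : 0 < α) (hx : 0 ≤ x) (t : ℝ≥0) {η : ℝ} (hη : 0 < η) :
    ∃ W : Ω → ℝ≥0∞, Measurable W ∧ ∫⁻ ω, W ω ∂P ≤ ENNReal.ofReal (Φ x + η) ∧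
      ∀ ω (r : ℝ), 0 ≤ r → r ≤ t → (r : EReal) < ruinTime (X ω) →
        ∫⁻ v in Icc 0 r, ENNReal.ofReal (Real.exp (-δ * v)) ∂(D ω).measure ≤ W ω := by
  set M := surplusBound g K x t with hM
  have hM0 : 0 ≤ M := by
    have := hgn 0 le_rfl
    rw [hM, surplusBound]
    positivity
  set B := lam * α * Φ (M + 1) * t with hB
  have hB0 : 0 ≤ B := by
    have := hΦ.nonneg (M + 1)
    positivity
  -- The budget η is split as η/2 for the pathwise errors, η/4 for the upward shift ε and η/4 for
  -- the mesh. `B` uses Φ(M+1), which bounds Φ(M+ε) before ε is chosen.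
  obtain ⟨ε, hε, hε1, hεB⟩ : ∃ ε > 0, ε < 1 ∧ B * ε < η / 4 := by
    refine ⟨min (1 / 2) (η / 4 / (B + 1)), by positivity, by
      linarith [min_le_left (1 / 2) (η / 4 / (B + 1))], ?_⟩
    calc B * min (1 / 2) (η / 4 / (B + 1)) ≤ B * (η / 4 / (B + 1)) :=
          mul_le_mul_of_nonneg_left (min_le_right _ _) hB0
      _ = (η / 4) * (B / (B + 1)) := by ring
      _ < (η / 4) * 1 := by
          gcongr
          rw [div_lt_one (by positivity)]
          linarith
      _ = _ := mul_one _
  obtain ⟨ε', hε', hεt⟩ : ∃ ε' > 0, t * ((lam + δ) * ε') < η / 2 := by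
    refine ⟨η / 4 / (t * (lam + δ) + 1), by positivity, ?_⟩
    have h1 : (t : ℝ) * (lam + δ) / (t * (lam + δ) + 1) ≤ 1 := by
      rw [div_le_one (by positivity)]
      linarith
    calc (t : ℝ) * ((lam + δ) * (η / 4 / (t * (lam + δ) + 1)))
        = η / 4 * (t * (lam + δ) / (t * (lam + δ) + 1)) := by ring
      _ ≤ η / 4 * 1 := by gcongr
      _ < _ := by linarith
  set m := M + ε with hm
  have hm0 : 0 ≤ m := by positivity
  have hΦm := hΦ.nonneg m
  set H : ℕ → ℝ≥0 := fun n => t / (n + 1 : ℕ) with hH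
  set A : ℕ → Ω → ℝ := fun n ω =>
    Φ x + ∑ k ∈ Finset.range (n + 1), stepGain lam δ α Φ T Y X m ε (H n) k ω + η / 2 with hAdef
  set C : Ω → ℝ := fun ω => Φ m * (1 + claimCount T t ω) with hC
  have hC0 : ∀ ω, 0 ≤ C ω := fun ω => by positivity
  have hNm : Measurable fun ω => (claimCount T t ω : ℝ) :=
    measurable_from_nat.comp (hc.measurable_count t)
  have hCm : Measurable C := (hNm.const_add 1).const_mul _
  have hAm : ∀ n, Measurable (A n) := fun n =>
    ((Finset.measurable_fun_sum _ fun k _ =>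
      measurable_stepGain hc hA hΦ m ε (H n) k).const_add _).add_const _
  have hAC : ∀ n ω, 0 ≤ A n ω + C ω := fun n ω => by
    have h1 := sum_stepGain_ge (X := X) hc hΦ hlam hδ hα hm0 ε (H n) (n + 1) ω
    have h2 : node (H n) (n + 1) = t := node_mesh t n
    rw [h2] at h1
    have := hΦ.nonneg x
    simp only [hAdef, hC]
    linarith
  have hNi : Integrable (fun ω => (claimCount T t ω : ℝ)) P := by
    refine ⟨hNm.aestronglyMeasurable, ?_⟩
    rw [HasFiniteIntegral]
    have h1 := hc.lintegral_claimCount_ne_top hlam t.coe_nonneg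
    refine lt_of_le_of_lt (lintegral_mono fun ω => ?_) (lt_top_iff_ne_top.2 h1)
    rw [Real.enorm_eq_ofReal (Nat.cast_nonneg _), ENNReal.ofReal_natCast]
  have hCi : Integrable C P := ((integrable_const _).add hNi).const_mul _
  have hAi : ∀ n, Integrable (A n) P := fun n =>
    (integral_const_add_sum_add_const (fun k =>
      integrable_stepGain hc hA hΦ hlam hδ hα hm0 ε (H n) k) _ _ _).1
  have hAint : ∀ᶠ n in atTop, ∫ ω, A n ω ∂P ≤ Φ x + η := by
    have hlim := (tendsto_mesh t).const_mul (2 * lam ^ 2 * Φ m * t)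
    rw [mul_zero] at hlim
    filter_upwards [hlim.eventually (Iio_mem_nhds (show 0 < η / 4 by positivity))] with n hn
    have h1 : ∫ ω, A n ω ∂P = Φ x + ∑ k ∈ Finset.range (n + 1),
        (∫ ω, stepGain lam δ α Φ T Y X m ε (H n) k ω ∂P) + η / 2 :=
      (integral_const_add_sum_add_const (fun k =>
        integrable_stepGain hc hA hΦ hlam hδ hα hm0 ε (H n) k) _ _ _).2
    have h2 : ∑ k ∈ Finset.range (n + 1), (∫ ω, stepGain lam δ α Φ T Y X m ε (H n) k ω ∂P)
        ≤ ∑ k ∈ Finset.range (n + 1), (lam * α * Φ m * ε * H n + 2 * lam ^ 2 * Φ m * H n ^ 2) := by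
      refine Finset.sum_le_sum fun k hk => ?_
      refine integral_stepGain_le hc hA hΦ hg hgn hlam hδ hα hx hε.le hε1 t.coe_nonneg ?_
      have h3 : node (H n) (k + 1) ≤ node (H n) (n + 1) := node_mono _ (by
        have := Finset.mem_range.1 hk
        omega)
      rw [show node (H n) (n + 1) = t from node_mesh t n] at h3
      exact h3
    have h3 : ((n + 1 : ℕ) : ℝ) * H n = t := by
      have := congrArg NNReal.toReal (node_mesh t n)
      rw [node] at this
      exact_mod_cast this
    have h4 : Φ m ≤ Φ (M + 1) := hΦ.mono hm0 (show 0 ≤ M + 1 by linarith) (by linarith)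
    have h5 : lam * α * Φ m * ε * t ≤ B * ε := by
      rw [hB]
      have : lam * α * Φ m * ε * t = (lam * α * ε * t) * Φ m := by ring
      rw [this]
      calc (lam * α * ε * t) * Φ m ≤ (lam * α * ε * t) * Φ (M + 1) := by gcongr
        _ = _ := by ring
    rw [Finset.sum_const, Finset.card_range, nsmul_eq_mul] at h2
    have h6 : ((n + 1 : ℕ) : ℝ) * (lam * α * Φ m * ε * H n + 2 * lam ^ 2 * Φ m * H n ^ 2)
        = lam * α * Φ m * ε * t + 2 * lam ^ 2 * Φ m * t * H n := by
      rw [← h3]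
      ring
    rw [h6] at h2
    have hn' : 2 * lam ^ 2 * Φ m * t * (H n : ℝ) < η / 4 := hn
    rw [h1]
    linarith
  have hev : ∀ ω (r : ℝ), 0 ≤ r → r ≤ t → (r = 0 ∨ (r : EReal) < ruinTime (X ω)) →
      ∀ᶠ n in atTop, 0 ≤ A n ω ∧
        ∫⁻ v in Icc 0 r, ENNReal.ofReal (Real.exp (-δ * v)) ∂(D ω).measure
          ≤ ENNReal.ofReal (A n ω) := fun ω r h0 h1 h2 =>
    hA.eventually_dividends_le hc hΦ hg hgn hlam hδ hα hx hε hε' hεt ω h0 h1 h2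
  have hle : ∀ ω (r : ℝ), 0 ≤ r → r ≤ t → (r = 0 ∨ (r : EReal) < ruinTime (X ω)) →
      (∫⁻ v in Icc 0 r, ENNReal.ofReal (Real.exp (-δ * v)) ∂(D ω).measure) + ENNReal.ofReal (C ω)
        ≤ liminf (fun n => ENNReal.ofReal (A n ω + C ω)) atTop := fun ω r h0 h1 h2 => by
    refine le_liminf_of_le (by isBoundedDefault) ?_
    filter_upwards [hev ω r h0 h1 h2] with n hn
    rw [ENNReal.ofReal_add hn.1 (hC0 ω)]
    gcongr
    exact hn.2
  have hmeas : ∀ n, Measurable fun ω => ENNReal.ofReal (A n ω + C ω) := fun n =>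
    ((hAm n).add hCm).ennreal_ofReal
  refine ⟨fun ω => liminf (fun n => ENNReal.ofReal (A n ω + C ω)) atTop - ENNReal.ofReal (C ω),
    (Measurable.liminf hmeas).sub hCm.ennreal_ofReal, ?_, fun ω r h0 h1 h2 =>
      ENNReal.le_sub_of_add_le_right ENNReal.ofReal_ne_top (hle ω r h0 h1 (Or.inr h2))⟩
  have hCl : ∫⁻ ω, ENNReal.ofReal (C ω) ∂P = ENNReal.ofReal (∫ ω, C ω ∂P) :=
    (ofReal_integral_eq_lintegral_ofReal hCi (ae_of_all _ hC0)).symm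
  rw [lintegral_sub hCm.ennreal_ofReal (by rw [hCl]; exact ENNReal.ofReal_ne_top)
    -- Taking r = 0 shows that C lies below the liminf on every path, so the truncated subtraction
    -- loses nothing.
    (ae_of_all _ fun ω => le_trans (by simp) (hle ω 0 le_rfl t.coe_nonneg (Or.inl rfl))), hCl,
    tsub_le_iff_right, ← ENNReal.ofReal_add (by linarith [hΦ.nonneg x])
      (integral_nonneg hC0)]
  refine (lintegral_liminf_le hmeas).trans ?_
  refine liminf_le_of_frequently_le' (Eventually.frequently ?_)
  filter_upwards [hAint] with n hn
  have hACi : Integrable (fun ω => A n ω + C ω) P := (hAi n).add hCi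
  rw [← ofReal_integral_eq_lintegral_ofReal hACi (ae_of_all _ (hAC n)),
    integral_add (hAi n) hCi]
  exact ENNReal.ofReal_le_ofReal (by linarith)

/-- The payment period before ruin is covered by the directed intervals [0,q] with q rational and
before ruin. Each is dominated by all majorants with a large enough horizon, and a second use of
Fatou sends the horizon to infinity and η to 0. -/
theorem IsAdmissible.epv_le (hc : IsClaimProcess P ℱ lam α T Y)
    (hA : IsAdmissible ℱ g T Y x D X) (hΦ : IsVerification g lam δ α b Φ)
    (hg : LipschitzWith K g) (hgn : ∀ z, 0 ≤ z → 0 ≤ g z)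
    (hlam : 0 < lam) (hδ : 0 < δ) (hα : 0 < α) (hx : 0 ≤ x) :
    epv P δ D X ≤ ENNReal.ofReal (Φ x) := by
  choose W hWm hWi hW using fun j : ℕ => hA.exists_majorant hc hΦ hg hgn hlam hδ hα hx
    ((j : ℝ≥0)) (η := 1 / ((j : ℝ) + 1)) (by positivity)
  have h1 : ∀ ω, ∫⁻ t in {t : ℝ | 0 ≤ t ∧ (t : EReal) < ruinTime (X ω)},
      ENNReal.ofReal (Real.exp (-δ * t)) ∂(D ω).measure ≤ liminf (fun j => W j ω) atTop := by
    intro ω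
    have hsub : {t : ℝ | 0 ≤ t ∧ (t : EReal) < ruinTime (X ω)}
        ⊆ ⋃ q : {q : ℚ // 0 ≤ (q : ℝ) ∧ ((q : ℝ) : EReal) < ruinTime (X ω)},
          Icc (0 : ℝ) (q : ℚ) := by
      rintro r ⟨hr0, hr⟩
      obtain ⟨q, hq1, hq2⟩ := EReal.lt_iff_exists_rat_btwn.1 hr
      have hq1' : r < q := by exact_mod_cast hq1
      exact mem_iUnion.2 ⟨⟨q, hr0.trans hq1'.le, hq2⟩, hr0, hq1'.le⟩
    refine (lintegral_mono_set hsub).trans ?_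
    rw [setLIntegral_iUnion_of_directed]
    · refine iSup_le fun q => le_liminf_of_le (by isBoundedDefault) ?_
      filter_upwards [eventually_ge_atTop ⌈((q : ℚ) : ℝ)⌉₊] with j hj
      refine hW j ω _ q.2.1 ?_ q.2.2
      exact (Nat.le_ceil ((q : ℚ) : ℝ)).trans (by exact_mod_cast hj)
    · refine Monotone.directed_le fun p q hpq => Icc_subset_Icc le_rfl ?_
      exact_mod_cast hpq
  refine (lintegral_mono h1).trans ((lintegral_liminf_le hWm).trans ?_)
  have hlim : Tendsto (fun j : ℕ => ENNReal.ofReal (Φ x + 1 / ((j : ℝ) + 1))) atTop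
      (𝓝 (ENNReal.ofReal (Φ x))) := by
    refine ENNReal.tendsto_ofReal ?_
    simpa using (tendsto_one_div_add_atTop_nhds_zero_nat (𝕜 := ℝ)).const_add (Φ x)
  rw [← hlim.liminf_eq]
  exact liminf_le_liminf (Eventually.of_forall hWi)

end

/-! ### Lower bound for barrier strategies -/

section Path

variable {Ω : Type*} {T Y : ℕ → Ω → ℝ} {ω : Ω} {g : ℝ → ℝ} {x : ℝ} {D : StieltjesFunction ℝ}
    {X : Ω → ℝ → ℝ} {lam δ α b : ℝ} {Φ : ℝ → ℝ} {K : ℝ≥0}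

theorem IsBarrierPath.alive_of_alive {S X : ℝ → ℝ} (hp : IsBarrierPath g b x S D X)
    (hg : LipschitzWith K g) (hgn : ∀ z, 0 ≤ z → 0 ≤ g z) {s u : ℝ} (hs : 0 ≤ s)
    (hal : ∀ v ∈ Icc 0 s, 0 ≤ X v) (hS : 0 ≤ X s - (S u - S s)) : ∀ v ∈ Icc 0 u, 0 ≤ X v := by
  intro v hv
  rcases le_total v s with h | h
  · exact hal v ⟨hv.1, h⟩
  · exact hp.nonneg_of_claims_le hg hgn hs hS v ⟨h, hv.2⟩

/-- There is no claim just after s, and a barrier path is ruined only through a claim. The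
inequality is strict, so a payment at s itself counts in the half-open interval [0,τ). -/
theorem IsBarrierPath.lt_ruinTime {S X : ℝ → ℝ} (hp : IsBarrierPath g b x S D X)
    (hg : LipschitzWith K g) (hgn : ∀ z, 0 ≤ z → 0 ≤ g z) {s : ℝ} (hs : 0 ≤ s)
    (hal : ∀ v ∈ Icc 0 s, 0 ≤ X v) : (s : EReal) < ruinTime X := by
  obtain ⟨u, hu, hSu⟩ := hp.claims.right_const s hs
  have h1 : ∀ r ∈ Ico s u, ∀ v ∈ Icc 0 r, 0 ≤ X v := fun r hr =>
    hp.alive_of_alive hg hgn hs hal (by rw [hSu r hr]; simpa using hal s ⟨hs, le_rfl⟩)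
  have h2 : (u : EReal) ≤ ruinTime X := le_ruinTime_iff.2 fun t ht hX => by
    by_contra hcon
    have hcon' : t < u := by exact_mod_cast not_le.1 hcon
    rcases le_total t s with h | h
    · exact absurd (hal t ⟨ht, h⟩) (not_le.2 hX)
    · exact absurd (h1 t ⟨h, hcon'⟩ t ⟨ht, le_rfl⟩) (not_le.2 hX)
  exact lt_of_lt_of_le (by exact_mod_cast hu) h2

open Classical in
/-- The dividends paid in `(s, u]`, provided there is no ruin up to `u`. -/
noncomputable def aliveDividends (D : StieltjesFunction ℝ) (X : ℝ → ℝ) (s u : ℝ) : ℝ :=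
  if ∀ v ∈ Icc 0 u, 0 ≤ X v then D u - D s else 0

theorem aliveDividends_nonneg {X : ℝ → ℝ} {s u : ℝ} (hsu : s ≤ u) :
    0 ≤ aliveDividends D X s u := by
  unfold aliveDividends
  split_ifs
  · exact sub_nonneg.2 (D.mono hsu)
  · exact le_rfl

/-- Without a claim this is the reverse pathwise inequality. With claims that the surplus at s
covers, the path survives and ends no lower than X(s) minus the claims, so monotonicity of Φ is
enough and the dividends are dropped. With larger claims, or earlier ruin, `stepValue` is 0. The cap
b is inert since X ≤ b, and no shift is needed. -/
theorem step_lower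
    (hp : IsBarrierPath g b x (fun t => aggregateClaims T Y t ω) D (X ω))
    (hg : LipschitzWith K g) (hgn : ∀ z, 0 ≤ z → 0 ≤ g z)
    (hΦ : IsVerification g lam δ α b Φ) (hlam : 0 < lam) (hδ : 0 < δ) (hα : 0 < α)
    (h : ℝ≥0) (k : ℕ) :
    stepValue lam δ α Φ T Y b 0 (node h k) (node h (k + 1))
          (fun ω => aliveSurplus (X ω) (node h k)) ω
      ≤ ruinValue Φ b (aliveSurplus (X ω) (node h (k + 1)))
        + aliveDividends D (X ω) (node h k) (node h (k + 1))
        + lam * α * Φ b * (g 0 + K * b) * h ^ 2 := by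
  have hs : (0 : ℝ) ≤ node h k := NNReal.coe_nonneg _
  have hsu : (node h k : ℝ) ≤ node h (k + 1) := node_le_succ h k
  have hmesh : (node h (k + 1) : ℝ) - node h k = h := by rw [coe_node_succ]; ring
  have hb := hΦ.b_pos
  have hΦb := hΦ.nonneg b
  have hC : 0 ≤ lam * α * Φ b * (g 0 + K * b) * h ^ 2 := by
    have := hgn 0 le_rfl
    positivity
  have hR := hΦ.ruinValue_nonneg b (aliveSurplus (X ω) (node h (k + 1)))
  have hA := aliveDividends_nonneg (D := D) (X := X ω) hsu
  by_cases hal : ∀ v ∈ Icc 0 (node h k : ℝ), 0 ≤ X ω v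
  · have hXs : X ω (node h k) ∈ Icc 0 b := ⟨hal _ ⟨hs, le_rfl⟩, hp.le_barrier _ hs⟩
    have hal' : 0 ≤ X ω (node h k) - (aggregateClaims T Y (node h (k + 1)) ω
        - aggregateClaims T Y (node h k) ω) → ∀ v ∈ Icc 0 (node h (k + 1) : ℝ), 0 ≤ X ω v :=
      fun hS => hp.alive_of_alive hg hgn hs hal hS
    by_cases hN : claimCount T (node h (k + 1)) ω = claimCount T (node h k) ω
    · have hS : aggregateClaims T Y (node h (k + 1)) ω = aggregateClaims T Y (node h k) ω := by
        simp only [aggregateClaims, hN]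
      have halu := hal' (by rw [hS]; simpa using hXs.1)
      have h1 := hp.le_value_add_dividends_of_noClaim hg hgn hΦ hlam hδ hα hs hsu hS
        fun v hv => halu v ⟨hs.trans hv.1, hv.2⟩
      rw [hmesh] at h1
      simp only [stepValue, indicator, mem_ofPred_eq, hN, ne_eq, not_true_eq_false, if_true,
        if_false, add_zero, aliveSurplus_of_alive hal]
      rw [ruinValue_of_mem hXs.1 hXs.2, ruinValue_of_mem hXs.1 hXs.2, hmesh,
        aliveSurplus_of_alive halu, aliveDividends, if_pos halu,
        ruinValue_of_mem (halu _ ⟨hs.trans hsu, le_rfl⟩) (hp.le_barrier _ (hs.trans hsu))]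
      linarith
    · simp only [stepValue, indicator, mem_ofPred_eq, hN, ne_eq, not_false_eq_true, if_true,
        if_false, zero_add, add_zero, aliveSurplus_of_alive hal]
      by_cases hS : 0 ≤ X ω (node h k) - (aggregateClaims T Y (node h (k + 1)) ω
        - aggregateClaims T Y (node h k) ω)
      · have halu := hal' hS
        have h1 := hp.sub_claims_le hgn hs hsu fun v hv => halu v ⟨hs.trans hv.1, hv.2⟩
        beta_reduce at h1
        have hXu := hp.le_barrier _ (hs.trans hsu)
        have h2 := hΦ.mono hS (halu _ ⟨hs.trans hsu, le_rfl⟩) h1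
        rw [aliveSurplus_of_alive halu] at hR ⊢
        rw [ruinValue_of_mem hS (h1.trans hXu),
          ruinValue_of_mem (halu _ ⟨hs.trans hsu, le_rfl⟩) hXu]
        linarith
      · rw [ruinValue_of_neg (not_le.1 hS)]
        positivity
  · have hSm : aggregateClaims T Y (node h k) ω ≤ aggregateClaims T Y (node h (k + 1)) ω :=
      hp.claims.mono hsu
    have h0 : stepValue lam δ α Φ T Y b 0 (node h k) (node h (k + 1))
        (fun ω => aliveSurplus (X ω) (node h k)) ω = 0 := by
      simp only [stepValue, indicator, mem_ofPred_eq, aliveSurplus_of_not_alive hal]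
      rw [ruinValue_of_neg (by norm_num), ruinValue_of_neg (by norm_num),
        ruinValue_of_neg (by linarith)]
      simp
    rw [h0]
    positivity

theorem path_lower
    (hp : IsBarrierPath g b x (fun t => aggregateClaims T Y t ω) D (X ω))
    (hg : LipschitzWith K g) (hgn : ∀ z, 0 ≤ z → 0 ≤ g z)
    (hΦ : IsVerification g lam δ α b Φ) (hlam : 0 < lam) (hδ : 0 < δ) (hα : 0 < α) (hx : 0 ≤ x)
    (hlin : Φ x ≤ Φ (min x b) + max (x - b) 0) (h : ℝ≥0) (n : ℕ) :
    Φ x + ∑ k ∈ Finset.range n, stepGain lam δ α Φ T Y X b 0 h k ω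
        - n * (lam * α * Φ b * (g 0 + K * b) * h ^ 2)
      ≤ Real.exp (-δ * node h n) * ruinValue Φ b (aliveSurplus (X ω) (node h n))
        + (D 0 + ∑ k ∈ Finset.range n, Real.exp (-δ * node h (k + 1))
          * aliveDividends D (X ω) (node h k) (node h (k + 1))) := by
  induction n with
  | zero =>
    have hb := hΦ.b_pos
    have h1 := hp.surplus 0 le_rfl
    rw [hp.claims.zero, intervalIntegral.integral_same, hp.D_zero] at h1
    have h2 : X ω 0 = min x b := by
      rw [h1]
      rcases le_total x b with h | h
      · rw [max_eq_right (by linarith), min_eq_left h]; ring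
      · rw [max_eq_left (by linarith), min_eq_right h]; ring
    have h0 : 0 ≤ min x b := le_min hx hb.le
    have hal : ∀ v ∈ Icc (0 : ℝ) 0, 0 ≤ X ω v := fun v hv => by
      rw [le_antisymm hv.2 hv.1, h2]; exact h0
    simp only [node_zero, NNReal.coe_zero, mul_zero, Real.exp_zero, one_mul, Finset.range_zero,
      Finset.sum_empty, add_zero, Nat.cast_zero, zero_mul, sub_zero]
    rw [aliveSurplus_of_alive hal, h2, ruinValue_of_mem h0 (min_le_right _ _), hp.D_zero]
    exact hlin
  | succ n ih =>
    have h1 := step_lower hp hg hgn hΦ hlam hδ hα h n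
    rw [Finset.sum_range_succ, Finset.sum_range_succ]
    have hs : (0 : ℝ) ≤ node h (n + 1) := NNReal.coe_nonneg _
    have hE : Real.exp (-δ * node h (n + 1)) ≤ 1 := Real.exp_le_one_iff.2 (by nlinarith)
    have hb := hΦ.b_pos
    have hΦb := hΦ.nonneg b
    have hC : 0 ≤ lam * α * Φ b * (g 0 + K * b) * h ^ 2 := by
      have := hgn 0 le_rfl
      positivity
    have h2 := mul_le_mul_of_nonneg_left h1 (Real.exp_pos (-δ * node h (n + 1))).le
    have h3 := mul_le_of_le_one_left hC hE
    have hSG : stepGain lam δ α Φ T Y X b 0 h n ω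
        = Real.exp (-δ * node h (n + 1)) * stepValue lam δ α Φ T Y b 0 (node h n)
          (node h (n + 1)) (fun ω => aliveSurplus (X ω) (node h n)) ω
        - Real.exp (-δ * node h n) * ruinValue Φ b (aliveSurplus (X ω) (node h n)) := rfl
    rw [hSG]
    push_cast
    linarith

/-- A lower Riemann-Stieltjes sum: payments are discounted at right nodes, and the interval in which
ruin happens is left out. -/
theorem IsBarrierPath.ofReal_dividends_le {S X : ℝ → ℝ} (hp : IsBarrierPath g b x S D X)
    (hg : LipschitzWith K g) (hgn : ∀ z, 0 ≤ z → 0 ≤ g z) (hδ : 0 < δ) (hX0 : 0 ≤ X 0)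
    (h : ℝ≥0) (n : ℕ) :
    ENNReal.ofReal (D 0 + ∑ k ∈ Finset.range n, Real.exp (-δ * node h (k + 1))
          * aliveDividends D X (node h k) (node h (k + 1)))
      ≤ ∫⁻ t in {t : ℝ | 0 ≤ t ∧ (t : EReal) < ruinTime X} ∩ Iic (node h n : ℝ),
        ENNReal.ofReal (Real.exp (-δ * t)) ∂D.measure := by
  have hnn : ∀ k, 0 ≤ Real.exp (-δ * node h (k + 1))
      * aliveDividends D X (node h k) (node h (k + 1)) := fun k =>
    mul_nonneg (Real.exp_pos _).le (aliveDividends_nonneg (node_le_succ h k))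
  induction n with
  | zero =>
    have h1 : ({0} : Set ℝ) ⊆ {t : ℝ | 0 ≤ t ∧ (t : EReal) < ruinTime X}
        ∩ Iic (node h 0 : ℝ) := by
      rintro t rfl
      refine ⟨⟨le_rfl, hp.lt_ruinTime hg hgn le_rfl fun v hv => ?_⟩, NNReal.coe_nonneg _⟩
      rw [le_antisymm hv.2 hv.1]
      exact hX0
    refine le_trans ?_ (lintegral_mono_set h1)
    simp [D.measure_singleton, hp.leftLim_D_zero]
  | succ n ih =>
    have hsu : (node h n : ℝ) ≤ node h (n + 1) := node_le_succ h n
    rw [Finset.sum_range_succ, ← add_assoc, ENNReal.ofReal_add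
      (add_nonneg (hp.D_nonneg 0) (Finset.sum_nonneg fun k _ => hnn k)) (hnn n)]
    by_cases hal : ∀ v ∈ Icc 0 (node h (n + 1) : ℝ), 0 ≤ X v
    · have hτ := hp.lt_ruinTime hg hgn (NNReal.coe_nonneg _) hal
      have hsub : ({t : ℝ | 0 ≤ t ∧ (t : EReal) < ruinTime X} ∩ Iic (node h n : ℝ))
          ∪ Ioc (node h n : ℝ) (node h (n + 1))
          ⊆ {t : ℝ | 0 ≤ t ∧ (t : EReal) < ruinTime X} ∩ Iic (node h (n + 1) : ℝ) := by
        rintro t (ht | ht)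
        · exact ⟨ht.1, le_trans ht.2 hsu⟩
        · exact ⟨⟨(NNReal.coe_nonneg _).trans ht.1.le,
            lt_of_le_of_lt (by exact_mod_cast ht.2) hτ⟩, ht.2⟩
      refine le_trans ?_ (lintegral_mono_set hsub)
      rw [lintegral_union measurableSet_Ioc (Set.disjoint_left.2 fun t ht ht' =>
        absurd ht.2 (not_le.2 ht'.1))]
      refine add_le_add ih ?_
      rw [aliveDividends, if_pos hal, ENNReal.ofReal_mul (Real.exp_pos _).le, ← D.measure_Ioc,
        ← setLIntegral_const]
      refine setLIntegral_mono' measurableSet_Ioc fun t ht => ?_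
      refine ENNReal.ofReal_le_ofReal (Real.exp_le_exp.2 ?_)
      nlinarith [ht.2]
    · rw [aliveDividends, if_neg hal]
      simp only [mul_zero, ENNReal.ofReal_zero, add_zero]
      exact ih.trans (lintegral_mono_set (inter_subset_inter_right _ (Iic_subset_Iic.2 hsu)))

end Path

section

variable {Ω : Type*} [mΩ : MeasurableSpace Ω] {P : Measure Ω}
  {ℱ : Filtration ℝ≥0 mΩ}
  {lam δ α b : ℝ} {T Y : ℕ → Ω → ℝ} {g : ℝ → ℝ} {x : ℝ} {D : Ω → StieltjesFunction ℝ}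
  {X : Ω → ℝ → ℝ} {Φ : ℝ → ℝ} {K : ℝ≥0}

theorem ofReal_integral_le {f : Ω → ℝ} (hf : Integrable f P) :
    ENNReal.ofReal (∫ ω, f ω ∂P) ≤ ∫⁻ ω, ENNReal.ofReal (f ω) ∂P := by
  have h1 : Integrable (fun ω => max (f ω) 0) P := hf.pos_part
  have h2 : ∀ ω, ENNReal.ofReal (f ω) = ENNReal.ofReal (max (f ω) 0) := fun ω => by
    rcases le_total (f ω) 0 with h | h
    · rw [max_eq_right h, ENNReal.ofReal_of_nonpos h, ENNReal.ofReal_zero]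
    · rw [max_eq_left h]
  simp only [h2]
  rw [← ofReal_integral_eq_lintegral_ofReal h1 (ae_of_all _ fun ω => le_max_right _ _)]
  exact ENNReal.ofReal_le_ofReal (integral_mono hf h1 fun ω => le_max_left _ _)

variable [IsProbabilityMeasure P]

/-- With n steps of size h and nh = t, the quadratic errors add up to (C + C')th. The value left at
the horizon is at most exp(-δt)Φ(b) because the surplus never exceeds b. First h tends to 0, then t
to infinity. -/
theorem IsAdmissible.barrier_le_epv (hc : IsClaimProcess P ℱ lam α T Y)
    (hA : IsAdmissible ℱ g T Y x D X) (hB : IsBarrier g b D X) (hΦ : IsVerification g lam δ α b Φ)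
    (hg : LipschitzWith K g) (hgn : ∀ z, 0 ≤ z → 0 ≤ g z)
    (hlam : 0 < lam) (hδ : 0 < δ) (hα : 0 < α) (hx : 0 ≤ x)
    (hlin : Φ x ≤ Φ (min x b) + max (x - b) 0) :
    ENNReal.ofReal (Φ x) ≤ epv P δ D X := by
  have hb := hΦ.b_pos
  have hΦb := hΦ.nonneg b
  have hg0 := hgn 0 le_rfl
  set C := lam * α * Φ b * (g 0 + K * b) with hC
  set C' := (lam * (lam + δ) + δ ^ 2 + lam ^ 2) * Φ b with hC'
  have hC'0 : 0 ≤ C' := by positivity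
  have hpath : ∀ (t h : ℝ≥0) (n : ℕ), node h n = t → δ * h ≤ 1 →
      ENNReal.ofReal (Φ x - Real.exp (-δ * t) * Φ b - (C + C') * t * h) ≤ epv P δ D X := by
    intro t h n hn hh
    have hgain : ∀ k, -(C' * h ^ 2) ≤ ∫ ω, stepGain lam δ α Φ T Y X b 0 h k ω ∂P := fun k => by
      have hs0 : (0 : ℝ) ≤ node h k := NNReal.coe_nonneg _
      have hmesh : (node h (k + 1) : ℝ) - node h k = h := by rw [coe_node_succ]; ring
      have h1 := hc.le_integral_stepValue hΦ hlam hδ hα hb.le (node_le_succ h k)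
        (by rw [hmesh]; exact hh) (hA.measurable_aliveSurplus hc (node h k)) (fun ω => by
          by_cases hal : ∀ v ∈ Icc 0 (node h k : ℝ), 0 ≤ X ω v
          · right
            rw [aliveSurplus_of_alive hal]
            exact ⟨hal _ ⟨hs0, le_rfl⟩, (hB.isBarrierPath hg.continuous
              (hA.isControlledPath hc ω)).le_barrier _ hs0⟩
          · exact Or.inl (aliveSurplus_of_not_alive hal))
      rw [integral_stepGain hc hA hΦ hlam hδ hα hb.le]
      rw [hmesh] at h1 ⊢
      have hs1 : (0 : ℝ) ≤ node h (k + 1) := NNReal.coe_nonneg _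
      have hE : Real.exp (-δ * node h (k + 1)) ≤ 1 := Real.exp_le_one_iff.2 (by nlinarith)
      have hQ : 0 ≤ C' * (h : ℝ) ^ 2 := by positivity
      have h2 := mul_le_of_le_one_left hQ hE
      refine le_trans (b := Real.exp (-δ * node h (k + 1)) * -(C' * h ^ 2)) (by linarith) ?_
      exact mul_le_mul_of_nonneg_left (by linarith) (Real.exp_pos _).le
    have hint := integral_const_add_sum_add_const (P := P) (fun k =>
      integrable_stepGain hc hA hΦ hlam hδ hα hb.le 0 h k) (Φ x)
      (-(Real.exp (-δ * t) * Φ b) - n * (C * h ^ 2)) n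
    have hsum : -(n * (C' * h ^ 2)) ≤ ∑ k ∈ Finset.range n,
        ∫ ω, stepGain lam δ α Φ T Y X b 0 h k ω ∂P := by
      have := Finset.sum_le_sum fun k (_ : k ∈ Finset.range n) => hgain k
      rw [Finset.sum_const, Finset.card_range, nsmul_eq_mul] at this
      linarith
    have hnh : (n : ℝ) * h = t := by
      rw [← hn, node]
      push_cast
      ring
    have h3 : Φ x - Real.exp (-δ * t) * Φ b - (C + C') * t * h ≤ ∫ ω, (Φ x
        + ∑ k ∈ Finset.range n, stepGain lam δ α Φ T Y X b 0 h k ω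
        + (-(Real.exp (-δ * t) * Φ b) - n * (C * h ^ 2))) ∂P := by
      rw [hint.2, ← hnh]
      linarith
    refine (ENNReal.ofReal_le_ofReal h3).trans ((ofReal_integral_le hint.1).trans
      (lintegral_mono fun ω => ?_))
    have hp := hB.isBarrierPath hg.continuous (hA.isControlledPath hc ω)
    have h4 := path_lower (K := K) hp hg hgn hΦ hlam hδ hα hx hlin h n
    have h5 := hp.ofReal_dividends_le hg hgn hδ (hA.surplus_zero_nonneg hc ω) h n
    refine le_trans (ENNReal.ofReal_le_ofReal ?_) (h5.trans (lintegral_mono_set inter_subset_left))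
    have h6 := mul_le_mul_of_nonneg_left (hΦ.ruinValue_le hb.le
      (aliveSurplus (X ω) (node h n))) (Real.exp_pos (-δ * node h n)).le
    rw [hn] at h4 h6
    linarith
  have hmesh : ∀ t : ℝ≥0, ENNReal.ofReal (Φ x - Real.exp (-δ * t) * Φ b) ≤ epv P δ D X := by
    intro t
    have hlim := tendsto_mesh t
    have h1 := (hlim.const_mul ((C + C') * t)).const_sub (Φ x - Real.exp (-δ * t) * Φ b)
    rw [mul_zero, sub_zero] at h1
    refine le_of_tendsto (ENNReal.tendsto_ofReal h1) ?_
    have h2 := hlim.const_mul δ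
    rw [mul_zero] at h2
    filter_upwards [h2.eventually (Iio_mem_nhds one_pos)] with n hn
    exact hpath t _ (n + 1) (node_mesh t n) (le_of_lt hn)
  have h1 : Tendsto (fun n : ℕ => Φ x - Real.exp (-δ * ((n : ℝ≥0) : ℝ)) * Φ b) atTop (𝓝 (Φ x)) := by
    have h2 : Tendsto (fun n : ℕ => Real.exp (-δ * ((n : ℝ≥0) : ℝ))) atTop (𝓝 0) := by
      refine Real.tendsto_exp_atBot.comp ?_
      simp only [NNReal.coe_natCast]
      exact tendsto_natCast_atTop_atTop.const_mul_atTop_of_neg (by linarith)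
    simpa using (h2.mul_const (Φ b)).const_sub (Φ x)
  exact le_of_tendsto (ENNReal.tendsto_ofReal h1) (Eventually.of_forall fun n => hmesh n)

end

/-! ### The candidate value function -/

theorem harmonicDrift_congr {lam δ α : ℝ} {Φ Φ' : ℝ → ℝ} {z : ℝ} (hz : 0 ≤ z)
    (h : ∀ y ∈ Icc 0 z, Φ y = Φ' y) : harmonicDrift lam δ α Φ z = harmonicDrift lam δ α Φ' z := by
  rw [harmonicDrift, harmonicDrift, claimAvg_congr hz h, h z ⟨hz, le_rfl⟩]

theorem harmonicDrift_div (lam δ α : ℝ) (Φ : ℝ → ℝ) (c z : ℝ) :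
    harmonicDrift lam δ α (fun y => Φ y / c) z = harmonicDrift lam δ α Φ z / c := by
  have h1 : claimAvg α (fun y => Φ y / c) z = claimAvg α Φ z / c := by
    rw [claimAvg, claimAvg, ← intervalIntegral.integral_div]
    congr 1
    funext y
    ring
  rw [harmonicDrift, harmonicDrift, h1]
  ring

theorem harmonicDrift_ge {lam δ α : ℝ} (hlam : 0 < lam) (hα : 0 < α)
    {Φ : ℝ → ℝ} {z : ℝ} (hz : 0 ≤ z) (hc : Continuous Φ) (hm : MonotoneOn Φ (Ici 0))
    (h0 : 0 ≤ Φ z) : δ * Φ z ≤ harmonicDrift lam δ α Φ z := by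
  have h1 : claimAvg α Φ z ≤ ∫ y in (0 : ℝ)..z, Φ z * (α * Real.exp (-α * y)) := by
    refine intervalIntegral.integral_mono_on hz
      (Continuous.intervalIntegrable (by fun_prop) _ _)
      (Continuous.intervalIntegrable (by fun_prop) _ _) fun y hy => ?_
    exact mul_le_mul_of_nonneg_right (hm (show z - y ∈ Ici 0 from sub_nonneg.2 hy.2) hz
      (by linarith [hy.1])) (by positivity)
  rw [intervalIntegral.integral_const_mul, integral_exp_density] at h1
  have h2 : Φ z * (1 - Real.exp (-α * z)) ≤ Φ z * 1 :=
    mul_le_mul_of_nonneg_left (by linarith [Real.exp_pos (-α * z)]) h0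
  rw [harmonicDrift]
  nlinarith

/-- The weight exp(αz) is the integrating factor of A' = α(Φ - A): the claim averages cancel and
only local terms are left. -/
theorem hasDerivAt_exp_mul_harmonicDrift {lam δ α : ℝ} {Φ : ℝ → ℝ} (hΦ : Continuous Φ) {z p : ℝ}
    (hp : HasDerivAt Φ p z) :
    HasDerivAt (fun z => Real.exp (α * z) * harmonicDrift lam δ α Φ z)
      (Real.exp (α * z) * ((lam + δ) * p + α * δ * Φ z)) z := by
  have h1 : HasDerivAt (fun z : ℝ => Real.exp (α * z)) (Real.exp (α * z) * (α * 1)) z :=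
    ((hasDerivAt_id' z).const_mul α).exp
  have h2 : HasDerivAt (harmonicDrift lam δ α Φ)
      ((lam + δ) * p - lam * (α * (Φ z - claimAvg α Φ z))) z :=
    (hp.const_mul _).sub ((hasDerivAt_claimAvg hΦ z).const_mul _)
  refine (h1.mul h2).congr_deriv ?_
  rw [harmonicDrift]
  ring

namespace IsBarrierSolution

variable {g : ℝ → ℝ} {lam δ α b : ℝ} {ψ : ℝ → ℝ}

/-- ψ is controlled only on [0,∞); freezing it below 0 gives a globally continuous function without
changing any average at z ≥ 0. -/
theorem continuous_extend (h : IsBarrierSolution g lam δ α ψ b) :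
    Continuous fun z => ψ (max z 0) :=
  h.continuousOn.comp_continuous (by fun_prop) fun z => mem_Ici.2 (le_max_right z 0)

theorem monotoneOn_extend (h : IsBarrierSolution g lam δ α ψ b) :
    MonotoneOn (fun z => ψ (max z 0)) (Ici 0) := fun y _ z _ hyz =>
  h.strictMono.monotoneOn (show max y 0 ∈ Ici 0 from mem_Ici.2 (le_max_right _ _))
    (show max z 0 ∈ Ici 0 from mem_Ici.2 (le_max_right _ _)) (max_le_max_right _ hyz)

theorem hasDerivAt (h : IsBarrierSolution g lam δ α ψ b) {z : ℝ} (hz : 0 < z) :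
    HasDerivAt ψ (deriv ψ z) z :=
  ((h.contDiffOn.differentiableOn (by norm_num)).differentiableAt (Ioi_mem_nhds hz)).hasDerivAt

theorem hasDerivAt_extend (h : IsBarrierSolution g lam δ α ψ b) {z : ℝ} (hz : 0 < z) :
    HasDerivAt (fun z => ψ (max z 0)) (deriv ψ z) z := by
  refine (h.hasDerivAt hz).congr_of_eventuallyEq ?_
  filter_upwards [Ioi_mem_nhds hz] with y hy
  rw [max_eq_left (le_of_lt hy)]

theorem mul_deriv_eq (h : IsBarrierSolution g lam δ α ψ b) {z : ℝ} (hz : 0 < z) :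
    g z * deriv ψ z = harmonicDrift lam δ α (fun z => ψ (max z 0)) z := by
  rw [harmonicDrift_congr (Φ' := ψ) hz.le fun y hy => by rw [max_eq_left hy.1]]
  have := h.equation z hz
  rw [generator] at this
  rw [harmonicDrift, claimAvg]
  linarith

theorem deriv_nonneg (h : IsBarrierSolution g lam δ α ψ b) {z : ℝ} (hz : 0 < z) :
    0 ≤ deriv ψ z := by
  rw [← (h.hasDerivAt hz).hasDerivWithinAt.derivWithin (uniqueDiffOn_Ici 0 z hz.le)]
  exact h.strictMono.monotoneOn.derivWithin_nonneg

/-- Let z decrease to 0 in gψ' = H: the left side is nonnegative, and the claim average vanishes at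
0, so (λ+δ)ψ(0) ≥ 0. -/
theorem zero_nonneg (h : IsBarrierSolution g lam δ α ψ b) (hgn : ∀ z, 0 ≤ z → 0 ≤ g z)
    (hlam : 0 < lam) (hδ : 0 < δ) : 0 ≤ ψ 0 := by
  have h1 : Tendsto (harmonicDrift lam δ α (fun z => ψ (max z 0))) (𝓝[>] 0)
      (𝓝 (harmonicDrift lam δ α (fun z => ψ (max z 0)) 0)) :=
    (continuous_harmonicDrift h.continuous_extend).continuousAt.mono_left nhdsWithin_le_nhds
  have h2 : 0 ≤ harmonicDrift lam δ α (fun z => ψ (max z 0)) 0 := by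
    refine ge_of_tendsto h1 ?_
    filter_upwards [self_mem_nhdsWithin] with z hz
    rw [← h.mul_deriv_eq hz]
    exact mul_nonneg (hgn z (le_of_lt hz)) (h.deriv_nonneg hz)
  simp only [harmonicDrift, claimAvg, intervalIntegral.integral_same, mul_zero, sub_zero,
    max_self] at h2
  exact nonneg_of_mul_nonneg_right h2 (by positivity)

theorem pos (h : IsBarrierSolution g lam δ α ψ b) (hgn : ∀ z, 0 ≤ z → 0 ≤ g z)
    (hlam : 0 < lam) (hδ : 0 < δ) {z : ℝ} (hz : 0 < z) : 0 < ψ z :=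
  (h.zero_nonneg hgn hlam hδ).trans_lt (h.strictMono (self_mem_Ici) hz.le hz)

/-- A consequence of H ≥ δψ. As ψ > 0 on (0,∞), it forces both g and ψ' to be strictly positive
there. -/
theorem mul_deriv_ge (h : IsBarrierSolution g lam δ α ψ b) (hgn : ∀ z, 0 ≤ z → 0 ≤ g z)
    (hlam : 0 < lam) (hδ : 0 < δ) (hα : 0 < α) {z : ℝ} (hz : 0 < z) :
    δ * ψ z ≤ g z * deriv ψ z := by
  rw [h.mul_deriv_eq hz]
  have := harmonicDrift_ge (δ := δ) hlam hα hz.le h.continuous_extend h.monotoneOn_extend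
    (by rw [max_eq_left hz.le]; exact (h.pos hgn hlam hδ hz).le)
  rwa [max_eq_left hz.le] at this

theorem g_pos (h : IsBarrierSolution g lam δ α ψ b) (hgn : ∀ z, 0 ≤ z → 0 ≤ g z)
    (hlam : 0 < lam) (hδ : 0 < δ) (hα : 0 < α) {z : ℝ} (hz : 0 < z) : 0 < g z := by
  refine lt_of_le_of_ne (hgn z hz.le) fun h0 => ?_
  have h1 := h.mul_deriv_ge hgn hlam hδ hα hz
  rw [← h0, zero_mul] at h1
  exact absurd h1 (not_le.2 (mul_pos hδ (h.pos hgn hlam hδ hz)))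

theorem deriv_pos (h : IsBarrierSolution g lam δ α ψ b) (hgn : ∀ z, 0 ≤ z → 0 ≤ g z)
    (hlam : 0 < lam) (hδ : 0 < δ) (hα : 0 < α) {z : ℝ} (hz : 0 < z) : 0 < deriv ψ z := by
  refine lt_of_le_of_ne (h.deriv_nonneg hz) fun h0 => ?_
  have h1 := h.mul_deriv_ge hgn hlam hδ hα hz
  rw [← h0, mul_zero] at h1
  exact absurd h1 (not_le.2 (mul_pos hδ (h.pos hgn hlam hδ hz)))

/-- If ψ(0) > 0, then g(z) ≤ Kz and gψ' ≥ δψ ≥ δψ(0) give ψ' ≥ a/z. So ψ - a log is nondecreasing on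
(0,∞) and ψ would tend to -∞ at 0. -/
theorem zero_of_drift_zero (h : IsBarrierSolution g lam δ α ψ b) {K : ℝ≥0}
    (hg : LipschitzWith K g) (hgn : ∀ z, 0 ≤ z → 0 ≤ g z)
    (hlam : 0 < lam) (hδ : 0 < δ) (hα : 0 < α) (h0 : g 0 = 0) : ψ 0 = 0 := by
  by_contra hne
  have hψ0 : 0 < ψ 0 := lt_of_le_of_ne (h.zero_nonneg hgn hlam hδ) (Ne.symm hne)
  have hgK : ∀ z, 0 ≤ z → g z ≤ K * z := fun z hz => by
    have := LipschitzWith.le_add_mul hg z 0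
    rwa [h0, zero_add, sub_zero, abs_of_nonneg hz] at this
  have hK : 0 < (K : ℝ) := by
    have h1 := h.g_pos hgn hlam hδ hα one_pos
    have h2 := hgK 1 zero_le_one
    linarith
  set a := δ * ψ 0 / K with ha
  have ha0 : 0 < a := by positivity
  have hmono : MonotoneOn (fun z => ψ z - a * Real.log z) (Ioi 0) := by
    have hd : ∀ z ∈ Ioi (0 : ℝ), HasDerivAt (fun z => ψ z - a * Real.log z)
        (deriv ψ z - a * z⁻¹) z := fun z hz =>
      (h.hasDerivAt hz).sub ((Real.hasDerivAt_log (ne_of_gt hz)).const_mul a)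
    refine monotoneOn_of_deriv_nonneg (convex_Ioi 0)
      (fun z hz => (hd z hz).continuousAt.continuousWithinAt)
      (fun z hz => (hd z (interior_subset hz)).differentiableAt.differentiableWithinAt)
      fun z hz => ?_
    have hz' : 0 < z := interior_subset hz
    rw [(hd z hz').deriv]
    have h1 := h.mul_deriv_ge hgn hlam hδ hα hz'
    have h2 := mul_le_mul_of_nonneg_right (hgK z hz'.le) (h.deriv_nonneg hz')
    have h3 := mul_le_mul_of_nonneg_left (h.strictMono.monotoneOn self_mem_Ici hz'.le hz'.le) hδ.le
    have h4 : a * z⁻¹ ≤ deriv ψ z := by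
      rw [ha, div_mul_eq_mul_div, div_le_iff₀ hK, ← div_eq_mul_inv, div_le_iff₀ hz']
      linarith
    linarith
  -- Chosen so that comparison with the point 1 gives ψ(e) ≤ ψ(0) - 1, against monotonicity.
  set e := Real.exp (-((ψ 1 - ψ 0 + 1) / a)) with he
  have h01 : ψ 0 ≤ ψ 1 := h.strictMono.monotoneOn self_mem_Ici (mem_Ici.2 zero_le_one) zero_le_one
  have he1 : e ≤ 1 := Real.exp_le_one_iff.2 (neg_nonpos.2 (by
    have : 0 ≤ ψ 1 - ψ 0 + 1 := by linarith
    positivity))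
  have he0 : 0 < e := Real.exp_pos _
  have h1 := hmono (show e ∈ Ioi 0 from he0) (mem_Ioi.2 one_pos) he1
  have h2 : ψ 0 ≤ ψ e := h.strictMono.monotoneOn self_mem_Ici he0.le he0.le
  have h3 : a * Real.log e = -(ψ 1 - ψ 0 + 1) := by
    rw [he, Real.log_exp]
    field_simp
  simp only [Real.log_one, mul_zero, sub_zero] at h1
  linarith

/-- ψ' is at least ψ'(b) on (0,∞); after division by ψ'(b) this is the slope condition for Φ. -/
theorem mul_sub_le (h : IsBarrierSolution g lam δ α ψ b) {y z : ℝ} (hy : 0 ≤ y) (hyz : y ≤ z) :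
    deriv ψ b * (z - y) ≤ ψ z - ψ y := by
  have hmono : MonotoneOn (fun z => ψ z - deriv ψ b * z) (Ici 0) := by
    have hd : ∀ z ∈ Ioi (0 : ℝ), HasDerivAt (fun z => ψ z - deriv ψ b * z)
        (deriv ψ z - deriv ψ b * 1) z := fun z hz =>
      (h.hasDerivAt hz).sub ((hasDerivAt_id' z).const_mul _)
    refine monotoneOn_of_deriv_nonneg (convex_Ici 0)
      (h.continuousOn.sub (by fun_prop)) (fun z hz => ?_) fun z hz => ?_
    · rw [interior_Ici] at hz
      exact (hd z hz).differentiableAt.differentiableWithinAt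
    · rw [interior_Ici] at hz
      rw [(hd z hz).deriv, mul_one]
      exact sub_nonneg.2 (h.isMin hz)
  have := hmono (show y ∈ Ici 0 from hy) (show z ∈ Ici 0 from hy.trans hyz) hyz
  linarith

/-- A single formula for both branches, from which continuity at b is visible. -/
theorem candidate_eq (h : IsBarrierSolution g lam δ α ψ b) (z : ℝ) :
    candidate ψ b (max z 0) = ψ (max (min z b) 0) / deriv ψ b + max (z - b) 0 := by
  have hb := h.b_pos
  rcases le_total z b with hz | hz
  · rw [candidate, if_pos (max_le hz hb.le), min_eq_left hz, max_eq_right (by linarith : z - b ≤ 0),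
      add_zero]
  · rcases hz.eq_or_lt with rfl | hz'
    · rw [candidate, if_pos (max_le le_rfl hb.le)]
      simp
    · rw [max_eq_left (hb.le.trans hz), candidate, if_neg (not_le.2 hz'), min_eq_right hz,
        max_eq_left hb.le, max_eq_left (sub_nonneg.2 hz)]
      ring

theorem candidate_of_le (h : IsBarrierSolution g lam δ α ψ b) {z : ℝ} (hz : z ≤ b) :
    candidate ψ b (max z 0) = ψ (max z 0) / deriv ψ b := by
  rw [candidate, if_pos (max_le hz h.b_pos.le)]

theorem candidate_of_ge (h : IsBarrierSolution g lam δ α ψ b) {z : ℝ} (hz : b ≤ z) :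
    candidate ψ b (max z 0) = z - b + ψ b / deriv ψ b := by
  rw [h.candidate_eq, min_eq_right hz, max_eq_left h.b_pos.le, max_eq_left (sub_nonneg.2 hz)]
  ring

theorem continuous_candidate (h : IsBarrierSolution g lam δ α ψ b) :
    Continuous fun z => candidate ψ b (max z 0) := by
  simp only [h.candidate_eq]
  have h1 : Continuous fun z => ψ (max (min z b) 0) :=
    h.continuous_extend.comp (continuous_id.min continuous_const)
  exact (h1.div_const _).add (by fun_prop)

theorem harmonicDrift_candidate_of_le (h : IsBarrierSolution g lam δ α ψ b) {z : ℝ} (hz : 0 ≤ z)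
    (hzb : z ≤ b) : harmonicDrift lam δ α (fun z => candidate ψ b (max z 0)) z
      = harmonicDrift lam δ α (fun z => ψ (max z 0)) z / deriv ψ b := by
  rw [← harmonicDrift_div]
  exact harmonicDrift_congr hz fun y hy => h.candidate_of_le (hy.2.trans hzb)

theorem harmonicDrift_candidate_barrier (h : IsBarrierSolution g lam δ α ψ b)
    (hgn : ∀ z, 0 ≤ z → 0 ≤ g z) (hlam : 0 < lam) (hδ : 0 < δ) (hα : 0 < α) :
    harmonicDrift lam δ α (fun z => candidate ψ b (max z 0)) b = g b := by
  rw [h.harmonicDrift_candidate_of_le h.b_pos.le le_rfl, ← h.mul_deriv_eq h.b_pos,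
    mul_div_cancel_right₀ _ (h.deriv_pos hgn hlam hδ hα h.b_pos).ne']

/-- Fix x > b and put p = ψ'(x). On [b,x], pΦ - ψ is nonnegative at b because p ≥ ψ'(b), and
nondecreasing because ψ' ≤ p. Hence exp(αy)(pH_Φ - H_ψ), where the index names the function used in
H, has derivative exp(αy)((λ+δ)(p - ψ') + αδ(pΦ - ψ)) ≥ 0, and at b it is a nonnegative multiple of
p - ψ'(b). At x it says pH_Φ(x) ≥ H_ψ(x) = g(x)p, and p > 0 cancels. -/
theorem le_harmonicDrift_candidate (h : IsBarrierSolution g lam δ α ψ b)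
    (hgn : ∀ z, 0 ≤ z → 0 ≤ g z) (hlam : 0 < lam) (hδ : 0 < δ) (hα : 0 < α) {x : ℝ} (hx : b ≤ x) :
    g x ≤ harmonicDrift lam δ α (fun z => candidate ψ b (max z 0)) x := by
  rcases hx.eq_or_lt with rfl | hx'
  · exact (h.harmonicDrift_candidate_barrier hgn hlam hδ hα).ge
  have hb := h.b_pos
  have hx0 : 0 < x := hb.trans hx'
  set Φ := fun z => candidate ψ b (max z 0) with hΦ
  set f := fun z => ψ (max z 0) with hf
  have hΦc : Continuous Φ := h.continuous_candidate
  have hfc : Continuous f := h.continuous_extend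
  set p := deriv ψ x with hp
  have hp0 : 0 < p := h.deriv_pos hgn hlam hδ hα hx0
  have hcp : deriv ψ b ≤ p := h.isMin hx0
  have hc := h.deriv_pos hgn hlam hδ hα hb
  have hfd : ∀ y ∈ Ioo b x, HasDerivAt f (deriv ψ y) y := fun y hy =>
    h.hasDerivAt_extend (hb.trans hy.1)
  have hΦd : ∀ y ∈ Ioo b x, HasDerivAt Φ 1 y := fun y hy => by
    have h1 : HasDerivAt (fun z : ℝ => z - b + ψ b / deriv ψ b) 1 y :=
      ((hasDerivAt_id' y).sub_const b).add_const _
    refine h1.congr_of_eventuallyEq ?_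
    filter_upwards [Ioi_mem_nhds hy.1] with z hz
    exact h.candidate_of_ge (le_of_lt hz)
  have hpy : ∀ y ∈ Ioo b x, deriv ψ y ≤ p := fun y hy => h.deriv_mono hy.1 hx' hy.2.le
  have hΦb : Φ b = f b / deriv ψ b := h.candidate_of_le le_rfl
  have hfb : 0 ≤ f b := by
    simp only [hf, max_eq_left hb.le]
    exact (h.pos hgn hlam hδ hb).le
  have hcmp : MonotoneOn (fun y => p * Φ y - f y) (Icc b x) := by
    have hd : ∀ y ∈ Ioo b x, HasDerivAt (fun y => p * Φ y - f y) (p * 1 - deriv ψ y) y :=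
      fun y hy => ((hΦd y hy).const_mul p).sub (hfd y hy)
    refine monotoneOn_of_deriv_nonneg (convex_Icc b x) (by fun_prop) (fun y hy => ?_)
      fun y hy => ?_
    · rw [interior_Icc] at hy
      exact (hd y hy).differentiableAt.differentiableWithinAt
    · rw [interior_Icc] at hy
      rw [(hd y hy).deriv, mul_one]
      exact sub_nonneg.2 (hpy y hy)
  have hcmp' : ∀ y ∈ Icc b x, 0 ≤ p * Φ y - f y := fun y hy => by
    refine le_trans ?_ (hcmp ⟨le_rfl, hx⟩ hy hy.1)
    beta_reduce
    rw [hΦb, mul_div_assoc', sub_nonneg, le_div_iff₀ hc, mul_comm]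
    exact mul_le_mul_of_nonneg_right hcp hfb
  set F := fun y => p * (Real.exp (α * y) * harmonicDrift lam δ α Φ y)
    - Real.exp (α * y) * harmonicDrift lam δ α f y with hF
  have hFm : MonotoneOn F (Icc b x) := by
    have hd : ∀ y ∈ Ioo b x, HasDerivAt F (p * (Real.exp (α * y) * ((lam + δ) * 1 + α * δ * Φ y))
        - Real.exp (α * y) * ((lam + δ) * deriv ψ y + α * δ * f y)) y := fun y hy =>
      ((hasDerivAt_exp_mul_harmonicDrift hΦc (hΦd y hy)).const_mul p).sub
        (hasDerivAt_exp_mul_harmonicDrift hfc (hfd y hy))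
    have h1 := continuous_harmonicDrift (lam := lam) (δ := δ) (α := α) hΦc
    have h2 := continuous_harmonicDrift (lam := lam) (δ := δ) (α := α) hfc
    refine monotoneOn_of_deriv_nonneg (convex_Icc b x) (by fun_prop) (fun y hy => ?_)
      fun y hy => ?_
    · rw [interior_Icc] at hy
      exact (hd y hy).differentiableAt.differentiableWithinAt
    · rw [interior_Icc] at hy
      rw [(hd y hy).deriv]
      have h3 := sub_nonneg.2 (hpy y hy)
      have h4 := hcmp' y ⟨hy.1.le, hy.2.le⟩
      have h5 : 0 ≤ Real.exp (α * y) * ((lam + δ) * (p - deriv ψ y)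
          + α * δ * (p * Φ y - f y)) := by positivity
      linarith
  have h1 := hFm ⟨le_rfl, hx⟩ ⟨hx, le_rfl⟩ hx
  have h2 : 0 ≤ F b := by
    simp only [hF]
    rw [h.harmonicDrift_candidate_barrier hgn hlam hδ hα, ← h.mul_deriv_eq hb]
    have h3 := mul_nonneg (mul_nonneg (Real.exp_pos (α * b)).le (hgn b hb.le)) (sub_nonneg.2 hcp)
    linarith
  have h3 : 0 ≤ Real.exp (α * x) * p * (harmonicDrift lam δ α Φ x - g x) := by
    have h4 := h2.trans h1
    simp only [hF] at h4
    rw [← h.mul_deriv_eq hx0] at h4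
    linarith
  exact sub_nonneg.1 (nonneg_of_mul_nonneg_right h3 (by positivity))

/-- Only z = 0 with g(0) > 0 needs an argument: there ψ' = H/g has a limit from the right, and this
limit is the one-sided derivative of the continuous ψ. -/
theorem deriv_eq (h : IsBarrierSolution g lam δ α ψ b) (hg : Continuous g) {z : ℝ} (hz : 0 ≤ z)
    (hzb : z < b) (hgz : 0 < g z) :
    ∃ p, HasDerivWithinAt (fun z => candidate ψ b (max z 0)) p (Ici z) z
      ∧ g z * p = harmonicDrift lam δ α (fun z => candidate ψ b (max z 0)) z := by
  rw [h.harmonicDrift_candidate_of_le hz hzb.le]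
  have hcongr : ∀ p, HasDerivWithinAt (fun z => ψ (max z 0)) p (Ici z) z →
      HasDerivWithinAt (fun z => candidate ψ b (max z 0)) (p / deriv ψ b) (Ici z) z := by
    intro p hp
    refine (hp.div_const (deriv ψ b)).congr_of_eventuallyEq ?_ (h.candidate_of_le hzb.le)
    filter_upwards [mem_nhdsWithin_of_mem_nhds (Iio_mem_nhds hzb)] with y hy
    exact h.candidate_of_le (le_of_lt hy)
  rcases hz.eq_or_lt with rfl | hz'
  · refine ⟨_, hcongr (harmonicDrift lam δ α (fun z => ψ (max z 0)) 0 / g 0) ?_, by field_simp⟩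
    refine hasDerivWithinAt_Ici_of_tendsto_deriv (s := Ioi 0) (fun y hy =>
      (h.hasDerivAt_extend hy).differentiableAt.differentiableWithinAt)
      h.continuous_extend.continuousWithinAt self_mem_nhdsWithin ?_
    have h1 : Tendsto (fun y => harmonicDrift lam δ α (fun z => ψ (max z 0)) y / g y) (𝓝[>] 0)
        (𝓝 (harmonicDrift lam δ α (fun z => ψ (max z 0)) 0 / g 0)) :=
      (((continuous_harmonicDrift h.continuous_extend).tendsto 0).div (hg.tendsto 0)
        hgz.ne').mono_left nhdsWithin_le_nhds
    refine h1.congr' ?_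
    filter_upwards [self_mem_nhdsWithin,
      mem_nhdsWithin_of_mem_nhds ((hg.tendsto 0).eventually (Ioi_mem_nhds hgz))] with y hy hgy
    rw [(h.hasDerivAt_extend hy).deriv, ← h.mul_deriv_eq hy,
      mul_div_cancel_left₀ _ (ne_of_gt hgy)]
  · refine ⟨_, hcongr _ (h.hasDerivAt_extend hz').hasDerivWithinAt, ?_⟩
    rw [mul_div_assoc', h.mul_deriv_eq hz']

theorem isVerification (h : IsBarrierSolution g lam δ α ψ b) {K : ℝ≥0}
    (hg : LipschitzWith K g) (hgn : ∀ z, 0 ≤ z → 0 ≤ g z)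
    (hlam : 0 < lam) (hδ : 0 < δ) (hα : 0 < α) :
    IsVerification g lam δ α b fun z => candidate ψ b (max z 0) where
  cont := h.continuous_candidate
  nonneg := fun z => by
    rw [h.candidate_eq]
    have h1 := h.deriv_pos hgn hlam hδ hα h.b_pos
    have h2 : 0 ≤ ψ (max (min z b) 0) := (h.zero_nonneg hgn hlam hδ).trans
      (h.strictMono.monotoneOn self_mem_Ici (show max (min z b) 0 ∈ Ici 0 from mem_Ici.2 (le_max_right _ _))
        (le_max_right _ _))
    positivity
  slope := fun y z hy hyz => by
    have hc := h.deriv_pos hgn hlam hδ hα h.b_pos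
    have key : ∀ y z, 0 ≤ y → y ≤ z → z - y ≤ ψ z / deriv ψ b - ψ y / deriv ψ b := fun y z hy hyz => by
      rw [← sub_div, le_div_iff₀ hc, mul_comm]
      exact h.mul_sub_le hy hyz
    rcases le_total z b with hz | hz
    · rw [h.candidate_of_le hz, h.candidate_of_le (hyz.trans hz), max_eq_left hy,
        max_eq_left (hy.trans hyz)]
      exact key y z hy hyz
    · rw [h.candidate_of_ge hz]
      rcases le_total y b with hy' | hy'
      · rw [h.candidate_of_le hy', max_eq_left hy]
        linarith [key y b hy hy']
      · rw [h.candidate_of_ge hy']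
        linarith
  deriv_le := fun z hz hgz => by
    rcases lt_or_ge z b with hzb | hzb
    · obtain ⟨p, hp, he⟩ := h.deriv_eq hg.continuous hz hzb hgz
      exact ⟨p, hp, he.le⟩
    · refine ⟨1, ?_, by rw [mul_one]; exact h.le_harmonicDrift_candidate hgn hlam hδ hα hzb⟩
      have h1 : HasDerivWithinAt (fun z : ℝ => z - b + ψ b / deriv ψ b) 1 (Ici z) z :=
        (((hasDerivAt_id' z).sub_const b).add_const _).hasDerivWithinAt
      exact h1.congr (fun y hy => h.candidate_of_ge (hzb.trans hy)) (h.candidate_of_ge hzb)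
  deriv_eq := fun z hz hzb hgz => h.deriv_eq hg.continuous hz hzb hgz
  drift_barrier := h.harmonicDrift_candidate_barrier hgn hlam hδ hα
  g_pos := fun z hz => h.g_pos hgn hlam hδ hα hz
  zero := fun h0 => by
    rw [h.candidate_of_le h.b_pos.le, max_self, h.zero_of_drift_zero hg hgn hlam hδ hα h0, zero_div]
  b_pos := h.b_pos

end IsBarrierSolution

/-! ### Construction of the barrier path -/

/-- A measurable path that is bounded on compact time intervals. -/
structure IsSurplusPath (u : ℝ → ℝ) : Prop where
  measurable : Measurable u
  bounded : ∀ t, ∃ C, ∀ r ∈ Icc 0 t, |u r| ≤ C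

/-- Surplus without dividends, when the income rate is driven by the path `u`. -/
noncomputable def freeSurplus (g : ℝ → ℝ) (x : ℝ) (S u : ℝ → ℝ) (t : ℝ) : ℝ :=
  x + (∫ s in (0 : ℝ)..max t 0, g (u s)) - S (max t 0)

/-- Running supremum of the excess of `z` over `b`. -/
noncomputable def runningExcess (b : ℝ) (z : ℝ → ℝ) (t : ℝ) : ℝ :=
  ⨆ r : Icc (0 : ℝ) t, max (z r - b) 0

/-- Skorokhod reflection at `b` of the surplus with income driven by `u`. -/
noncomputable def reflectedPath (g : ℝ → ℝ) (b x : ℝ) (S u : ℝ → ℝ) (t : ℝ) : ℝ :=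
  freeSurplus g x S u t - runningExcess b (freeSurplus g x S u) t

/-! #### Running suprema -/

section RunningExcess

variable {b : ℝ} {z : ℝ → ℝ}

theorem runningExcess_nonneg (t : ℝ) : 0 ≤ runningExcess b z t :=
  Real.iSup_nonneg fun _ => le_max_right _ _

theorem runningExcess_le {t a : ℝ} (ha : 0 ≤ a) (h : ∀ r ∈ Icc 0 t, z r - b ≤ a) :
    runningExcess b z t ≤ a :=
  Real.iSup_le (fun r => max_le (h r r.2) ha) ha

theorem runningExcess_of_neg {t : ℝ} (ht : t < 0) : runningExcess b z t = 0 :=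
  le_antisymm (runningExcess_le le_rfl fun _ hr => absurd (hr.1.trans hr.2) (not_le.2 ht))
    (runningExcess_nonneg t)

theorem le_runningExcess {t a : ℝ} (ha : ∀ r ∈ Icc 0 t, z r ≤ a) {r : ℝ} (hr : r ∈ Icc 0 t) :
    z r - b ≤ runningExcess b z t := by
  have hb : BddAbove (range fun r : Icc (0 : ℝ) t => max (z r - b) 0) := by
    refine ⟨max (a - b) 0, ?_⟩
    rintro _ ⟨v, rfl⟩
    exact max_le_max_right _ (by linarith [ha v v.2])
  exact (le_max_left _ _).trans (le_ciSup hb ⟨r, hr⟩)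

theorem runningExcess_mono {s t a : ℝ} (hst : s ≤ t) (ha : ∀ r ∈ Icc 0 t, z r ≤ a) :
    runningExcess b z s ≤ runningExcess b z t :=
  runningExcess_le (runningExcess_nonneg t) fun _ hr =>
    le_runningExcess ha ⟨hr.1, hr.2.trans hst⟩

/-- Passing to the running excess does not enlarge a uniform difference of two paths; this gives the
Lipschitz property of the reflection map. -/
theorem runningExcess_le_add {z' : ℝ → ℝ} {t a e : ℝ} (ha : ∀ r ∈ Icc 0 t, z' r ≤ a) (he : 0 ≤ e)
    (h : ∀ r ∈ Icc 0 t, z r ≤ z' r + e) : runningExcess b z t ≤ runningExcess b z' t + e :=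
  runningExcess_le (add_nonneg (runningExcess_nonneg t) he) fun r hr => by
    linarith [h r hr, le_runningExcess (b := b) ha hr]

theorem runningExcess_zero : runningExcess b z 0 = max (z 0 - b) 0 := by
  refine le_antisymm (runningExcess_le (le_max_right _ _) fun r hr => ?_)
    (max_le (le_runningExcess (a := z 0) (fun r hr => ?_) ⟨le_rfl, le_rfl⟩)
      (runningExcess_nonneg 0))
  · rw [le_antisymm hr.2 hr.1]
    exact le_max_left _ _
  · rw [le_antisymm hr.2 hr.1]

/-- If `z` grows at rate at most `C` up to time `T`, so does its running excess. -/
theorem runningExcess_le_of_growth {T C : ℝ} (hC : 0 ≤ C)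
    (hz : ∀ v r, 0 ≤ v → v ≤ r → r ≤ T → z r ≤ z v + C * (r - v)) {s t : ℝ} (hs : 0 ≤ s)
    (hst : s ≤ t) (ht : t ≤ T) : runningExcess b z t ≤ runningExcess b z s + C * (t - s) := by
  have hbd : ∀ r ∈ Icc 0 s, z r ≤ z 0 + C * T := fun r hr => by
    have h1 := hz 0 r le_rfl hr.1 ((hr.2.trans hst).trans ht)
    have h2 : C * (r - 0) ≤ C * T := mul_le_mul_of_nonneg_left (by linarith [hr.2]) hC
    linarith
  have h0 : 0 ≤ C * (t - s) := mul_nonneg hC (by linarith)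
  refine runningExcess_le (add_nonneg (runningExcess_nonneg s) h0) fun r hr => ?_
  rcases le_total r s with h | h
  · linarith [le_runningExcess (b := b) hbd ⟨hr.1, h⟩]
  · have h1 := hz s r hs h (hr.2.trans ht)
    have h2 := le_runningExcess (b := b) hbd ⟨hs, le_rfl⟩
    have h3 : C * (r - s) ≤ C * (t - s) := mul_le_mul_of_nonneg_left (by linarith [hr.2]) hC
    linarith

end RunningExcess

/-! ### The reflection map as a contraction, and its fixed point -/

section Reflection

variable {g : ℝ → ℝ} {K : ℝ≥0} {b x : ℝ} {S u v : ℝ → ℝ}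

namespace IsSurplusPath

theorem exists_drift_bound (hu : IsSurplusPath u) (hg : LipschitzWith K g) (t : ℝ) :
    ∃ C, 0 ≤ C ∧ ∀ r ∈ Icc 0 t, |g (u r)| ≤ C := by
  obtain ⟨C, hC⟩ := hu.bounded t
  obtain ⟨C', hC'⟩ := (isCompact_Icc (a := -C) (b := C)).exists_bound_of_continuousOn
    hg.continuous.continuousOn
  exact ⟨|C'|, abs_nonneg _, fun r hr => (hC' _ (abs_le.1 (hC r hr))).trans (le_abs_self _)⟩

theorem intervalIntegrable (hu : IsSurplusPath u) (hg : LipschitzWith K g) {s t : ℝ} (hs : 0 ≤ s)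
    (hst : s ≤ t) : IntervalIntegrable (fun r => g (u r)) volume s t := by
  obtain ⟨C, -, hC⟩ := hu.exists_drift_bound hg t
  rw [intervalIntegrable_iff_integrableOn_Ioc_of_le hst]
  refine Measure.integrableOn_of_bounded (M := C) (by simp)
    (hg.continuous.measurable.comp hu.measurable).aestronglyMeasurable ?_
  filter_upwards [ae_restrict_mem measurableSet_Ioc] with r hr
  exact hC r ⟨hs.trans hr.1.le, hr.2⟩

theorem freeSurplus_eq (hu : IsSurplusPath u) (hg : LipschitzWith K g) {s t : ℝ} (hs : 0 ≤ s)
    (hst : s ≤ t) : freeSurplus g x S u t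
      = freeSurplus g x S u s + (∫ r in s..t, g (u r)) - (S t - S s) := by
  have h1 := intervalIntegral.integral_add_adjacent_intervals
    (hu.intervalIntegrable hg le_rfl hs) (hu.intervalIntegrable hg hs hst)
  rw [freeSurplus, freeSurplus, max_eq_left hs, max_eq_left (hs.trans hst)]
  linarith

theorem freeSurplus_le (hu : IsSurplusPath u) (hg : LipschitzWith K g) (hS : Monotone S)
    {T C : ℝ} (hC : ∀ r ∈ Icc 0 T, |g (u r)| ≤ C) (s t : ℝ) (hs : 0 ≤ s) (hst : s ≤ t)
    (ht : t ≤ T) : freeSurplus g x S u t ≤ freeSurplus g x S u s + C * (t - s) := by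
  have h1 : ∫ r in s..t, g (u r) ≤ ∫ r in s..t, C :=
    intervalIntegral.integral_mono_on hst (hu.intervalIntegrable hg hs hst) (by simp) fun r hr =>
      (abs_le.1 (hC r ⟨hs.trans hr.1, hr.2.trans ht⟩)).2
  rw [intervalIntegral.integral_const, smul_eq_mul] at h1
  rw [hu.freeSurplus_eq hg hs hst]
  linarith [hS hst]

theorem freeSurplus_bddAbove (hu : IsSurplusPath u) (hg : LipschitzWith K g) (hS : Monotone S)
    (T : ℝ) : ∃ a, ∀ r ∈ Icc 0 T, freeSurplus g x S u r ≤ a := by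
  obtain ⟨C, hC0, hC⟩ := hu.exists_drift_bound hg T
  refine ⟨freeSurplus g x S u 0 + C * T, fun r hr => ?_⟩
  have h1 := hu.freeSurplus_le (x := x) hg hS hC 0 r le_rfl hr.1 hr.2
  have h2 : C * (r - 0) ≤ C * T := mul_le_mul_of_nonneg_left (by linarith [hr.2]) hC0
  linarith

theorem monotone_runningExcess (hu : IsSurplusPath u) (hg : LipschitzWith K g) (hS : Monotone S) :
    Monotone (runningExcess b (freeSurplus g x S u)) := fun _ t hst => by
  obtain ⟨a, ha⟩ := hu.freeSurplus_bddAbove (x := x) hg hS t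
  exact runningExcess_mono hst ha

theorem runningExcess_sub_le (hu : IsSurplusPath u) (hg : LipschitzWith K g) (hS : Monotone S)
    (T : ℝ) : ∃ C, 0 ≤ C ∧ ∀ s t, 0 ≤ s → s ≤ t → t ≤ T →
      runningExcess b (freeSurplus g x S u) t
        ≤ runningExcess b (freeSurplus g x S u) s + C * (t - s) := by
  obtain ⟨C, hC0, hC⟩ := hu.exists_drift_bound hg T
  exact ⟨C, hC0, fun s t hs hst ht =>
    runningExcess_le_of_growth hC0 (hu.freeSurplus_le hg hS hC) hs hst ht⟩

theorem continuous_integral (hu : IsSurplusPath u) (hg : LipschitzWith K g) :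
    Continuous fun t => ∫ s in (0 : ℝ)..max t 0, g (u s) := by
  have h1 : ContinuousOn (fun t => ∫ s in (0 : ℝ)..t, g (u s)) (Ici 0) := by
    intro t ht
    have ht0 : (0 : ℝ) ≤ t := ht
    have h1 := intervalIntegral.continuousOn_primitive_interval'
      (hu.intervalIntegrable hg le_rfl (by linarith : (0 : ℝ) ≤ t + 1)) (left_mem_uIcc)
    rw [uIcc_of_le (by linarith)] at h1
    refine (h1 t ⟨ht0, by linarith⟩).mono_of_mem_nhdsWithin ?_
    filter_upwards [self_mem_nhdsWithin,
      mem_nhdsWithin_of_mem_nhds (Iio_mem_nhds (by linarith : t < t + 1))] with v hv hv'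
    exact ⟨hv, hv'.le⟩
  exact h1.comp_continuous (by fun_prop) fun t => mem_Ici.2 (le_max_right t 0)

theorem reflectedPath_of_neg (hS0 : S 0 = 0) {t : ℝ} (ht : t < 0) :
    reflectedPath g b x S u t = x := by
  rw [reflectedPath, freeSurplus, runningExcess_of_neg ht, max_eq_right ht.le,
    intervalIntegral.integral_same, hS0]
  ring

theorem reflectedPath (hu : IsSurplusPath u) (hg : LipschitzWith K g) (hS : Monotone S) :
    IsSurplusPath (reflectedPath g b x S u) where
  measurable := by
    have h1 : Measurable fun t => S (max t 0) :=
      hS.measurable.comp (measurable_id.max measurable_const)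
    exact (((hu.continuous_integral hg).measurable.const_add x).sub h1).sub
      (hu.monotone_runningExcess hg hS).measurable
  bounded := fun t => by
    obtain ⟨C, hC0, hC⟩ := hu.exists_drift_bound hg t
    refine ⟨|x| + C * t + (|S 0| + |S t|) + runningExcess b (freeSurplus g x S u) t,
      fun r hr => ?_⟩
    have h1 : |∫ s in (0 : ℝ)..max r 0, g (u s)| ≤ C * t := by
      have h2 := intervalIntegral.norm_integral_le_of_norm_le_const (a := (0 : ℝ)) (b := max r 0)
        (f := fun s => g (u s)) (C := C) fun s hs => by
          rw [uIoc_of_le (le_max_right _ _), max_eq_left hr.1] at hs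
          exact hC s ⟨hs.1.le, hs.2.trans hr.2⟩
      rw [max_eq_left hr.1, sub_zero, abs_of_nonneg hr.1] at h2
      rw [max_eq_left hr.1]
      exact h2.trans (mul_le_mul_of_nonneg_left hr.2 hC0)
    have h3 := hu.monotone_runningExcess (b := b) (x := x) hg hS hr.2
    have h4 := runningExcess_nonneg (b := b) (z := freeSurplus g x S u) r
    have h5 := hS hr.1
    have h6 := hS hr.2
    have h7 := abs_le.1 h1
    have h8 := abs_le.1 (le_refl |x|)
    have h9 := abs_le.1 (le_refl |S 0|)
    have h10 := abs_le.1 (le_refl |S t|)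
    rw [DividendModel.reflectedPath, freeSurplus, max_eq_left hr.1] at *
    rw [abs_le]
    constructor <;> linarith [h7.1, h7.2, h8.1, h8.2, h9.1, h9.2, h10.1, h10.2]

/-- With weight exp((4K+1)t), integration of the income difference gains K/(4K+1) ≤ 1/4. Reflection
at most doubles a difference, since it subtracts a running supremum that moves by no more than the
free surplus. The factor is therefore 1/2. -/
theorem reflectedPath_sub_le (hu : IsSurplusPath u) (hv : IsSurplusPath v)
    (hg : LipschitzWith K g) (hS : Monotone S) {T a : ℝ} (ha : 0 ≤ a)
    (h : ∀ s ∈ Icc 0 T, |u s - v s| ≤ a * Real.exp ((4 * K + 1) * s)) {t : ℝ} (ht : t ∈ Icc 0 T) :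
    |DividendModel.reflectedPath g b x S u t - DividendModel.reflectedPath g b x S v t|
      ≤ a / 2 * Real.exp ((4 * K + 1) * t) := by
  have hK : (0 : ℝ) ≤ K := K.coe_nonneg
  set c : ℝ := 4 * K + 1 with hc
  have hc0 : 0 < c := by positivity
  set e := K * a / c * Real.exp (c * t) with he
  have he0 : 0 ≤ e := by positivity
  have key : ∀ r ∈ Icc 0 t, |freeSurplus g x S u r - freeSurplus g x S v r| ≤ e := by
    intro r hr
    have hiu := hu.intervalIntegrable hg le_rfl hr.1
    have hiv := hv.intervalIntegrable hg le_rfl hr.1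
    have h1 : freeSurplus g x S u r - freeSurplus g x S v r
        = ∫ s in (0 : ℝ)..r, (g (u s) - g (v s)) := by
      rw [intervalIntegral.integral_sub hiu hiv, freeSurplus, freeSurplus, max_eq_left hr.1]
      ring
    rw [h1]
    refine (intervalIntegral.abs_integral_le_integral_abs hr.1).trans ?_
    have h2 := integral_le_exp_weight (u := fun s => |g (u s) - g (v s)|) (s := 0) (r := r)
      (m := K * a) (c := c) hc0 hr.1 (by positivity) (hiu.sub hiv).abs fun s hs => by
        have h3 := hg.dist_le_mul (u s) (v s)
        rw [Real.dist_eq, Real.dist_eq] at h3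
        have h4 := mul_le_mul_of_nonneg_left (h s ⟨hs.1, hs.2.trans (hr.2.trans ht.2)⟩) hK
        rw [sub_zero, mul_assoc]
        exact h3.trans h4
    refine h2.trans ?_
    rw [sub_zero, he]
    have : Real.exp (c * r) ≤ Real.exp (c * t) :=
      Real.exp_le_exp.2 (mul_le_mul_of_nonneg_left hr.2 hc0.le)
    gcongr
  obtain ⟨a1, ha1⟩ := hu.freeSurplus_bddAbove (x := x) hg hS t
  obtain ⟨a2, ha2⟩ := hv.freeSurplus_bddAbove (x := x) hg hS t
  have h1 := runningExcess_le_add (b := b) (z := freeSurplus g x S u) ha2 he0 fun r hr => by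
    linarith [(abs_le.1 (key r hr)).2]
  have h2 := runningExcess_le_add (b := b) (z := freeSurplus g x S v) ha1 he0 fun r hr => by
    linarith [(abs_le.1 (key r hr)).1]
  have h3 := abs_le.1 (key t ⟨ht.1, le_rfl⟩)
  have h4 : 2 * e ≤ a / 2 * Real.exp (c * t) := by
    have h5 : K * a / c ≤ a / 4 := by
      rw [div_le_iff₀ hc0, hc]
      nlinarith
    have h6 := mul_le_mul_of_nonneg_right h5 (Real.exp_pos (c * t)).le
    rw [← he] at h6
    linarith
  rw [DividendModel.reflectedPath, DividendModel.reflectedPath, abs_le]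
  constructor <;> linarith [h3.1, h3.2]

end IsSurplusPath

/-- Picard iterates for the reflected equation. -/
noncomputable def picard (g : ℝ → ℝ) (b x : ℝ) (S : ℝ → ℝ) : ℕ → ℝ → ℝ
  | 0 => fun _ => x
  | n + 1 => reflectedPath g b x S (picard g b x S n)

/-- The surplus under the barrier strategy. -/
noncomputable def barrierSurplus (g : ℝ → ℝ) (b x : ℝ) (S : ℝ → ℝ) (t : ℝ) : ℝ :=
  limUnder atTop fun n => picard g b x S n t

theorem isSurplusPath_picard (hg : LipschitzWith K g) (hS : Monotone S) (n : ℕ) :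
    IsSurplusPath (picard g b x S n) := by
  induction n with
  | zero => exact ⟨measurable_const, fun _ => ⟨|x|, fun _ _ => le_rfl⟩⟩
  | succ n ih => exact ih.reflectedPath hg hS

theorem picard_of_neg (hS0 : S 0 = 0) {t : ℝ} (ht : t < 0) (n : ℕ) : picard g b x S n t = x := by
  cases n with
  | zero => rfl
  | succ n => exact IsSurplusPath.reflectedPath_of_neg hS0 ht

theorem picard_succ_sub_le (hg : LipschitzWith K g) (hS : Monotone S) (T : ℝ) :
    ∃ C, 0 ≤ C ∧ ∀ n, ∀ t ∈ Icc 0 T, |picard g b x S n t - picard g b x S (n + 1) t|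
      ≤ C * (1 / 2) ^ n * Real.exp ((4 * K + 1) * t) := by
  have h0 := isSurplusPath_picard (b := b) (x := x) hg hS
  obtain ⟨C1, hC1⟩ := (h0 1).bounded T
  refine ⟨|x| + |C1|, by positivity, fun n => ?_⟩
  induction n with
  | zero =>
    intro t ht
    have hK : (0 : ℝ) ≤ K := K.coe_nonneg
    have h1 : 1 ≤ Real.exp ((4 * K + 1) * t) :=
      Real.one_le_exp (mul_nonneg (by positivity) ht.1)
    have h2 : |picard g b x S 0 t - picard g b x S 1 t| ≤ |x| + |C1| :=
      (abs_sub _ _).trans (add_le_add le_rfl ((hC1 t ht).trans (le_abs_self _)))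
    rw [pow_zero, mul_one]
    exact h2.trans (le_mul_of_one_le_right (by positivity) h1)
  | succ n ih =>
    intro t ht
    have h1 := (h0 n).reflectedPath_sub_le (b := b) (x := x) (h0 (n + 1)) hg hS (by positivity)
      ih ht
    refine h1.trans (le_of_eq ?_)
    rw [pow_succ]
    ring

theorem tendsto_picard (hg : LipschitzWith K g) (hS : Monotone S) (hS0 : S 0 = 0) (t : ℝ) :
    Tendsto (fun n => picard g b x S n t) atTop (𝓝 (barrierSurplus g b x S t)) := by
  refine tendsto_nhds_limUnder ?_
  rcases lt_or_ge t 0 with ht | ht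
  · exact ⟨x, tendsto_const_nhds.congr fun n => (picard_of_neg hS0 ht n).symm⟩
  · obtain ⟨C, -, hC⟩ := picard_succ_sub_le (b := b) (x := x) hg hS t
    refine cauchySeq_tendsto_of_complete (cauchySeq_of_le_geometric (1 / 2)
      (C * Real.exp ((4 * K + 1) * t)) (by norm_num) fun n => ?_)
    rw [Real.dist_eq]
    exact (hC n t ⟨ht, le_rfl⟩).trans (le_of_eq (by ring))

theorem barrierSurplus_of_neg (hg : LipschitzWith K g) (hS : Monotone S) (hS0 : S 0 = 0) {t : ℝ}
    (ht : t < 0) : barrierSurplus g b x S t = x :=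
  tendsto_nhds_unique (tendsto_picard hg hS hS0 t)
    (tendsto_const_nhds.congr fun n => (picard_of_neg hS0 ht n).symm)

theorem picard_sub_barrierSurplus_le (hg : LipschitzWith K g) (hS : Monotone S) (hS0 : S 0 = 0)
    (T : ℝ) : ∃ C, 0 ≤ C ∧ ∀ n, ∀ t ∈ Icc 0 T, |picard g b x S n t - barrierSurplus g b x S t|
      ≤ C * (1 / 2) ^ n * Real.exp ((4 * K + 1) * t) := by
  obtain ⟨C, hC0, hC⟩ := picard_succ_sub_le (b := b) (x := x) hg hS T
  refine ⟨2 * C, by positivity, fun n t ht => ?_⟩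
  have h1 := dist_le_of_le_geometric_of_tendsto (1 / 2) (C * Real.exp ((4 * K + 1) * t))
    (by norm_num) (fun n => by
      rw [Real.dist_eq]
      exact (hC n t ht).trans (le_of_eq (by ring)))
    (tendsto_picard (b := b) (x := x) hg hS hS0 t) n
  rw [Real.dist_eq] at h1
  exact h1.trans (le_of_eq (by ring))

theorem isSurplusPath_barrierSurplus (hg : LipschitzWith K g) (hS : Monotone S) (hS0 : S 0 = 0) :
    IsSurplusPath (barrierSurplus g b x S) where
  measurable := measurable_of_tendsto_metrizable
    (fun n => (isSurplusPath_picard hg hS n).measurable)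
    (tendsto_pi_nhds.2 fun t => tendsto_picard hg hS hS0 t)
  bounded := fun T => by
    obtain ⟨C, hC0, hC⟩ := picard_sub_barrierSurplus_le (b := b) (x := x) hg hS hS0 T
    refine ⟨|x| + C * Real.exp ((4 * K + 1) * T), fun t ht => ?_⟩
    have h1 := hC 0 t ht
    have h2 : Real.exp ((4 * K + 1) * t) ≤ Real.exp ((4 * K + 1) * T) :=
      Real.exp_le_exp.2 (mul_le_mul_of_nonneg_left ht.2 (by positivity))
    have h3 := mul_le_mul_of_nonneg_left h2 hC0
    rw [pow_zero, mul_one, abs_sub_comm] at h1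
    have h4 := abs_sub_abs_le_abs_sub (barrierSurplus g b x S t) (picard g b x S 0 t)
    have h5 : |picard g b x S 0 t| = |x| := rfl
    linarith

/-- The iterates converge in the weighted norm on [0,t], and the map is a contraction in it, so the
limit is a fixed point. -/
theorem barrierSurplus_eq (hg : LipschitzWith K g) (hS : Monotone S) (hS0 : S 0 = 0) (t : ℝ) :
    barrierSurplus g b x S t = reflectedPath g b x S (barrierSurplus g b x S) t := by
  rcases lt_or_ge t 0 with ht | ht
  · rw [barrierSurplus_of_neg hg hS hS0 ht, IsSurplusPath.reflectedPath_of_neg hS0 ht]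
  obtain ⟨C, hC0, hC⟩ := picard_sub_barrierSurplus_le (b := b) (x := x) hg hS hS0 t
  have hX := isSurplusPath_barrierSurplus (b := b) (x := x) hg hS hS0
  refine tendsto_nhds_unique ((tendsto_add_atTop_iff_nat 1).2 (tendsto_picard hg hS hS0 t)) ?_
  rw [tendsto_iff_dist_tendsto_zero]
  have h1 : Tendsto (fun n : ℕ => C * (1 / 2) ^ n / 2 * Real.exp ((4 * K + 1) * t)) atTop
      (𝓝 0) := by
    have := (tendsto_pow_atTop_nhds_zero_of_lt_one (r := (1 / 2 : ℝ)) (by norm_num)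
      (by norm_num)).const_mul C
    simpa using (this.div_const 2).mul_const (Real.exp ((4 * K + 1) * t))
  refine squeeze_zero (fun _ => dist_nonneg) (fun n => ?_) h1
  rw [Real.dist_eq]
  exact (isSurplusPath_picard hg hS n).reflectedPath_sub_le hX hg hS (by positivity) (hC n)
    ⟨ht, le_rfl⟩

end Reflection

/-! ### The reflected path is a barrier path -/

section BarrierPath

variable {g : ℝ → ℝ} {K : ℝ≥0} {b x : ℝ} {S : ℝ → ℝ}

theorem IsSurplusPath.continuousWithinAt_freeSurplus {u : ℝ → ℝ} (hu : IsSurplusPath u)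
    (hg : LipschitzWith K g) (hS : IsClaimPath S) {t : ℝ} (ht : 0 ≤ t) :
    ContinuousWithinAt (freeSurplus g x S u) (Ici t) t := by
  have h2 : ContinuousWithinAt (fun t => S (max t 0)) (Ici t) t := by
    obtain ⟨v, hv, hSv⟩ := hS.right_const t ht
    refine continuousWithinAt_const.congr_of_eventuallyEq (f := fun _ => S t) ?_
      (by rw [max_eq_left ht])
    filter_upwards [Ico_mem_nhdsGE hv] with r hr
    rw [max_eq_left (ht.trans hr.1), hSv r hr]
  exact (continuousWithinAt_const.add (hu.continuous_integral hg).continuousWithinAt).sub h2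

theorem IsSurplusPath.continuousWithinAt_runningExcess {u : ℝ → ℝ} (hu : IsSurplusPath u)
    (hg : LipschitzWith K g) (hS : Monotone S) (t : ℝ) :
    ContinuousWithinAt (runningExcess b (freeSurplus g x S u)) (Ici t) t := by
  rcases lt_or_ge t 0 with ht | ht
  · refine (continuousAt_const (y := (0 : ℝ))).continuousWithinAt.congr_of_eventuallyEq ?_
      (runningExcess_of_neg ht)
    filter_upwards [mem_nhdsWithin_of_mem_nhds (Iio_mem_nhds ht)] with v hv
    exact runningExcess_of_neg hv
  · obtain ⟨C, hC0, hC⟩ := hu.runningExcess_sub_le (b := b) (x := x) hg hS (t + 1)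
    have h1 : Tendsto (fun v => runningExcess b (freeSurplus g x S u) t + C * (v - t)) (𝓝[≥] t)
        (𝓝 (runningExcess b (freeSurplus g x S u) t)) := by
      have h2 : Continuous fun v => runningExcess b (freeSurplus g x S u) t + C * (v - t) := by
        fun_prop
      have h3 := (h2.tendsto t).mono_left (nhdsWithin_le_nhds (s := Ici t))
      simpa using h3
    refine tendsto_of_tendsto_of_tendsto_of_le_of_le' tendsto_const_nhds h1 ?_ ?_
    · filter_upwards [self_mem_nhdsWithin] with v hv
      exact hu.monotone_runningExcess hg hS hv
    · filter_upwards [Ico_mem_nhdsGE (lt_add_one t)] with v hv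
      exact hC t v ht hv.1 hv.2.le

/-- The dividends of the barrier strategy. -/
noncomputable def barrierDividends (b x : ℝ) (hg : LipschitzWith K g) (hS : IsClaimPath S) :
    StieltjesFunction ℝ where
  toFun := runningExcess b (freeSurplus g x S (barrierSurplus g b x S))
  mono' := (isSurplusPath_barrierSurplus hg hS.mono hS.zero).monotone_runningExcess hg hS.mono
  right_continuous' :=
    (isSurplusPath_barrierSurplus hg hS.mono hS.zero).continuousWithinAt_runningExcess hg hS.mono

theorem barrierSurplus_add_dividends (hg : LipschitzWith K g)
    (hS : IsClaimPath S) (t : ℝ) :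
    barrierSurplus g b x S t + barrierDividends b x hg hS t
      = freeSurplus g x S (barrierSurplus g b x S) t := by
  have h1 := barrierSurplus_eq (b := b) (x := x) hg hS.mono hS.zero t
  rw [reflectedPath] at h1
  have h2 : barrierDividends b x hg hS t
    = runningExcess b (freeSurplus g x S (barrierSurplus g b x S)) t := rfl
  linarith

theorem isControlledPath_barrier (hg : LipschitzWith K g)
    (hS : IsClaimPath S) :
    IsControlledPath g x S (barrierDividends b x hg hS) (barrierSurplus g b x S) where
  claims := hS
  D_neg := fun _ ht => runningExcess_of_neg ht
  X_neg := fun _ ht => barrierSurplus_of_neg hg hS.mono hS.zero ht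
  integrable := fun _ ht =>
    (isSurplusPath_barrierSurplus hg hS.mono hS.zero).intervalIntegrable hg le_rfl ht
  surplus := fun t ht => by
    have h1 := barrierSurplus_add_dividends (b := b) (x := x) hg hS t
    rw [freeSurplus, max_eq_left ht] at h1
    linarith

theorem freeSurplus_sub_le_dividends (hg : LipschitzWith K g)
    (hS : IsClaimPath S) {r t : ℝ} (hr : r ∈ Icc 0 t) :
    freeSurplus g x S (barrierSurplus g b x S) r - b ≤ barrierDividends b x hg hS t := by
  have hX := isSurplusPath_barrierSurplus (b := b) (x := x) hg hS.mono hS.zero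
  obtain ⟨a, ha⟩ := hX.freeSurplus_bddAbove (x := x) hg hS.mono t
  exact le_runningExcess ha hr

theorem barrierSurplus_le (hg : LipschitzWith K g)
    (hS : IsClaimPath S) {t : ℝ} (ht : 0 ≤ t) : barrierSurplus g b x S t ≤ b := by
  have h1 := barrierSurplus_add_dividends (b := b) (x := x) hg hS t
  have h2 := freeSurplus_sub_le_dividends (b := b) (x := x) hg hS (r := t) ⟨ht, le_rfl⟩
  linarith

theorem barrierDividends_zero (hg : LipschitzWith K g)
    (hS : IsClaimPath S) : barrierDividends b x hg hS 0 = max (x - b) 0 := by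
  have h1 : barrierDividends b x hg hS 0
    = runningExcess b (freeSurplus g x S (barrierSurplus g b x S)) 0 := rfl
  rw [h1, runningExcess_zero, freeSurplus, max_self, intervalIntegral.integral_same, hS.zero]
  simp

theorem continuousOn_barrierDividends (hg : LipschitzWith K g)
    (hS : IsClaimPath S) : ContinuousOn (barrierDividends b x hg hS) (Ici 0) := by
  intro t ht
  have ht0 : (0 : ℝ) ≤ t := ht
  have hX := isSurplusPath_barrierSurplus (b := b) (x := x) hg hS.mono hS.zero
  obtain ⟨C, hC0, hC⟩ := hX.runningExcess_sub_le (b := b) (x := x) hg hS.mono (t + 1)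
  have h1 : Tendsto (fun v => C * |v - t|) (𝓝[Ici 0] t) (𝓝 0) := by
    have h2 : Continuous fun v => C * |v - t| := by fun_prop
    have h3 := (h2.tendsto t).mono_left (nhdsWithin_le_nhds (s := Ici 0))
    simpa using h3
  rw [ContinuousWithinAt, tendsto_iff_dist_tendsto_zero]
  refine squeeze_zero' (Eventually.of_forall fun _ => dist_nonneg) ?_ h1
  filter_upwards [self_mem_nhdsWithin,
    mem_nhdsWithin_of_mem_nhds (Iio_mem_nhds (lt_add_one t))] with v hv hv'
  have hmono := (barrierDividends b x hg hS).mono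
  rw [Real.dist_eq]
  rcases le_total v t with h | h
  · have h3 : barrierDividends b x hg hS t ≤ barrierDividends b x hg hS v + C * (t - v) :=
      hC v t hv h (by linarith)
    rw [abs_of_nonpos (sub_nonpos.2 (hmono h)), abs_of_nonpos (sub_nonpos.2 h)]
    linarith
  · have h3 : barrierDividends b x hg hS v ≤ barrierDividends b x hg hS t + C * (v - t) :=
      hC t v ht0 h (le_of_lt hv')
    rw [abs_of_nonneg (sub_nonneg.2 (hmono h)), abs_of_nonneg (sub_nonneg.2 h)]
    linarith

theorem intervalIntegrable_barrier_indicator (hg : LipschitzWith K g)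
    (hS : IsClaimPath S) (s t : ℝ) :
    IntervalIntegrable ({s | barrierSurplus g b x S s = b}.indicator fun _ => g b) volume s t := by
  have hX := (isSurplusPath_barrierSurplus (b := b) (x := x) hg hS.mono hS.zero).measurable
  exact ⟨(integrable_const _).indicator (hX (measurableSet_singleton b)),
    (integrable_const _).indicator (hX (measurableSet_singleton b))⟩

/-- If X(t) < b, the free surplus Z stays strictly below its running maximum level for a while and D
is constant. If X(t) = b, then until the next claim and while X > 0 the income is nonnegative, so Z
is nondecreasing, its supremum is the current value, X stays at b, and D grows by the whole income.
Positivity of b supplies X > 0 nearby. -/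
theorem eventually_barrierDividends (hg : LipschitzWith K g)
    (hS : IsClaimPath S) (hb : 0 < b) (hgn : ∀ z, 0 ≤ z → 0 ≤ g z) {t : ℝ}
    (ht : 0 ≤ t) : ∀ᶠ r in 𝓝[≥] t, barrierDividends b x hg hS r = barrierDividends b x hg hS t
      + ∫ s in t..r, {s | barrierSurplus g b x S s = b}.indicator (fun _ => g b) s := by
  set X := barrierSurplus g b x S with hXdef
  set D := barrierDividends b x hg hS with hD
  set Z := freeSurplus g x S X with hZ
  have hX : IsSurplusPath X := isSurplusPath_barrierSurplus hg hS.mono hS.zero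
  have hp : IsControlledPath g x S D X := isControlledPath_barrier hg hS
  have hXD : ∀ t, X t + D t = Z t := barrierSurplus_add_dividends hg hS
  have hZD : ∀ {r t}, r ∈ Icc 0 t → Z r - b ≤ D t := freeSurplus_sub_le_dividends hg hS
  have hDle : ∀ {t a}, 0 ≤ a → (∀ r ∈ Icc 0 t, Z r - b ≤ a) → D t ≤ a := fun ha h =>
    runningExcess_le ha h
  have hXc := hp.continuousWithinAt ht
  have hD0 := hp.D_nonneg t
  rcases (barrierSurplus_le hg hS ht : X t ≤ b).lt_or_eq with hlt | heq
  · have hZc : ContinuousWithinAt Z (Ici t) t :=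
      (hXc.add (D.right_continuous t)).congr (fun v _ => (hXD v).symm) (hXD t).symm
    have h1 : ∀ᶠ r in 𝓝[≥] t, X r < b ∧ Z r < D t + b :=
      (hXc.eventually (Iio_mem_nhds hlt)).and
        (hZc.eventually (Iio_mem_nhds (by linarith [hXD t])))
    obtain ⟨u, hu, hu'⟩ := mem_nhdsGE_iff_exists_Ico_subset.1 h1
    filter_upwards [Ico_mem_nhdsGE hu] with r hr
    have h2 : D r = D t := by
      refine le_antisymm (hDle hD0 fun v hv => ?_) (D.mono hr.1)
      rcases le_total v t with h | h
      · exact hZD ⟨hv.1, h⟩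
      · linarith [(hu' ⟨h, hv.2.trans_lt hr.2⟩).2]
    rw [h2, intervalIntegral.integral_congr (g := fun _ => (0 : ℝ)) fun v hv => ?_]
    · simp
    · rw [uIcc_of_le hr.1] at hv
      have h3 : X v < b := (hu' ⟨hv.1, hv.2.trans_lt hr.2⟩).1
      exact indicator_of_notMem (fun h => h3.ne h) _
  · obtain ⟨u1, hu1, hS1⟩ := hS.right_const t ht
    obtain ⟨u2, hu2, hX2⟩ := mem_nhdsGE_iff_exists_Ico_subset.1
      (hXc.eventually (Ioi_mem_nhds (show 0 < X t from hb.trans_eq heq.symm)))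
    have hmono : ∀ v r, t ≤ v → v ≤ r → r < min u1 u2 → Z v ≤ Z r := fun v r hv hvr hr => by
      have h1 := hX.freeSurplus_eq (x := x) (S := S) hg (ht.trans hv) hvr
      have h2 : 0 ≤ ∫ s in v..r, g (X s) := intervalIntegral.integral_nonneg hvr fun s hs =>
        hgn _ (le_of_lt (hX2 ⟨hv.trans hs.1, (hs.2.trans_lt hr).trans_le (min_le_right _ _)⟩))
      rw [hS1 r ⟨hv.trans hvr, hr.trans_le (min_le_left _ _)⟩,
        hS1 v ⟨hv, (hvr.trans_lt hr).trans_le (min_le_left _ _)⟩] at h1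
      linarith
    have hDZ : ∀ r ∈ Ico t (min u1 u2), D r = Z r - b := fun r hr => by
      have h1 := hXD t
      have h2 := hmono t r le_rfl hr.1 hr.2
      refine le_antisymm (hDle (by linarith) fun v hv => ?_) (hZD ⟨ht.trans hr.1, le_rfl⟩)
      rcases le_total v t with h | h
      · linarith [hZD ⟨hv.1, h⟩]
      · linarith [hmono v r h hv.2 hr.2]
    have hXb : ∀ r ∈ Ico t (min u1 u2), X r = b := fun r hr => by
      linarith [hXD r, hDZ r hr]
    filter_upwards [Ico_mem_nhdsGE (lt_min hu1 hu2)] with r hr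
    have h1 := hX.freeSurplus_eq (x := x) (S := S) hg ht hr.1
    rw [hS1 r ⟨hr.1, hr.2.trans_le (min_le_left _ _)⟩] at h1
    have h2 : ∫ s in t..r, g (X s)
        = ∫ s in t..r, {s | X s = b}.indicator (fun _ => g b) s := by
      refine intervalIntegral.integral_congr fun v hv => ?_
      rw [uIcc_of_le hr.1] at hv
      have h3 : X v = b := hXb v ⟨hv.1, hv.2.trans_lt hr.2⟩
      rw [indicator_of_mem (show v ∈ {s | X s = b} from h3), h3]
    rw [← h2]
    linarith [hDZ r hr, hDZ t ⟨le_rfl, lt_min hu1 hu2⟩]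

/-- The local identity to the right says that D minus the integral is locally constant to the right;
being continuous, it is constant. -/
theorem barrierDividends_eq (hg : LipschitzWith K g)
    (hS : IsClaimPath S) (hb : 0 < b) (hgn : ∀ z, 0 ≤ z → 0 ≤ g z) {t : ℝ}
    (ht : 0 ≤ t) : barrierDividends b x hg hS t = barrierDividends b x hg hS 0
      + ∫ s in (0 : ℝ)..t, {s | barrierSurplus g b x S s = b}.indicator (fun _ => g b) s := by
  have hi := intervalIntegrable_barrier_indicator (b := b) (x := x) hg hS
  have hcont : ContinuousOn (fun t => barrierDividends b x hg hS t
      - ∫ s in (0 : ℝ)..t, {s | barrierSurplus g b x S s = b}.indicator (fun _ => g b) s)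
      (Icc 0 t) :=
    ((continuousOn_barrierDividends hg hS).mono Icc_subset_Ici_self).sub
      (intervalIntegral.continuous_primitive hi 0).continuousOn
  have h1 := constant_of_has_deriv_right_zero hcont (fun r hr => ?_) t ⟨ht, le_rfl⟩
  · simp only [intervalIntegral.integral_same, sub_zero] at h1
    linarith
  · refine (hasDerivWithinAt_const r (Ici r) (barrierDividends b x hg hS r - ∫ s in (0 : ℝ)..r,
      {s | barrierSurplus g b x S s = b}.indicator (fun _ => g b) s)).congr_of_eventuallyEq ?_ rfl
    filter_upwards [eventually_barrierDividends (x := x) hg hS hb hgn hr.1] with v hv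
    rw [hv, ← intervalIntegral.integral_add_adjacent_intervals (hi 0 r) (hi r v)]
    ring

theorem jump_barrierDividends (hg : LipschitzWith K g)
    (hS : IsClaimPath S) {t : ℝ} (ht : 0 < t) : jump (barrierDividends b x hg hS) t = 0 := by
  have h1 : Function.leftLim (barrierDividends b x hg hS) t = barrierDividends b x hg hS t := by
    refine leftLim_eq_of_tendsto ?_
    have h2 := (continuousOn_barrierDividends (b := b) (x := x) hg hS t ht.le).continuousAt
      (Ici_mem_nhds ht)
    exact h2.tendsto.mono_left nhdsWithin_le_nhds
  rw [jump, h1, sub_self]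

theorem jump_barrierDividends_zero (hg : LipschitzWith K g)
    (hS : IsClaimPath S) :
    jump (barrierDividends b x hg hS) 0 = max (x - b) 0 := by
  rw [jump, (isControlledPath_barrier hg hS).leftLim_D_zero, sub_zero, barrierDividends_zero]

/-- At 0 the payment is the positive part of x - b, at most x. Later there is no jump, and the left
limit of X exists because claims are constant just before t; it is a limit of values before ruin,
hence nonnegative. -/
theorem jump_barrierDividends_le (hg : LipschitzWith K g)
    (hS : IsClaimPath S) (hb : 0 < b) (hx : 0 ≤ x) {t : ℝ} (ht : 0 ≤ t)
    (hτ : (t : EReal) ≤ ruinTime (barrierSurplus g b x S)) :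
    jump (barrierDividends b x hg hS) t ≤ Function.leftLim (barrierSurplus g b x S) t := by
  have hp := isControlledPath_barrier (b := b) (x := x) hg hS
  rcases ht.eq_or_lt with rfl | ht'
  · have h2 : Function.leftLim (barrierSurplus g b x S) 0 = x := by
      refine leftLim_eq_of_tendsto (tendsto_const_nhds.congr' ?_)
      filter_upwards [self_mem_nhdsWithin] with v hv
      exact (hp.X_neg v hv).symm
    rw [jump_barrierDividends_zero, h2]
    exact max_le (by linarith) hx
  · rw [jump_barrierDividends hg hS ht']
    obtain ⟨s, hs0, hst, hs⟩ := hS.left_const t ht'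
    have h1 : Tendsto (fun v => x + (∫ r in (0 : ℝ)..v, g (barrierSurplus g b x S r)) - S s
        - barrierDividends b x hg hS v) (𝓝[<] t)
        (𝓝 (x + (∫ r in (0 : ℝ)..t, g (barrierSurplus g b x S r)) - S s
        - barrierDividends b x hg hS t)) := by
      have h2 := ((hp.continuousOn_drift t ht).continuousAt (Ici_mem_nhds ht')).tendsto
      have h3 := ((continuousOn_barrierDividends (b := b) (x := x) hg hS t ht).continuousAt
        (Ici_mem_nhds ht')).tendsto
      exact (((h2.const_add x).sub_const (S s)).sub h3).mono_left nhdsWithin_le_nhds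
    have h2 : Tendsto (barrierSurplus g b x S) (𝓝[<] t)
        (𝓝 (x + (∫ r in (0 : ℝ)..t, g (barrierSurplus g b x S r)) - S s
        - barrierDividends b x hg hS t)) := by
      refine h1.congr' ?_
      filter_upwards [Ico_mem_nhdsLT hst] with v hv
      rw [hp.surplus v (hs0.trans hv.1), hs v hv]
    rw [leftLim_eq_of_tendsto h2]
    refine ge_of_tendsto h2 ?_
    filter_upwards [Ico_mem_nhdsLT hst] with v hv
    exact nonneg_of_lt_ruinTime (hs0.trans hv.1)
      (lt_of_lt_of_le (by exact_mod_cast hv.2) hτ)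

theorem tsum_jump_barrierDividends (hg : LipschitzWith K g)
    (hS : IsClaimPath S) {t : ℝ} (ht : 0 ≤ t) :
    ∑' s : Icc (0 : ℝ) t, jump (barrierDividends b x hg hS) (s : ℝ)
      = barrierDividends b x hg hS 0 := by
  rw [tsum_eq_single (⟨0, le_rfl, ht⟩ : Icc (0 : ℝ) t) fun s hs => ?_]
  · rw [jump_barrierDividends_zero, barrierDividends_zero]
  · exact jump_barrierDividends hg hS
      (lt_of_le_of_ne s.2.1 fun h => hs (Subtype.ext h.symm))

end BarrierPath

/-! ### Adaptedness and existence of the barrier strategy -/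

section Measurability

variable {Ω : Type*} [MeasurableSpace Ω] {X : Ω → ℝ → ℝ} {t : ℝ}

/-- Grid points approaching s from the right, where the paths are continuous, and capped at t so
that only values known by time t are used. -/
theorem tendsto_grid_above {s : ℝ} (h0 : 0 ≤ s) (hs : s < t) :
    Tendsto (fun n : ℕ => max 0 (min (((⌊s * (n + 1)⌋ : ℤ) + 1 : ℝ) / (n + 1)) t)) atTop
      (𝓝[≥] s) := by
  have h1 : ∀ n : ℕ, s ≤ max 0 (min (((⌊s * (n + 1)⌋ : ℤ) + 1 : ℝ) / (n + 1)) t) := fun n => by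
    refine le_max_of_le_right (le_min ?_ hs.le)
    rw [le_div_iff₀ (by positivity)]
    exact (Int.lt_floor_add_one _).le
  refine tendsto_nhdsWithin_iff.2 ⟨?_, Eventually.of_forall h1⟩
  refine tendsto_of_tendsto_of_tendsto_of_le_of_le (g := fun _ => s)
    (h := fun n : ℕ => s + 1 / ((n : ℝ) + 1)) tendsto_const_nhds ?_ h1 fun n => ?_
  · simpa using (tendsto_one_div_add_atTop_nhds_zero_nat (𝕜 := ℝ)).const_add s
  · have h2 : (0 : ℝ) < n + 1 := by positivity
    refine max_le (by positivity) ((min_le_left _ _).trans ?_)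
    rw [div_le_iff₀ h2, add_mul, one_div_mul_cancel h2.ne']
    linarith [Int.floor_le (s * (n + 1 : ℝ))]

/-- Sampling the path at such grid points gives jointly measurable approximations, because their
index runs over a countable set; right-continuity passes to the limit and Fubini integrates out
time. The σ-algebra is arbitrary, which allows the use with the one at time t. -/
theorem measurable_integral_of_rightContinuous {g : ℝ → ℝ} (hg : Continuous g) (ht : 0 ≤ t)
    (hm : ∀ s ∈ Icc 0 t, Measurable fun ω => X ω s)
    (hc : ∀ ω, ∀ s ∈ Ico 0 t, ContinuousWithinAt (X ω) (Ici s) s) :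
    Measurable fun ω => ∫ s in (0 : ℝ)..t, g (X ω s) := by
  set c : ℕ → ℤ → ℝ := fun n j => max 0 (min ((j + 1 : ℝ) / (n + 1)) t) with hcdef
  have hcm : ∀ n j, c n j ∈ Icc 0 t := fun n j =>
    ⟨le_max_left _ _, max_le ht (min_le_right _ _)⟩
  have hf : ∀ n : ℕ, Measurable fun p : Ω × ℝ => X p.1 (c n ⌊p.2 * (n + 1)⌋) := fun n => by
    have h1 : Measurable fun p : Ω × ℤ => X p.1 (c n p.2) :=
      measurable_from_prod_countable_left fun j => hm _ (hcm n j)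
    exact h1.comp (measurable_fst.prodMk
      (Int.measurable_floor.comp (measurable_snd.mul_const _)))
  have hG : Measurable fun p : Ω × ℝ => (Ico 0 t).indicator (fun s => g (X p.1 s)) p.2 := by
    refine measurable_of_tendsto_metrizable (f := fun (n : ℕ) (p : Ω × ℝ) =>
      (Prod.snd ⁻¹' Ico 0 t).indicator
        (fun p : Ω × ℝ => g (X p.1 (c n ⌊p.2 * (n + 1)⌋))) p) (fun n =>
      (hg.measurable.comp (hf n)).indicator (measurable_snd measurableSet_Ico))
      (tendsto_pi_nhds.2 fun p => ?_)
    by_cases hp : p.2 ∈ Ico 0 t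
    · simp only [indicator_of_mem hp, indicator_of_mem (show p ∈ Prod.snd ⁻¹' Ico 0 t from hp)]
      exact (hg.tendsto _).comp ((hc p.1 p.2 hp).tendsto.comp (tendsto_grid_above hp.1 hp.2))
    · simp only [indicator_of_notMem hp,
        indicator_of_notMem (show p ∉ Prod.snd ⁻¹' Ico 0 t from hp)]
      exact tendsto_const_nhds
  have h1 := (hG.stronglyMeasurable.integral_prod_right' (ν := volume)).measurable
  have h2 : (fun ω => ∫ s in (0 : ℝ)..t, g (X ω s))
      = fun ω => ∫ s, (Ico 0 t).indicator (fun s => g (X ω s)) s := by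
    funext ω
    rw [intervalIntegral.integral_of_le ht, ← integral_Ico_eq_integral_Ioc,
      ← integral_indicator measurableSet_Ico]
  rw [h2]
  exact h1

theorem measurable_runningExcess {b : ℝ} (ht : 0 ≤ t)
    (hm : ∀ s ∈ Icc 0 t, Measurable fun ω => X ω s)
    (hc : ∀ ω, ∀ s ∈ Ico 0 t, ContinuousWithinAt (X ω) (Ici s) s)
    (hb : ∀ ω, ∃ a, ∀ s ∈ Icc 0 t, X ω s ≤ a) :
    Measurable fun ω => runningExcess b (X ω) t := by
  refine measurable_of_Iic fun a => ?_
  rcases lt_or_ge a 0 with ha | ha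
  · rw [show (fun ω => runningExcess b (X ω) t) ⁻¹' Iic a = ∅ from
      eq_empty_of_forall_notMem fun ω hω =>
        absurd ((runningExcess_nonneg t).trans hω) (not_le.2 ha)]
    exact MeasurableSet.empty
  · have h1 : (fun ω => runningExcess b (X ω) t) ⁻¹' Iic a
        = (⋂ q : ℚ, {ω | (q : ℝ) ∈ Icc 0 t → X ω q - b ≤ a}) ∩ {ω | X ω t - b ≤ a} := by
      ext ω
      obtain ⟨B, hB⟩ := hb ω
      simp only [mem_preimage, mem_Iic, mem_inter_iff, mem_iInter, mem_ofPred_eq]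
      refine ⟨fun h => ⟨fun q hq => (le_runningExcess hB hq).trans h,
        (le_runningExcess hB ⟨ht, le_rfl⟩).trans h⟩, fun ⟨h2, h3⟩ =>
        runningExcess_le ha fun r hr => ?_⟩
      rcases hr.2.eq_or_lt with h4 | h4
      · rwa [h4]
      · by_contra hcon
        have h5 : ∀ᶠ v in 𝓝[≥] r, a + b < X ω v :=
          (hc ω r ⟨hr.1, h4⟩).eventually (Ioi_mem_nhds (by linarith [not_le.1 hcon]))
        obtain ⟨d, hd, hd'⟩ := mem_nhdsGE_iff_exists_Ico_subset.1 h5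
        obtain ⟨q, hq1, hq2⟩ := exists_rat_btwn (lt_min h4 hd)
        have h6 : a + b < X ω q := hd' ⟨hq1.le, hq2.trans_le (min_le_right _ _)⟩
        linarith [h2 q ⟨hr.1.trans hq1.le, (hq2.trans_le (min_le_left _ _)).le⟩]
    rw [h1]
    refine MeasurableSet.inter (MeasurableSet.iInter fun q => ?_)
      (((hm t ⟨ht, le_rfl⟩).sub_const b) measurableSet_Iic)
    by_cases hq : (q : ℝ) ∈ Icc 0 t
    · simp only [hq, true_imp_iff]
      exact ((hm q hq).sub_const b) measurableSet_Iic
    · simp [hq]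

end Measurability

section

variable {Ω : Type*} [mΩ : MeasurableSpace Ω] {P : Measure Ω} {ℱ : Filtration ℝ≥0 mΩ}
  {lam α : ℝ} {T Y : ℕ → Ω → ℝ} {g : ℝ → ℝ} {K : ℝ≥0}

namespace IsClaimProcess

theorem isClaimPath (hc : IsClaimProcess P ℱ lam α T Y) (ω : Ω) :
    IsClaimPath fun t => aggregateClaims T Y t ω :=
  isClaimPath_aggregateClaims (hc.T_zero ω) (hc.T_strictMono ω) (hc.T_tendsto ω)
    fun i => hc.Y_nonneg i ω

theorem adapted_freeSurplus (hc : IsClaimProcess P ℱ lam α T Y) (hg : LipschitzWith K g) (x : ℝ)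
    {u : Ω → ℝ → ℝ}
    (hm : ∀ t : ℝ≥0, Measurable[ℱ t] fun ω => u ω t)
    (hr : ∀ ω t, 0 ≤ t → ContinuousWithinAt (u ω) (Ici t) t) (t : ℝ≥0) :
    Measurable[ℱ t] fun ω => freeSurplus g x (fun t => aggregateClaims T Y t ω) (u ω) t := by
  have h1 : Measurable[ℱ t] fun ω => ∫ s in (0 : ℝ)..t, g (u ω s) :=
    @measurable_integral_of_rightContinuous Ω (ℱ t) u t g hg.continuous t.coe_nonneg
      (fun s hs => (hm ⟨s, hs.1⟩).mono (ℱ.mono (show (⟨s, hs.1⟩ : ℝ≥0) ≤ t from hs.2)) le_rfl)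
      fun ω _ hs => hr ω _ hs.1
  unfold freeSurplus
  simp only [max_eq_left t.coe_nonneg]
  exact (h1.const_add x).sub (hc.adapted_claims t)

theorem adapted_runningExcess (hc : IsClaimProcess P ℱ lam α T Y) (hg : LipschitzWith K g)
    (b x : ℝ) {u : Ω → ℝ → ℝ} (hu : ∀ ω, IsSurplusPath (u ω))
    (hm : ∀ t : ℝ≥0, Measurable[ℱ t] fun ω => u ω t)
    (hr : ∀ ω t, 0 ≤ t → ContinuousWithinAt (u ω) (Ici t) t) (t : ℝ≥0) :
    Measurable[ℱ t] fun ω =>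
      runningExcess b (freeSurplus g x (fun t => aggregateClaims T Y t ω) (u ω)) t :=
  @measurable_runningExcess Ω (ℱ t)
    (fun ω => freeSurplus g x (fun t => aggregateClaims T Y t ω) (u ω)) t b t.coe_nonneg
    (fun s hs => (hc.adapted_freeSurplus hg x hm hr ⟨s, hs.1⟩).mono
      (ℱ.mono (show (⟨s, hs.1⟩ : ℝ≥0) ≤ t from hs.2)) le_rfl)
    (fun ω _ hs => (hu ω).continuousWithinAt_freeSurplus hg (hc.isClaimPath ω) hs.1)
    fun ω => (hu ω).freeSurplus_bddAbove hg (hc.isClaimPath ω).mono t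

/-- Adaptedness and right-continuity are carried through the iteration together, since the time
integral of the next iterate needs both. -/
theorem adapted_picard (hc : IsClaimProcess P ℱ lam α T Y) (hg : LipschitzWith K g) (b x : ℝ)
    (n : ℕ) : (∀ t : ℝ≥0, Measurable[ℱ t] fun ω =>
        picard g b x (fun t => aggregateClaims T Y t ω) n t) ∧
      ∀ ω t, 0 ≤ t → ContinuousWithinAt
        (picard g b x (fun t => aggregateClaims T Y t ω) n) (Ici t) t := by
  induction n with
  | zero => exact ⟨fun _ => measurable_const, fun _ _ _ => continuousWithinAt_const⟩
  | succ n ih =>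
    have hu : ∀ ω, IsSurplusPath (picard g b x (fun t => aggregateClaims T Y t ω) n) := fun ω =>
      isSurplusPath_picard hg (hc.isClaimPath ω).mono n
    exact ⟨fun t => (hc.adapted_freeSurplus hg x ih.1 ih.2 t).sub
      (hc.adapted_runningExcess hg b x hu ih.1 ih.2 t), fun ω t ht =>
      ((hu ω).continuousWithinAt_freeSurplus hg (hc.isClaimPath ω) ht).sub
        ((hu ω).continuousWithinAt_runningExcess hg (hc.isClaimPath ω).mono t)⟩

theorem adapted_barrierSurplus (hc : IsClaimProcess P ℱ lam α T Y) (hg : LipschitzWith K g)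
    (b x : ℝ) (t : ℝ≥0) : Measurable[ℱ t] fun ω =>
      barrierSurplus g b x (fun t => aggregateClaims T Y t ω) t :=
  @measurable_of_tendsto_metrizable Ω ℝ (ℱ t) _ _ _ _ _ _
    (fun n => (hc.adapted_picard hg b x n).1 t) (tendsto_pi_nhds.2 fun ω =>
      tendsto_picard hg (hc.isClaimPath ω).mono (hc.isClaimPath ω).zero t)

theorem exists_barrier (hc : IsClaimProcess P ℱ lam α T Y) (hg : LipschitzWith K g)
    (hgn : ∀ z, 0 ≤ z → 0 ≤ g z) {b x : ℝ} (hb : 0 < b) (hx : 0 ≤ x) :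
    ∃ (D : Ω → StieltjesFunction ℝ) (X : Ω → ℝ → ℝ), IsAdmissible ℱ g T Y x D X
      ∧ IsBarrier g b D X := by
  have hp := fun ω => isControlledPath_barrier (b := b) (x := x) hg (hc.isClaimPath ω)
  refine ⟨fun ω => barrierDividends b x hg (hc.isClaimPath ω),
    fun ω => barrierSurplus g b x fun t => aggregateClaims T Y t ω, ?_, ?_⟩
  · exact
    { D_neg := fun ω => (hp ω).D_neg
      X_neg := fun ω => (hp ω).X_neg
      adapted_D := hc.adapted_runningExcess hg b x
        (fun ω => isSurplusPath_barrierSurplus hg (hc.isClaimPath ω).mono (hc.isClaimPath ω).zero)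
        (hc.adapted_barrierSurplus hg b x) fun ω t ht => (hp ω).continuousWithinAt ht
      adapted_X := hc.adapted_barrierSurplus hg b x
      integrable := fun ω => (hp ω).integrable
      surplus := fun ω => (hp ω).surplus
      jump_le := fun ω t ht hτ => jump_barrierDividends_le hg (hc.isClaimPath ω) hb hx ht hτ }
  · refine ⟨fun ω t ht => ?_, fun ω t ht => ?_⟩
    · rcases ht.eq_or_lt with rfl | ht'
      · have h1 := (hp ω).surplus 0 le_rfl
        rw [intervalIntegral.integral_same, (hc.isClaimPath ω).zero, barrierDividends_zero] at h1
        rw [jump_barrierDividends_zero, h1]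
        congr 1
        ring
      · have h1 := barrierSurplus_le (b := b) (x := x) hg (hc.isClaimPath ω) ht
        rw [jump_barrierDividends hg _ ht', add_zero, max_eq_right (by linarith)]
    · rw [tsum_jump_barrierDividends hg _ ht,
        barrierDividends_eq hg (hc.isClaimPath ω) hb hgn ht]
      ring

end IsClaimProcess

end

end DividendModel

theorem theorem4p4 {Ω : Type*} [mΩ : MeasurableSpace Ω]
    (P : Measure Ω) [IsProbabilityMeasure P] (ℱ : Filtration ℝ≥0 mΩ)
    (lam δ α : ℝ) (hlam : 0 < lam) (hδ : 0 < δ) (hα : 0 < α)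
    (T Y : ℕ → Ω → ℝ) (hclaims : DividendModel.IsClaimProcess P ℱ lam α T Y)
    (g : ℝ → ℝ) (K : ℝ≥0) (hg : LipschitzWith K g) (hg_nonneg : ∀ z, 0 ≤ z → 0 ≤ g z)
    (ψ : ℝ → ℝ) (b : ℝ) (hψ : DividendModel.IsBarrierSolution g lam δ α ψ b)
    (x : ℝ) (hx : 0 ≤ x) :
    -- the barrier strategy exists and is admissible
    (∃ (D : Ω → StieltjesFunction ℝ) (X : Ω → ℝ → ℝ),
      DividendModel.IsAdmissible ℱ g T Y x D X ∧ DividendModel.IsBarrier g b D X) ∧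
    -- its expected present value is the candidate function; the surplus never exceeds `b`,
    -- and once at `b` it stays there until the next claim
    (∀ (D : Ω → StieltjesFunction ℝ) (X : Ω → ℝ → ℝ),
      DividendModel.IsAdmissible ℱ g T Y x D X → DividendModel.IsBarrier g b D X →
        DividendModel.epv P δ D X = ENNReal.ofReal (DividendModel.candidate ψ b x) ∧
        DividendModel.epv P δ D X = DividendModel.value P ℱ g δ T Y x ∧
        (∀ ω t, 0 ≤ t → X ω t ≤ b) ∧
        (∀ ω s t, 0 ≤ s → s ≤ t → X ω s = b →
          DividendModel.claimCount T s ω = DividendModel.claimCount T t ω → X ω t = b)) ∧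
    -- the candidate function is the value function
    0 ≤ DividendModel.candidate ψ b x ∧
    DividendModel.value P ℱ g δ T Y x = ENNReal.ofReal (DividendModel.candidate ψ b x) := by
  have hΦ := hψ.isVerification hg hg_nonneg hlam hδ hα
  have hb := hψ.b_pos
  have hex := hclaims.exists_barrier (x := x) hg hg_nonneg hb hx
  have hΦx : DividendModel.candidate ψ b (max x 0) = DividendModel.candidate ψ b x := by
    rw [max_eq_left hx]
  have hub : ∀ (D : Ω → StieltjesFunction ℝ) (X : Ω → ℝ → ℝ),
      DividendModel.IsAdmissible ℱ g T Y x D X →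
        DividendModel.epv P δ D X ≤ ENNReal.ofReal (DividendModel.candidate ψ b x) :=
    fun D X hA => by
      have h1 := hA.epv_le hclaims hΦ hg hg_nonneg hlam hδ hα hx
      rwa [hΦx] at h1
  have heq : ∀ (D : Ω → StieltjesFunction ℝ) (X : Ω → ℝ → ℝ),
      DividendModel.IsAdmissible ℱ g T Y x D X → DividendModel.IsBarrier g b D X →
        DividendModel.epv P δ D X = ENNReal.ofReal (DividendModel.candidate ψ b x) :=
    fun D X hA hB => by
      refine le_antisymm (hub D X hA) ?_
      -- Above b the candidate has slope exactly 1, so the initial lump payment down to b preserves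
      -- its value.
      have hlin : DividendModel.candidate ψ b (max x 0)
          ≤ DividendModel.candidate ψ b (max (min x b) 0) + max (x - b) 0 := by
        rw [hψ.candidate_eq, hψ.candidate_of_le (min_le_right x b)]
      have h1 := hA.barrier_le_epv hclaims hB hΦ hg hg_nonneg hlam hδ hα hx hlin
      rwa [hΦx] at h1
  have hval : DividendModel.value P ℱ g δ T Y x
      = ENNReal.ofReal (DividendModel.candidate ψ b x) := by
    obtain ⟨D, X, hA, hB⟩ := hex
    refine le_antisymm (iSup_le fun D => iSup_le fun X => iSup_le fun hA => hub D X hA) ?_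
    rw [← heq D X hA hB]
    exact le_iSup_of_le D (le_iSup_of_le X (le_iSup_of_le hA le_rfl))
  refine ⟨hex, fun D X hA hB => ⟨heq D X hA hB, by rw [heq D X hA hB, hval], ?_, ?_⟩, ?_, hval⟩
  · exact fun ω t ht => (hB.isBarrierPath hg.continuous
      (hA.isControlledPath hclaims ω)).le_barrier t ht
  · intro ω s t hs hst hXs hN
    have hp := hB.isBarrierPath hg.continuous (hA.isControlledPath hclaims ω)
    refine hp.eq_barrier hg (hg_nonneg b hb.le) hs ?_ hXs t ⟨hst, le_rfl⟩
    simp only [DividendModel.aggregateClaims, hN]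
  · rw [← hΦx]
    exact hΦ.nonneg x
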